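/- **Conventions.** Languages are first-order and arbitrary (of any cardinality); theories need not be complete. A theory $T$ is *model complete* if every embedding between models of $T$ is elementary. $T$ *eliminates $\exists^\infty$* if for every formula $\phi(t,y)$, $t$ a single variable, there is a formula $\theta(y)$ such that for all $M\models T$ and all tuples $b$ of $M$: $M\models\theta(b)$ if and only if $\phi(t,b)$ has infinitely many realisations in $M$. A theory $T'$ is a *model companion* of $T$ (same language) if $T'$ is model complete, every model of $T$ embeds in a model of $T'$ and every model of $T'$ embeds in a model of $T$. Let $\mathscr L_0\subseteq\mathscr L$ be languages, let $T$ be an $\mathscr L$-theory and $T_0$ an $\mathscr L_0$-theory with $T\models T_0$, and let $\mathrm{acl}_0$ be algebraic closure in the sense of $\mathscr L_0$. The triple $(T,T_0,\mathscr L_0)$ is *suitable* if * $(H_1)$ $T$ is model complete; * $(H_2)$ $T_0$ is model complete, and for every infinite subset $A$ of a model of $T_0$, $\mathrm{acl}_0(A)\models T_0$; * $(H_3^+)$ $\mathrm{acl}_0$ defines a modular pregeometry in every model of $T_0$; * $(H_4)$ for every $\mathscr L$-formula $\phi(x,y)$ ($x,y$ finite tuples of variables) there is an $\mathscr L$-formula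 $\theta_\phi(y)$ such that for all $M\models T$ and all $b$ in $M$: $M\models\theta_\phi(b)$ if and only if there are an elementary extension $N\succ M$ and a tuple $a$ of $N$ with $N\models\phi(a,b)$ that is $\mathrm{acl}_0$-independent over $M$. **Theorem.** 1. Let $\mathbb F_q$ be a finite field, $\mathscr L_0=\{(\lambda_\alpha)_{\alpha\in\mathbb F_q},+,0\}$, and let $T_0$ be the $\mathscr L_0$-theory of infinite-dimensional $\mathbb F_q$-vector spaces. Let $\mathscr L\supseteq\mathscr L_0$, and let $T$ be an $\mathscr L$-theory that implies $T_0$, is model complete and eliminates $\exists^\infty$. Then $(T,T_0,\mathscr L_0)$ is a suitable triple. The theory $T_V$ of models of $T$ with a unary predicate $V$ for an infinite $\mathbb F_q$-vector subspace has a model companion $TV$. Moreover, for every $n\ge 0$ the theory $T_{V_1\dots V_n}$ of models of $T$ with $n$ unary predicates for $\mathbb F_q$-vector subspaces has a model companion $TV_1\dots V_n$, which is also a model companion of the theory of models of $T$ with $n$ predicates for infinite $\mathbb F_q$-vector subspaces. 2. Let $p$ be a prime, let $\mathscr L$ be a language containing the language $\mathscr L_{\mathrm{ring}}=\{+,-,\cdot,0,1\}$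 of rings, and let $T$ be an $\mathscr L$-theory whose models are infinite fields of characteristic $p$. If $T$ is model complete and eliminates $\exists^\infty$, then for every $n\ge 0$ the theory $T_{G_1\dots G_n}$ of models of $T$ with $n$ unary predicates for additive subgroups has a model companion. 3. In particular, for every prime $p$ and every $n\ge0$ the theory of algebraically closed fields of characteristic $p$ with $n$ predicates for additive subgroups has a model companion. 4. Similarly, let $p$ be a prime and let $T$ be a model complete theory, in the language of rings possibly expanded by constants, all of whose models are perfect pseudo-algebraically closed (PAC) fields of characteristic $p$. Then for every $n\ge 0$ the theory of models of $T$ with $n$ predicates for additive subgroups has a model companion. Here a field is PAC if it is existentially closed (as a field) in each of its regular extensions. -/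

import Mathlib

open FirstOrder FirstOrder.Language
open scoped TensorProduct

universe u v

namespace GenericSubspace

universe u₀ v₀ w

/-! ### Model completeness, model companions, the quantifier "there are infinitely many" -/

section Theories

variable {L : FirstOrder.Language.{u, v}}

/-- `T` is model complete: every embedding between two models of `T` is elementary. -/
def IsModelComplete (T : L.Theory) : Prop :=
  ∀ (M N : Type w) [L.Structure M] [L.Structure N] [Nonempty M] [Nonempty N] [M ⊨ T] [N ⊨ T]
    (f : M ↪[L] N) (n : ℕ) (φ : L.Formula (Fin n)) (x : Fin n → M),
    φ.Realize (f ∘ x) ↔ φ.Realize x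

/-- Every model of `T` embeds in a model of `T'`. -/
def EmbedsIn (T T' : L.Theory) : Prop :=
  ∀ (M : Type w) [L.Structure M] [Nonempty M] [M ⊨ T],
    ∃ (N : Type w) (_ : L.Structure N) (_ : Nonempty N), N ⊨ T' ∧ Nonempty (M ↪[L] N)

/-- `T'` is a model companion of `T`: it is model complete, every model of `T` embeds in a model
of `T'`, and every model of `T'` embeds in a model of `T`. -/
structure IsModelCompanion (T' T : L.Theory) : Prop where
  modelComplete : IsModelComplete.{u, v, w} T'
  embeds : EmbedsIn.{u, v, w} T T'
  embedded : EmbedsIn.{u, v, w} T' T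

/-- `T` eliminates `∃^∞`: for every formula `φ(t, y)` with `t` a single variable there is a formula
`θ(y)` that holds of `b` in a model of `T` if and only if `φ(t, b)` has infinitely many
realisations there. -/
def EliminatesExistsInfinity (T : L.Theory) : Prop :=
  ∀ (m : ℕ) (φ : L.Formula (Unit ⊕ Fin m)), ∃ θ : L.Formula (Fin m),
    ∀ (M : Type w) [L.Structure M] [Nonempty M] [M ⊨ T] (b : Fin m → M),
      θ.Realize b ↔ {t : M | φ.Realize (Sum.elim (fun _ => t) b)}.Infinite

end Theories

/-! ### Pregeometries and algebraic closure -/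

section Pregeometries

variable {M : Type w}

/-- The operator `cl` is a pregeometry. -/
structure IsPregeometry (cl : Set M → Set M) : Prop where
  subset_cl : ∀ A, A ⊆ cl A
  mono : ∀ A B, A ⊆ B → cl A ⊆ cl B
  cl_cl : ∀ A, cl (cl A) = cl A
  finitary : ∀ A, ∀ x ∈ cl A, ∃ B : Set M, B ⊆ A ∧ B.Finite ∧ x ∈ cl B
  exchange : ∀ A a b, a ∈ cl (A ∪ {b}) → a ∉ cl A → b ∈ cl (A ∪ {a})

/-- The set `X` is independent over `C`. -/
def IsIndepOver (cl : Set M → Set M) (C X : Set M) : Prop :=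
  ∀ x ∈ X, x ∉ cl (C ∪ (X \ {x}))

/-- `A` and `B` are independent over `C` in the sense of the pregeometry `cl`: every subset of `A`
that is independent over `C` remains independent over `C ∪ B`. -/
def AreIndepOver (cl : Set M → Set M) (A C B : Set M) : Prop :=
  ∀ X ⊆ A, IsIndepOver cl C X → IsIndepOver cl (C ∪ B) X

/-- The pregeometry `cl` is modular: any two closed sets are independent over their
intersection. -/
def IsModular (cl : Set M → Set M) : Prop :=
  ∀ A B, cl A = A → cl B = B → AreIndepOver cl A (A ∩ B) B

/-- The tuple `a` is independent over `C` (in particular its entries are distinct). -/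
def IsIndepTupleOver (cl : Set M → Set M) (C : Set M) {n : ℕ} (a : Fin n → M) : Prop :=
  ∀ i, a i ∉ cl (C ∪ a '' {j | j ≠ i})

/-- Model-theoretic algebraic closure of `A` in the `L`-structure `M`: the union of the finite
`A`-definable subsets of `M`. -/
def acl (L : FirstOrder.Language.{u, v}) [L.Structure M] (A : Set M) : Set M :=
  {x | ∃ S : Set M, A.Definable₁ L S ∧ S.Finite ∧ x ∈ S}

/-- Algebraic closure of a subset of an `L`-structure computed in its reduct along `ι`. -/
def aclReduct {L₀ : FirstOrder.Language.{u₀, v₀}} {L : FirstOrder.Language.{u, v}} (ι : L₀ →ᴸ L) [L.Structure M]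
    (A : Set M) : Set M :=
  letI := ι.reduct M
  acl L₀ A

end Pregeometries

/-! ### Suitable triples -/

section Suitable

variable {L₀ : FirstOrder.Language.{u₀, v₀}} {L : FirstOrder.Language.{u, v}}

/-- The `L`-theory `T` contains (that is, implies) the `L₀`-theory `T₀`. -/
def ContainsTheory (ι : L₀ →ᴸ L) (T : L.Theory) (T₀ : L₀.Theory) : Prop :=
  ∀ σ ∈ T₀, T ⊨ᵇ ι.onSentence σ

/-- `(T, T₀, L₀)` is a suitable triple, where the inclusion of `L₀` in `L` is `ι`. -/
structure IsSuitableTriple (ι : L₀ →ᴸ L) (T : L.Theory) (T₀ : L₀.Theory) : Prop where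
  contains : ContainsTheory ι T T₀
  modelComplete : IsModelComplete.{u, v, w} T
  modelComplete₀ : IsModelComplete.{u₀, v₀, w} T₀
  /-- the algebraic closure of an infinite set is (the domain of a substructure that is) a model
  of `T₀` -/
  acl_model : ∀ (N : Type w) [L₀.Structure N] [Nonempty N] [N ⊨ T₀] (A : Set N), A.Infinite →
    ∃ S : L₀.Substructure N, (S : Set N) = acl L₀ A ∧ S ⊨ T₀
  pregeometry : ∀ (N : Type w) [L₀.Structure N] [Nonempty N] [N ⊨ T₀],
    IsPregeometry (acl (M := N) L₀)
  modular : ∀ (N : Type w) [L₀.Structure N] [Nonempty N] [N ⊨ T₀], IsModular (acl (M := N) L₀)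
  /-- "`φ(x, b)` has, in an elementary extension of `M`, a realisation that is independent over
  `M`" is a first-order condition on `b` -/
  definable : ∀ (n m : ℕ) (φ : L.Formula (Fin n ⊕ Fin m)), ∃ θ : L.Formula (Fin m),
    ∀ (M : Type w) [L.Structure M] [Nonempty M] [M ⊨ T] (b : Fin m → M),
      θ.Realize b ↔
        ∃ (N : Type w) (_ : L.Structure N) (f : M ↪ₑ[L] N) (a : Fin n → N),
          φ.Realize (Sum.elim a (f ∘ b)) ∧ IsIndepTupleOver (aclReduct ι) (Set.range f) a

end Suitable

/-! ### Expansions by predicates for substructures -/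

section Expansions

/-- Symbols of the language with `n` unary predicates. -/
inductive PredRel (n : ℕ) : ℕ → Type
  | pred (i : Fin n) : PredRel n 1

/-- The language with `n` unary predicates `V₁, …, Vₙ`. -/
def predLang (n : ℕ) : FirstOrder.Language.{0, 0} := ⟨fun _ => Empty, PredRel n⟩

variable {L₀ : FirstOrder.Language.{u₀, v₀}} {L : FirstOrder.Language.{u, v}} {n : ℕ}

/-- The `i`-th predicate symbol, in the language `L ∪ {V₁, …, Vₙ}`. -/
abbrev predSym (L : FirstOrder.Language.{u, v}) (i : Fin n) : (L.sum (predLang n)).Relations 1 :=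
  Sum.inr (PredRel.pred i)

/-- The formula `Vᵢ(t)`. -/
def predFormula (i : Fin n) {k : ℕ} (t : (L.sum (predLang n)).Term (Empty ⊕ Fin k)) :
    (L.sum (predLang n)).BoundedFormula Empty k :=
  (predSym L i).boundedFormula₁ t

/-- The `i`-th predicate is closed under the function symbol `f`. -/
noncomputable def closureAxiom (i : Fin n) {k : ℕ} (f : L.Functions k) :
    (L.sum (predLang n)).Sentence :=
  ((BoundedFormula.iInf fun j : Fin k => predFormula (L := L) i (&j)) ⟹
    predFormula i (Term.func (LHom.sumInl.onFunction f) fun j => &j)).alls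

/-- The `i`-th predicate has at least `k` elements. -/
noncomputable def cardAxiom (L : FirstOrder.Language.{u, v}) (i : Fin n) (k : ℕ) :
    (L.sum (predLang n)).Sentence :=
  ((BoundedFormula.iInf fun j : Fin k => predFormula (L := L) i (&j)) ⊓
    BoundedFormula.iInf fun p : {p : Fin k × Fin k // p.1 ≠ p.2} => ∼(&p.1.1 =' &p.1.2)).exs

/-- The theory of models of `T` with predicates `V₁, …, Vₙ` for `L₀`-substructures. -/
def substructureTheory (ι : L₀ →ᴸ L) (T : L.Theory) (n : ℕ) : (L.sum (predLang n)).Theory :=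
  LHom.sumInl.onTheory T ∪
    {σ | ∃ (i : Fin n) (k : ℕ) (f : L₀.Functions k), σ = closureAxiom i (ι.onFunction f)}

/-- The theory of models of `T` with predicates `V₁, …, Vₙ` for infinite `L₀`-substructures. -/
def infiniteSubstructureTheory (ι : L₀ →ᴸ L) (T : L.Theory) (n : ℕ) :
    (L.sum (predLang n)).Theory :=
  substructureTheory ι T n ∪ {σ | ∃ (i : Fin n) (k : ℕ), σ = cardAxiom L i k}

end Expansions

/-! ### Vector spaces over a field `F` -/

section VectorSpaces

variable (F : Type)

/-- Function symbols of the language of `F`-vector spaces. -/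
inductive VecFunc : ℕ → Type
  | zero : VecFunc 0
  | add : VecFunc 2
  | smul (α : F) : VecFunc 1

/-- The language `{(λ_α)_{α ∈ F}, +, 0}` of `F`-vector spaces, without relation symbols. -/
def vecLang : FirstOrder.Language.{0, 0} := ⟨VecFunc F, fun _ => Empty⟩

variable {F}

/-- The symbol `0`. -/
abbrev zeroSym : (vecLang F).Constants := VecFunc.zero

/-- The symbol `+`. -/
abbrev addSym : (vecLang F).Functions 2 := VecFunc.add

/-- The symbol `λ_α`. -/
abbrev smulSym (α : F) : (vecLang F).Functions 1 := VecFunc.smul α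

/-- The term `0`. -/
def tZero {k : ℕ} : (vecLang F).Term (Empty ⊕ Fin k) :=
  Constants.term zeroSym

/-- The term `s + t`. -/
def tAdd {k : ℕ} (s t : (vecLang F).Term (Empty ⊕ Fin k)) : (vecLang F).Term (Empty ⊕ Fin k) :=
  addSym.apply₂ s t

/-- The term `λ_α(t)`. -/
def tSmul {k : ℕ} (α : F) (t : (vecLang F).Term (Empty ⊕ Fin k)) :
    (vecLang F).Term (Empty ⊕ Fin k) :=
  (smulSym α).apply₁ t

/-- The axioms of `F`-vector spaces. -/
inductive VecAxiom [Field F] : (vecLang F).Sentence → Prop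
  | add_assoc : VecAxiom (∀' ∀' ∀' (tAdd (tAdd (&0) (&1)) (&2) =' tAdd (&0) (tAdd (&1) (&2))))
  | add_comm : VecAxiom (∀' ∀' (tAdd (&0) (&1) =' tAdd (&1) (&0)))
  | zero_add : VecAxiom (∀' (tAdd tZero (&0) =' &0))
  | neg_add : VecAxiom (∀' (tAdd (tSmul (-1) (&0)) (&0) =' tZero))
  | one_smul : VecAxiom (∀' (tSmul 1 (&0) =' &0))
  | mul_smul (α β : F) : VecAxiom (∀' (tSmul (α * β) (&0) =' tSmul α (tSmul β (&0))))
  | add_smul (α β : F) :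
      VecAxiom (∀' (tSmul (α + β) (&0) =' tAdd (tSmul α (&0)) (tSmul β (&0))))
  | smul_add (α : F) :
      VecAxiom (∀' ∀' (tSmul α (tAdd (&0) (&1)) =' tAdd (tSmul α (&0)) (tSmul α (&1))))

/-- The theory of infinite `F`-vector spaces; for a finite field `F` this is the theory of
infinite-dimensional `F`-vector spaces. -/
def infVecTheory (F : Type) [Field F] : (vecLang F).Theory :=
  {σ | VecAxiom σ} ∪ (vecLang F).infiniteTheory

end VectorSpaces

/-! ### Fields -/

section Fields

/-- Function symbols of the language of additive groups. -/
inductive AddGroupFunc : ℕ → Type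
  | zero : AddGroupFunc 0
  | neg : AddGroupFunc 1
  | add : AddGroupFunc 2

/-- The language `{0, -, +}` of additive groups. -/
def addGroupLang : FirstOrder.Language.{0, 0} := ⟨AddGroupFunc, fun _ => Empty⟩

/-- The inclusion of the language of additive groups in the language of rings. -/
def addGroupToRing : addGroupLang →ᴸ Language.ring where
  onFunction := fun _ f => match f with
    | AddGroupFunc.zero => ringFunc.zero
    | AddGroupFunc.neg => ringFunc.neg
    | AddGroupFunc.add => ringFunc.add
  onRelation := fun _ r => r.elim

variable {L : FirstOrder.Language.{u, v}}

/-- The theory of models of `T` with predicates `G₁, …, Gₙ` for additive subgroups, where `T` is a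
theory of rings in a language that contains the language of rings (through `ι`). -/
def additiveSubgroupTheory (ι : Language.ring →ᴸ L) (T : L.Theory) (n : ℕ) :
    (L.sum (predLang n)).Theory :=
  substructureTheory (ι.comp addGroupToRing) T n

/-- The `L`-structure on `K` interprets the ring symbols by the operations of the field `K`. -/
structure IsCompatible (ι : Language.ring →ᴸ L) (K : Type w) [Field K] [L.Structure K] : Prop where
  zero : ∀ x, Structure.funMap (M := K) (ι.onFunction Ring.zeroFunc) x = 0
  one : ∀ x, Structure.funMap (M := K) (ι.onFunction Ring.oneFunc) x = 1
  neg : ∀ x, Structure.funMap (M := K) (ι.onFunction Ring.negFunc) x = -x 0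
  add : ∀ x, Structure.funMap (M := K) (ι.onFunction Ring.addFunc) x = x 0 + x 1
  mul : ∀ x, Structure.funMap (M := K) (ι.onFunction Ring.mulFunc) x = x 0 * x 1

/-- Every model of `T` is, for the interpretation of the ring symbols, a field with the
property `P`. -/
def ModelsAreFields (ι : Language.ring →ᴸ L) (T : L.Theory) (P : ∀ (K : Type w) [Field K], Prop) :
    Prop :=
  ∀ (K : Type w) [L.Structure K] [Nonempty K] [K ⊨ T], ∃ _ : Field K, IsCompatible ι K ∧ P K

/-- The extension `E / K` of fields is regular: `E` is linearly disjoint over `K` from an algebraic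
closure of `K`, that is, their tensor product is a domain. -/
def IsRegularExtension (K E : Type w) [Field K] [Field E] [Algebra K E] : Prop :=
  IsDomain (AlgebraicClosure K ⊗[K] E)

/-- `K` is pseudo-algebraically closed: it is existentially closed in each of its regular
extensions, that is, a finite system of polynomial equations over `K` that has a solution in a
regular extension has a solution in `K`. (Inequations `f ≠ 0` are written `f * y = 1`.) -/
def IsPAC (K : Type w) [Field K] : Prop :=
  ∀ (E : Type w) [Field E] [Algebra K E], IsRegularExtension K E →
    ∀ (n : ℕ) (S : Finset (MvPolynomial (Fin n) K)),
      (∃ x : Fin n → E, ∀ f ∈ S, MvPolynomial.aeval x f = 0) →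
        ∃ x : Fin n → K, ∀ f ∈ S, MvPolynomial.eval x f = 0

end Fields

end GenericSubspace

open GenericSubspace

namespace GenericSubspace

universe u₀ v₀ u' v' w w'

/-! ### Uniformly definable predicates -/

section UniformlyDefinable

variable {L : FirstOrder.Language.{u, v}}

/-! Two ideas carry the proof: independent realisability is definable, and consistent linear
relations with the predicates can be prescribed freely on a generic tuple.

Definability. By compactness, a formula with parameters in a model M has, in an elementary
extension, a realisation linearly independent over M exactly when its solution set in M is not
covered by finitely many proper affine sets (`indepRealizable_iff`). Over a finite field there are
only finitely many possible directions, so coverability in codimension at least j reduces to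
codimension at least j + 1 together with the finiteness of some definable families of slices
(`covered_iff`). Elimination of `∃^∞` therefore makes the condition first-order (`UDef.covered`,
`UDef.indepRealizable`). This is condition (H₄); the other conditions of a suitable triple are
linear algebra, because algebraic closure is the span (`acl_vecLang`).

Companion. `genericTheory` says that whenever a formula has an independent realisation, and a choice
of subspaces of formal linear combinations agrees with the predicates on the parameters, some
realisation has exactly these combinations in the predicates. Adjoining the prescribed combinations
to the old subspaces at an independent realisation creates no new relation over M
(`exists_extension_realizing`); compactness and a countable chain then produce generic extensions
(`exists_generic_extension`). Conversely, let a generic M lie in N. By model completeness of T, the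
extension is elementary for the base language. Finitely many elements of N are linear combinations
of a tuple independent over M and of elements of M, so genericity copies them into M
(`IsGeneric.exists_specialization`). Hence N embeds over M in an elementary extension of M, and
Robinson's test gives model completeness.

Fields. In characteristic p the additive subgroups are the subspaces over `ZMod p`, so only
elimination of `∃^∞` remains for algebraically closed and perfect PAC fields. Both kinds are
existentially closed in their Laurent series fields. If elimination fails, an ultraproduct K of
models contains an infinite φ(K, β) whose coordinates are finite sets. Take a new realisation t in
an elementary extension. A suitable finitely generated extension of K containing t has a smooth
hypersurface model; Hensel's lemma gives generic points of its coordinates, so it embeds over K in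
an ultraproduct of elementary extensions of the coordinates (`exists_ringHom_ultraproduct`), and φ
survives by model completeness (`exists_isPreserved`). But finite definable sets do not grow in
elementary extensions, so t was already in K. -/

/-- The predicate `P` on `α`-tuples of models of `T` is given by a formula. -/
def UDef (T : L.Theory) {α : Type w'} (P : ∀ (M : Type w) [L.Structure M], (α → M) → Prop) : Prop :=
  ∃ θ : L.Formula α, ∀ (M : Type w) [L.Structure M] [Nonempty M] [M ⊨ T] (b : α → M),
    θ.Realize b ↔ P M b

variable {T : L.Theory} {α β : Type w'}
  {P Q : ∀ (M : Type w) [L.Structure M], (α → M) → Prop}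

theorem UDef.of_iff (h : UDef T P)
    (hPQ : ∀ (M : Type w) [L.Structure M] [Nonempty M] [M ⊨ T] (b : α → M), P M b ↔ Q M b) :
    UDef T Q := by
  obtain ⟨θ, hθ⟩ := h
  exact ⟨θ, fun M _ _ _ b => (hθ M b).trans (hPQ M b)⟩

theorem UDef.formula (φ : L.Formula α) : UDef.{u, v, w} T fun _ _ b => φ.Realize b :=
  ⟨φ, fun _ _ _ _ _ => Iff.rfl⟩

theorem UDef.not (h : UDef T P) : UDef T fun M _ b => ¬ P M b := by
  obtain ⟨θ, hθ⟩ := h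
  exact ⟨θ.not, fun M _ _ _ b => by rw [Formula.realize_not, hθ]⟩

theorem UDef.and (h : UDef T P) (h' : UDef T Q) : UDef T fun M _ b => P M b ∧ Q M b := by
  obtain ⟨θ, hθ⟩ := h
  obtain ⟨θ', hθ'⟩ := h'
  exact ⟨θ ⊓ θ', fun M _ _ _ b => by rw [Formula.realize_inf, hθ, hθ']⟩

theorem UDef.imp (h : UDef T P) (h' : UDef T Q) : UDef T fun M _ b => P M b → Q M b := by
  obtain ⟨θ, hθ⟩ := h
  obtain ⟨θ', hθ'⟩ := h'
  exact ⟨θ.imp θ', fun M _ _ _ b => by rw [Formula.realize_imp, hθ, hθ']⟩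

theorem UDef.finite_forall {ι : Type*} [Finite ι]
    {P : ι → ∀ (M : Type w) [L.Structure M], (α → M) → Prop} (h : ∀ i, UDef T (P i)) :
    UDef T fun M _ b => ∀ i, P i M b := by
  choose θ hθ using h
  exact ⟨Formula.iInf θ, fun M _ _ _ b => by simp only [Formula.realize_iInf, hθ]⟩

theorem UDef.finite_exists {ι : Type*} [Finite ι]
    {P : ι → ∀ (M : Type w) [L.Structure M], (α → M) → Prop} (h : ∀ i, UDef T (P i)) :
    UDef T fun M _ b => ∃ i, P i M b := by
  choose θ hθ using h
  exact ⟨Formula.iSup θ, fun M _ _ _ b => by simp only [Formula.realize_iSup, hθ]⟩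

theorem UDef.subst (h : UDef T P) (t : α → L.Term β) :
    UDef T fun M _ (b : β → M) => P M fun a => (t a).realize b := by
  obtain ⟨θ, hθ⟩ := h
  exact ⟨BoundedFormula.subst θ t, fun M _ _ _ b =>
    BoundedFormula.realize_subst.trans (hθ M _)⟩

theorem UDef.comp (h : UDef T P) (g : α → β) : UDef T fun M _ (b : β → M) => P M (b ∘ g) :=
  h.subst fun a => Term.var (g a)

theorem UDef.exists_tuple [Finite β] {P : ∀ (M : Type w) [L.Structure M], (α ⊕ β → M) → Prop}
    (h : UDef T P) : UDef T fun M _ (b : α → M) => ∃ c : β → M, P M (Sum.elim b c) := by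
  obtain ⟨θ, hθ⟩ := h
  exact ⟨Formula.iExs β θ, fun M _ _ _ b => by simp only [Formula.realize_iExs, hθ]⟩

theorem UDef.forall_tuple [Finite β] {P : ∀ (M : Type w) [L.Structure M], (α ⊕ β → M) → Prop}
    (h : UDef T P) : UDef T fun M _ (b : α → M) => ∀ c : β → M, P M (Sum.elim b c) := by
  obtain ⟨θ, hθ⟩ := h
  exact ⟨Formula.iAlls β θ, fun M _ _ _ b => by simp only [Formula.realize_iAlls, hθ]⟩

theorem UDef.equal (s t : L.Term α) :
    UDef.{u, v, w} T fun _ _ b => s.realize b = t.realize b :=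
  ⟨s.equal t, fun _ _ _ _ _ => by rw [Formula.realize_equal]⟩

/-- Uniformly definable predicates are preserved by elementary embeddings. -/
theorem UDef.map_iff (h : UDef T P) {M N : Type w} [L.Structure M] [L.Structure N] [Nonempty M]
    [M ⊨ T] (f : M ↪ₑ[L] N) (b : α → M) : P N (f ∘ b) ↔ P M b := by
  obtain ⟨θ, hθ⟩ := h
  have : Nonempty N := Nonempty.map f inferInstance
  have : N ⊨ T := (f.theory_model_iff T).1 inferInstance
  rw [← hθ, ← hθ, f.map_formula]

end UniformlyDefinable

/-! ### Compactness, model completeness -/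

section Compactness

variable {L : FirstOrder.Language.{u, v}}

/-- A set of formulas that is finitely realised in models of `T` is realised in a model of `T`. -/
theorem exists_realize_of_finite {T : L.Theory} {α : Type (max u v)} (Γ : Set (L.Formula α))
    (h : ∀ Γ₀ : Finset (L.Formula α), ↑Γ₀ ⊆ Γ →
      ∃ (N : Type (max u v)) (_ : L.Structure N) (_ : Nonempty N) (_ : N ⊨ T) (e : α → N),
        ∀ γ ∈ Γ₀, γ.Realize e) :
    ∃ (N : Type (max u v)) (_ : L.Structure N) (_ : Nonempty N) (_ : N ⊨ T) (e : α → N),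
      ∀ γ ∈ Γ, γ.Realize e := by
  classical
  let T' : L[[α]].Theory := (L.lhomWithConstants α).onTheory T ∪ Formula.equivSentence '' Γ
  have key : T'.IsSatisfiable := by
    rw [Theory.isSatisfiable_iff_isFinitelySatisfiable]
    intro T₀ hT₀
    -- The finite set mixes sentences of T with translated members of Γ; everything is translated
    -- back and only what lies in Γ is kept.
    obtain ⟨N, _, _, _, e, he⟩ := h
      ((T₀.image Formula.equivSentence.symm).filter (· ∈ Γ)) (by intro x hx; simp at hx; exact hx.2)
    let _ : (constantsOn α).Structure N := constantsOn.structure e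
    have : N ⊨ (T₀ : L[[α]].Theory) := by
      refine Theory.model_iff _ |>.2 fun σ hσ => ?_
      rcases hT₀ hσ with ⟨τ, hτ, rfl⟩ | ⟨γ, hγ, rfl⟩
      · rw [LHom.realize_onSentence]
        exact Theory.realize_sentence_of_mem T hτ
      · rw [Formula.realize_equivSentence]
        apply he
        simp only [Finset.mem_filter, Finset.mem_image]
        exact ⟨⟨_, hσ, by simp⟩, hγ⟩
    exact Theory.Model.isSatisfiable N
  obtain ⟨N⟩ := key
  let _ : L.Structure N := (L.lhomWithConstants α).reduct N
  have h1 : N ⊨ (L.lhomWithConstants α).onTheory T :=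
    Theory.Model.mono N.is_model Set.subset_union_left
  have h2 : N ⊨ Formula.equivSentence '' Γ := Theory.Model.mono N.is_model Set.subset_union_right
  refine ⟨N, inferInstance, inferInstance,
    (LHom.onTheory_model (L.lhomWithConstants α) T).1 h1, fun a => (L.con a : N), fun γ hγ => ?_⟩
  have := Theory.realize_sentence_of_mem _ (M := N) (Set.mem_image_of_mem Formula.equivSentence hγ)
  rw [← Equiv.symm_apply_apply Formula.equivSentence γ]
  exact (Formula.realize_equivSentence_symm_con N _).2 this

/-- A map that preserves the truth of formulas is an elementary embedding. -/
def elementaryOfRealize {M N : Type*} [L.Structure M] [L.Structure N] (e : M → N)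
    (h : ∀ (n : ℕ) (φ : L.Formula (Fin n)) (x : Fin n → M), φ.Realize x → φ.Realize (e ∘ x)) :
    M ↪ₑ[L] N where
  toFun := e
  map_formula' n φ x := ⟨fun hx => by
    by_contra hn
    exact (Formula.realize_not).1 (h n φ.not x (Formula.realize_not.2 hn)) hx, h n φ x⟩

/-- The formulas with parameters in `M` that are true in `M`. -/
def elementaryDiagramFormulas (L : FirstOrder.Language.{u, v}) (M : Type*) [L.Structure M] :
    Set (L.Formula M) :=
  {γ | ∃ (n : ℕ) (φ : L.Formula (Fin n)) (x : Fin n → M), φ.Realize x ∧ γ = φ.relabel x}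

theorem realize_of_mem_elementaryDiagramFormulas {M : Type*} [L.Structure M] {γ : L.Formula M}
    (h : γ ∈ elementaryDiagramFormulas L M) : γ.Realize id := by
  obtain ⟨n, φ, x, hx, rfl⟩ := h
  rwa [Formula.realize_relabel]

/-- An elementary embedding from a realisation of the elementary diagram. -/
def elementaryOfDiagram {M N : Type*} [L.Structure M] [L.Structure N] (e : M → N)
    (h : ∀ γ ∈ elementaryDiagramFormulas L M, γ.Realize e) : M ↪ₑ[L] N :=
  elementaryOfRealize e fun n φ x hx => by
    have := h _ ⟨n, φ, x, hx, rfl⟩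
    rwa [Formula.realize_relabel] at this

/-- Embeddings between models of a model complete theory are elementary. -/
def IsModelComplete.elementary {T : L.Theory} (hT : IsModelComplete.{u, v, w} T) {M N : Type w}
    [L.Structure M] [L.Structure N] [Nonempty M] [Nonempty N] [M ⊨ T] [N ⊨ T] (f : M ↪[L] N) :
    M ↪ₑ[L] N where
  toFun := f
  map_formula' n φ x := hT M N f n φ x

/-- Robinson's test for model completeness: it is enough to complete each embedding `M → N` of
models of `T` to an elementary embedding `M → N → M'`. -/
theorem isModelComplete_of_complete_to_elementary {T : L.Theory}
    (h : ∀ (M N : Type w) [L.Structure M] [L.Structure N] [Nonempty M] [Nonempty N] [M ⊨ T]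
      [N ⊨ T] (f : M ↪[L] N), ∃ (M' : Type w) (_ : L.Structure M') (g : N ↪[L] M')
        (e : M ↪ₑ[L] M'), ⇑g ∘ ⇑f = ⇑e) : IsModelComplete.{u, v, w} T := by
  have key : ∀ {n k : ℕ} (φ : L.BoundedFormula (Fin n) k), ∀ (M N : Type w) [L.Structure M]
      [L.Structure N] [Nonempty M] [Nonempty N] [M ⊨ T] [N ⊨ T] (f : M ↪[L] N) (x : Fin n → M)
      (y : Fin k → M), φ.Realize (f ∘ x) (f ∘ y) ↔ φ.Realize x y := by
    intro n k φ
    induction φ with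
    | falsum => intros; rfl
    | equal t s =>
      intro M N _ _ _ _ _ _ f x y
      simp only [BoundedFormula.Realize, ← Sum.comp_elim, HomClass.realize_term, f.injective.eq_iff]
    | rel R ts =>
      intro M N _ _ _ _ _ _ f x y
      simp only [BoundedFormula.Realize, ← Sum.comp_elim, HomClass.realize_term]
      exact f.map_rel R _
    | imp _ _ ih ih' =>
      intro M N _ _ _ _ _ _ f x y
      simp only [BoundedFormula.Realize, ih M N, ih' M N]
    | all φ ih =>
      intro M N _ _ _ _ _ _ f x y
      simp only [BoundedFormula.Realize]
      constructor
      · intro H a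
        rw [← ih M N f, Fin.comp_snoc]
        exact H (f a)
      · intro H a
        -- The universal statement travels along the elementary `e`, is instantiated at `g a`, and
        -- comes back to N by the induction hypothesis. That hypothesis covers all embeddings of
        -- models, hence also `g`.
        obtain ⟨M', _, g, e, hge⟩ := h M N f
        have : Nonempty M' := Nonempty.map g inferInstance
        have : M' ⊨ T := (e.theory_model_iff T).1 inferInstance
        have H' : (BoundedFormula.all φ).Realize (e ∘ x) (e ∘ y) := by
          rw [e.map_boundedFormula]; exact H
        have := H' (g a)
        rw [← hge, Function.comp_assoc, Function.comp_assoc, ← Fin.comp_snoc, ih N M' g] at this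
        exact this
  intro M N _ _ _ _ _ _ f n φ x
  have := key φ M N f x default
  rwa [Unique.eq_default (f ∘ default)] at this

end Compactness

/-! ### Elementary chains -/

section Chains

variable {L : FirstOrder.Language.{u, v}}

/-- Tarski's theorem on elementary chains: the maps to the union of a countable chain of
elementary embeddings are elementary. -/
theorem realize_iff_of_chain {G : ℕ → Type w} [∀ i, L.Structure (G i)] {Z : Type w'} [L.Structure Z]
    (e : ∀ i, G i ↪ₑ[L] G (i + 1)) (g : ∀ i, G i ↪[L] Z) (hg : ∀ i x, g (i + 1) (e i x) = g i x)
    (hZ : ∀ z, ∃ i x, g i x = z) {α : Type*} {n : ℕ} (φ : L.BoundedFormula α n) :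
    ∀ (i : ℕ) (v : α → G i) (xs : Fin n → G i),
      φ.Realize (g i ∘ v) (g i ∘ xs) ↔ φ.Realize v xs := by
  have lift : ∀ i j, i ≤ j → ∃ E : G i ↪ₑ[L] G j, ∀ x, g j (E x) = g i x := by
    intro i j hij
    induction j, hij using Nat.le_induction with
    | base => exact ⟨ElementaryEmbedding.refl L _, fun _ => rfl⟩
    | succ j _ ih =>
      obtain ⟨E, hE⟩ := ih
      exact ⟨(e j).comp E, fun x => by rw [ElementaryEmbedding.comp_apply, hg, hE]⟩
  induction φ with
  | falsum => intros; rfl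
  | equal t s =>
    intro i v xs
    simp only [BoundedFormula.Realize, ← Sum.comp_elim, HomClass.realize_term, (g i).injective.eq_iff]
  | rel R ts =>
    intro i v xs
    simp only [BoundedFormula.Realize, ← Sum.comp_elim, HomClass.realize_term]
    exact (g i).map_rel R _
  | imp _ _ ih ih' =>
    intro i v xs
    simp only [BoundedFormula.Realize, ih, ih']
  | all φ ih =>
    intro i v xs
    constructor
    · intro H a
      rw [← ih, Fin.comp_snoc]
      exact H (g i a)
    · intro H z
      obtain ⟨j, y, rfl⟩ := hZ z
      -- The parameters and the instance come from different stages; both are moved to a common one,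
      -- where elementarity of the chain maps applies.
      obtain ⟨E, hE⟩ := lift i (max i j) (le_max_left _ _)
      obtain ⟨E', hE'⟩ := lift j (max i j) (le_max_right _ _)
      have H' : (BoundedFormula.all φ).Realize (E ∘ v) (E ∘ xs) := by
        rw [E.map_boundedFormula]; exact H
      have := H' (E' y)
      rw [← ih, Fin.comp_snoc, hE'] at this
      have h1 : ∀ {β : Type _} (v : β → G i), g (max i j) ∘ E ∘ v = g i ∘ v :=
        fun v => funext fun b => hE (v b)
      rw [h1] at this
      have h2 : g (max i j) ∘ E ∘ xs = g i ∘ xs := funext fun b => hE (xs b)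
      rwa [h2] at this

end Chains

/-! ### Uniform finiteness in several variables -/

section Finiteness

variable {L : FirstOrder.Language.{u, v}} {T : L.Theory} {α β : Type}

theorem UDef.setFinite_unit [Finite α] (hT : EliminatesExistsInfinity.{u, v, w} T)
    {P : ∀ (M : Type w) [L.Structure M], (α ⊕ Unit → M) → Prop} (h : UDef T P) :
    UDef T fun M _ (b : α → M) => {t : M | P M (Sum.elim b fun _ => t)}.Finite := by
  obtain ⟨m, ⟨e⟩⟩ := Finite.exists_equiv_fin α
  obtain ⟨φ, hφ⟩ := h.comp (Sum.elim (fun a => Sum.inr (e a)) fun _ => Sum.inl ())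
  obtain ⟨θ, hθ⟩ := hT m φ
  refine ((UDef.formula θ).comp e.symm).not.of_iff fun M _ _ _ b => ?_
  rw [hθ, Set.not_infinite]
  refine Eq.to_iff (congrArg _ (Set.ext fun t => (hφ M _).trans ?_))
  have : Sum.elim (fun _ => t) (b ∘ e.symm) ∘ Sum.elim (fun a => Sum.inr (e a))
      (fun _ : Unit => Sum.inl ()) = Sum.elim b fun _ => t := by
    ext x; cases x <;> simp
  change P M _ ↔ P M _
  rw [this]

/-- A set of finite tuples is finite exactly when all its coordinate projections are, which reduces
several variables to one. -/
theorem UDef.setFinite [Finite α] [Finite β] (hT : EliminatesExistsInfinity.{u, v, w} T)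
    {P : ∀ (M : Type w) [L.Structure M], (α ⊕ β → M) → Prop} (h : UDef T P) :
    UDef T fun M _ (b : α → M) => {c : β → M | P M (Sum.elim b c)}.Finite := by
  have h1 (i : β) : UDef T fun M _ (b : α ⊕ Unit → M) =>
      ∃ c : β → M, P M (Sum.elim (b ∘ Sum.inl) c) ∧ c i = b (Sum.inr ()) := by
    refine UDef.exists_tuple (P := fun M _ b => P M (Sum.elim ((b ∘ Sum.inl) ∘ Sum.inl) (b ∘ Sum.inr)) ∧
      b (Sum.inr i) = b (Sum.inl (Sum.inr ()))) (UDef.and ?_ (UDef.equal (.var _) (.var _)))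
    refine (h.comp (Sum.elim (fun a => Sum.inl (Sum.inl a)) Sum.inr)).of_iff fun M _ _ _ b => ?_
    refine Eq.to_iff (congrArg _ (funext fun x => ?_))
    cases x <;> rfl
  refine (UDef.finite_forall fun i => (h1 i).setFinite_unit hT).of_iff fun M _ _ _ b => ?_
  simp only [Sum.elim_comp_inl, Sum.elim_inr]
  constructor
  · intro H
    refine (Set.Finite.pi' H).subset fun c hc i => ⟨c, hc, rfl⟩
  · intro H i
    refine (H.image fun c => c i).subset ?_
    rintro t ⟨c, hc, rfl⟩
    exact ⟨c, hc, rfl⟩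

end Finiteness

/-! ### Coverings by finitely many affine subspaces -/

section Covering

variable {F E M X : Type*} [Field F] [AddCommGroup E] [Module F E]

/-- The points `x` at which the functionals of `W` take the prescribed values `m`. -/
def affineSet (tr : X → E → M) (W : Submodule F E) (m : W → M) : Set X :=
  {x | ∀ l : W, tr x l = m l}

variable (F) in
/-- `D` is covered by finitely many affine sets of codimension at least `j`. -/
def Covered (tr : X → E → M) (j : ℕ) (D : Set X) : Prop :=
  ∃ H : Set (Σ W : Submodule F E, (W → M)), H.Finite ∧ (∀ h ∈ H, j ≤ Module.finrank F h.1) ∧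
    ∀ x ∈ D, ∃ h ∈ H, x ∈ affineSet tr h.1 h.2

variable {tr : X → E → M} {j : ℕ} {D D' : Set X}

theorem Covered.mono (h : Covered F tr j D) (hD : D' ⊆ D) : Covered F tr j D' := by
  obtain ⟨H, hH, hH', hx⟩ := h
  exact ⟨H, hH, hH', fun x hx' => hx x (hD hx')⟩

theorem Covered.anti {i : ℕ} (h : Covered F tr j D) (hij : i ≤ j) : Covered F tr i D := by
  obtain ⟨H, hH, hH', hx⟩ := h
  exact ⟨H, hH, fun h hh => hij.trans (hH' h hh), hx⟩

theorem Covered.biUnion {ι : Type*} {I : Set ι} (hI : I.Finite) {D : ι → Set X}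
    (h : ∀ i ∈ I, Covered F tr j (D i)) : Covered F tr j (⋃ i ∈ I, D i) := by
  choose! H hH hH' hx using h
  refine ⟨⋃ i ∈ I, H i, hI.biUnion hH, ?_, ?_⟩
  · intro h hh
    simp only [Set.mem_iUnion] at hh
    obtain ⟨i, hi, hh⟩ := hh
    exact hH' i hi h hh
  · intro x hx'
    simp only [Set.mem_iUnion] at hx'
    obtain ⟨i, hi, hx'⟩ := hx'
    obtain ⟨h, hh, hxh⟩ := hx i hi x hx'
    exact ⟨h, Set.mem_biUnion hi hh, hxh⟩

theorem Covered.union (h : Covered F tr j D) (h' : Covered F tr j D') : Covered F tr j (D ∪ D') := by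
  obtain ⟨H, hH, hH', hx⟩ := h
  obtain ⟨K, hK, hK', hx'⟩ := h'
  refine ⟨H ∪ K, hH.union hK, fun h hh => hh.elim (hH' h) (hK' h), fun x hx'' => ?_⟩
  rcases hx'' with hx'' | hx''
  · obtain ⟨h, hh, H⟩ := hx x hx''
    exact ⟨h, Or.inl hh, H⟩
  · obtain ⟨h, hh, H⟩ := hx' x hx''
    exact ⟨h, Or.inr hh, H⟩

theorem Covered.empty : Covered F tr j ∅ := ⟨∅, Set.finite_empty, by simp, by simp⟩

/-- The common values on a nonempty D define a single affine set with direction W that contains D.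
This is how coverings are produced below. -/
theorem covered_of_constant (W : Submodule F E) (hW : j ≤ Module.finrank F W)
    (h : ∀ x ∈ D, ∀ y ∈ D, ∀ l ∈ W, tr x l = tr y l) : Covered F tr j D := by
  rcases D.eq_empty_or_nonempty with rfl | ⟨x₀, hx₀⟩
  · exact Covered.empty
  · refine ⟨{⟨W, fun l => tr x₀ l⟩}, Set.finite_singleton _, by simpa, fun x hx => ⟨_, rfl, ?_⟩⟩
    exact fun l => h x hx x₀ hx₀ l l.2

variable [Module.Finite F E]

/-- Recursion for coverings: remove the slices of codimension `j` that are not covered in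
codimension `j + 1`. -/
theorem covered_iff [AddCommGroup M] [Module F M] [Finite (Submodule F E)]
    (htr : ∀ x, IsLinearMap F (tr x)) :
    Covered F tr j D ↔
      (∀ W : {W : Submodule F E // Module.finrank F W = j},
        {m : W.1 → M | ¬ Covered F tr (j + 1) {x | x ∈ D ∧ x ∈ affineSet tr W.1 m}}.Finite) ∧
      Covered F tr (j + 1) {x | x ∈ D ∧ ∀ W : {W : Submodule F E // Module.finrank F W = j},
        Covered F tr (j + 1) {y | y ∈ D ∧ y ∈ affineSet tr W.1 fun l => tr x l}} := by
  constructor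
  · rintro ⟨H, hH, hH', hx⟩
    -- A slice of codimension j that is not a member of the cover meets each member in codimension
    -- at least j + 1. A parallel member is disjoint from it; any other direction W' satisfies W ⊔
    -- W' > W because its dimension is at least j.
    have key (W : Submodule F E) (hW : Module.finrank F W = j) (m : W → M) (hm : ⟨W, m⟩ ∉ H) :
        Covered F tr (j + 1) {x | x ∈ D ∧ x ∈ affineSet tr W m} := by
      refine (Covered.biUnion hH (D := fun h => {x | x ∈ affineSet tr W m ∧ x ∈ affineSet tr h.1 h.2})
        ?_).mono ?_
      · rintro ⟨W', m'⟩ hh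
        by_cases hWW : W' = W
        · subst hWW
          convert! Covered.empty (F := F) (tr := tr) (j := j + 1)
          refine Set.eq_empty_iff_forall_notMem.2 ?_
          rintro x ⟨h1, h2⟩
          exact hm (by convert hh using 2; exact funext fun l => (h1 l).symm.trans (h2 l))
        · refine covered_of_constant (W ⊔ W') ?_ ?_
          · by_contra hlt
            have h1 : W ⊔ W' ≤ W := by
              refine (Submodule.eq_of_le_of_finrank_le le_sup_left ?_).ge
              omega
            have h2 : W' ≤ W := le_sup_right.trans h1
            exact hWW (Submodule.eq_of_le_of_finrank_le h2 (hW.trans_le (hH' _ hh)))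
          · rintro x ⟨hx1, hx2⟩ y ⟨hy1, hy2⟩ l hl
            obtain ⟨a, ha, b, hb, rfl⟩ := Submodule.mem_sup.1 hl
            rw [(htr x).map_add, (htr y).map_add, hx1 ⟨a, ha⟩, hy1 ⟨a, ha⟩, hx2 ⟨b, hb⟩, hy2 ⟨b, hb⟩]
      · rintro x ⟨hxD, hxW⟩
        obtain ⟨h, hh, hxh⟩ := hx x hxD
        exact Set.mem_biUnion hh ⟨hxW, hxh⟩
    refine ⟨fun ⟨W, hW⟩ => ?_, ?_⟩
    · refine (hH.preimage (f := fun m : W → M => (⟨W, m⟩ : Σ W : Submodule F E, (W → M)))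
        ?_).subset fun m hm => ?_
      · intro m _ m' _ h
        simpa using h
      · by_contra hmH
        exact hm (key W hW m hmH)
    -- On the residual set, a member of codimension j is harmless: if it contains a residual point
    -- x, then its part inside D is the slice through x, which is covered in codimension j + 1 by
    -- the definition of residual.
    · refine (Covered.biUnion hH (D := fun h => {x | (x ∈ D ∧ ∀ W : {W : Submodule F E //
        Module.finrank F W = j}, Covered F tr (j + 1) {y | y ∈ D ∧ y ∈ affineSet tr W.1
          fun l => tr x l}) ∧ x ∈ affineSet tr h.1 h.2}) ?_).mono ?_
      · rintro ⟨W', m'⟩ hh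
        rcases (hH' _ hh).eq_or_lt with heq | hlt
        · by_cases hne : {x | (x ∈ D ∧ ∀ W : {W : Submodule F E //
            Module.finrank F W = j}, Covered F tr (j + 1) {y | y ∈ D ∧ y ∈ affineSet tr W.1
              fun l => tr x l}) ∧ x ∈ affineSet tr W' m'}.Nonempty
          · obtain ⟨x, ⟨hxD, hx'⟩, hxm⟩ := hne
            refine (hx' ⟨W', heq.symm⟩).mono ?_
            rintro y ⟨⟨hyD, -⟩, hym⟩
            exact ⟨hyD, fun l => (hym l).trans (hxm l).symm⟩
          · rw [Set.not_nonempty_iff_eq_empty] at hne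
            rw [hne]
            exact Covered.empty
        · exact covered_of_constant W' hlt fun x hx y hy l hl =>
            (hx.2 ⟨l, hl⟩).trans (hy.2 ⟨l, hl⟩).symm
      · rintro x ⟨hxD, hx'⟩
        obtain ⟨h, hh, hxh⟩ := hx x hxD
        exact Set.mem_biUnion hh ⟨⟨hxD, hx'⟩, hxh⟩
  · rintro ⟨h1, h2⟩
    -- The exceptional slices are finite in number, over finitely many directions, and each one
    -- covers itself.
    have h3 := Covered.biUnion (F := F) (tr := tr) (j := j)
      (Set.finite_univ (α := {W : Submodule F E // Module.finrank F W = j}))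
      (D := fun W => ⋃ m ∈ {m : W.1 → M | ¬ Covered F tr (j + 1) {x | x ∈ D ∧ x ∈ affineSet tr W.1 m}},
        affineSet tr W.1 m) fun W _ => Covered.biUnion (h1 W) fun m _ =>
          covered_of_constant W.1 W.2.ge fun x hx y hy l hl => (hx ⟨l, hl⟩).trans (hy ⟨l, hl⟩).symm
    refine ((h2.anti (Nat.le_succ j)).union h3).mono fun x hx => ?_
    by_cases hc : ∀ W : {W : Submodule F E // Module.finrank F W = j},
        Covered F tr (j + 1) {y | y ∈ D ∧ y ∈ affineSet tr W.1 fun l => tr x l}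
    · exact Or.inl ⟨hx, hc⟩
    · right
      push Not at hc
      obtain ⟨W, hW⟩ := hc
      exact Set.mem_biUnion (Set.mem_univ W) (Set.mem_biUnion hW fun l => rfl)

/-- No subspace has dimension greater than that of E, so no affine set is available. This is the
base of the downward recursion on codimension. -/
theorem covered_top_iff (h : Module.finrank F E < j) : Covered F tr j D ↔ ∀ x, x ∉ D := by
  constructor
  · rintro ⟨H, -, hH, hx⟩ x hxD
    obtain ⟨h', hh, -⟩ := hx x hxD
    have := (hH _ hh).trans (Submodule.finrank_le h'.1)
    omega
  · intro h
    rw [Set.eq_empty_iff_forall_notMem.2 h]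
    exact Covered.empty

end Covering

/-! ### Theories of vector spaces with additional structure -/

section Linear

variable {F : Type} [Field F] {L : FirstOrder.Language.{u, v}}

/-- Names in `L` for the operations of an `F`-vector space. -/
structure LinData (F : Type) (L : FirstOrder.Language.{u, v}) where
  zero : L.Functions 0
  add : L.Functions 2
  -- A term instead of a symbol: in a language of rings, a scalar of `ZMod p` acts as an iterated
  -- sum.
  smul : F → L.Term Unit

/-- The `L`-structure on `M` interprets the names in `d` by the operations of the `F`-vector
space `M`. -/
class LinCompat (d : LinData F L) (M : Type w) [L.Structure M] [AddCommGroup M] [Module F M] :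
    Prop where
  zero : ∀ x, Structure.funMap (M := M) d.zero x = 0
  add : ∀ x, Structure.funMap (M := M) d.add x = x 0 + x 1
  smul : ∀ (a : F) (x : Unit → M), (d.smul a).realize x = a • x ()

/-- All models of `T` are `F`-vector spaces for the operations named in `d`. -/
def IsLinearTheory (d : LinData F L) (T : L.Theory) : Prop :=
  ∀ (M : Type w) [L.Structure M] [Nonempty M] [M ⊨ T], ∃ (_ : AddCommGroup M) (_ : Module F M),
    LinCompat d M

/-- The linear combination with coefficients `c`, as a term. -/
noncomputable def LinData.comb (d : LinData F L) {α : Type} [Fintype α] (c : α → F) : L.Term α :=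
  ((Finset.univ : Finset α).toList).foldr
    (fun a t => d.add.apply₂ ((d.smul (c a)).relabel fun _ => a) t) (Constants.term d.zero)

theorem LinData.realize_comb (d : LinData F L) {M : Type w} [L.Structure M] [AddCommGroup M]
    [Module F M] [LinCompat d M] {α : Type} [Fintype α] (c : α → F) (x : α → M) :
    (d.comb c).realize x = ∑ a, c a • x a := by
  rw [← Finset.sum_map_toList, LinData.comb]
  induction (Finset.univ : Finset α).toList with
  | nil =>
    rw [List.foldr_nil, Term.realize_constants]
    exact LinCompat.zero (d := d) _
  | cons a l ih =>
    rw [List.foldr_cons, Term.realize_functions_apply₂, ih, LinCompat.add (d := d)]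
    simp [LinCompat.smul (d := d)]

/-- An embedding is linear. -/
def LinData.linearMap (d : LinData F L) {M N : Type w} [L.Structure M] [AddCommGroup M]
    [Module F M] [LinCompat d M] [L.Structure N] [AddCommGroup N] [Module F N] [LinCompat d N]
    (f : M ↪[L] N) : M →ₗ[F] N where
  toFun := f
  map_add' x y := by
    have := f.map_fun d.add ![x, y]
    simpa [LinCompat.add (d := d)] using this
  map_smul' a x := by
    have := HomClass.realize_term (g := f) (t := d.smul a) (v := fun _ => x)
    simpa [LinCompat.smul (d := d)] using this.symm

/-- The formula `φ(x, b)` has, in an elementary extension of `M`, a realisation that is linearly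
independent over `M`. -/
def IndepRealizable (d : LinData F L) {k : ℕ} {β : Type w'} (φ : L.Formula (Fin k ⊕ β)) (M : Type w)
    [L.Structure M] (b : β → M) : Prop :=
  ∃ (N : Type w) (_ : L.Structure N) (f : M ↪ₑ[L] N) (a : Fin k → N),
    φ.Realize (Sum.elim a (f ∘ b)) ∧ ∀ c : Fin k → F, c ≠ 0 → ∀ m : M, (d.comb c).realize a ≠ f m

variable {T : L.Theory} {d : LinData F L}

/-- Downward induction on the codimension k + 1 - i by `covered_iff`. Its finiteness clause is
definable by elimination of `∃^∞`, the values on a direction W forming a finite tuple since F is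
finite; its covering clauses fall under the induction hypothesis. The family P and its parameters
vary in the induction because slices bring new parameters. -/
theorem UDef.covered [Finite F] (hd : IsLinearTheory.{u, v, w} d T) (hT : EliminatesExistsInfinity.{u, v, w} T)
    {k : ℕ} (i : ℕ) : ∀ {α : Type} [Finite α]
    {P : ∀ (M : Type w) [L.Structure M], (α ⊕ Fin k → M) → Prop} (_ : UDef T P),
    UDef T fun M _ (b : α → M) =>
      Covered F (fun (x : Fin k → M) c => (d.comb c).realize x) (k + 1 - i)
        {x | P M (Sum.elim b x)} := by
  have hfin : Finite (Submodule F (Fin k → F)) := inferInstance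
  induction i with
  | zero =>
    intro α _ P hP
    refine hP.not.forall_tuple.of_iff fun M _ _ _ b => ?_
    rw [covered_top_iff (by simp)]
    rfl
  | succ i ih =>
    intro α _ P hP
    -- Past i = k + 1 the truncated subtraction stays at 0 and nothing changes.
    rcases le_or_gt (k + 1) i with hi | hi
    · have : k + 1 - (i + 1) = k + 1 - i := by omega
      rw [this]
      exact ih hP
    obtain ⟨j, hj⟩ : ∃ j, k + 1 - i = j + 1 := ⟨k - i, by omega⟩
    have hj' : k + 1 - (i + 1) = j := by omega
    rw [hj']
    simp only [hj] at ih
    have h1 (W : Submodule F (Fin k → F)) : UDef T fun M _ (b : α ⊕ W → M) =>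
        Covered F (fun (x : Fin k → M) c => (d.comb c).realize x) (j + 1)
          {x | P M (Sum.elim (b ∘ Sum.inl) x) ∧ x ∈ affineSet (fun (x : Fin k → M) c =>
            (d.comb c).realize x) W (b ∘ Sum.inr)} := by
      refine ih (P := fun M _ b => P M (Sum.elim ((b ∘ Sum.inl) ∘ Sum.inl) (b ∘ Sum.inr)) ∧
        (b ∘ Sum.inr) ∈ affineSet (fun (x : Fin k → M) c => (d.comb c).realize x) W
          ((b ∘ Sum.inl) ∘ Sum.inr)) (UDef.and ?_ ?_)
      · refine (hP.comp (Sum.elim (fun a => Sum.inl (Sum.inl a)) Sum.inr)).of_iff fun M _ _ _ b => ?_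
        refine Eq.to_iff (congrArg _ (funext fun x => ?_))
        cases x <;> rfl
      · refine UDef.finite_forall fun l => (UDef.equal ((d.comb l).relabel Sum.inr)
          (.var (Sum.inl (Sum.inr l)))).of_iff fun M _ _ _ b => ?_
        rw [Term.realize_relabel]; rfl
    have h2 : UDef T fun M _ (b : α ⊕ Fin k → M) =>
        P M b ∧ ∀ W : {W : Submodule F (Fin k → F) // Module.finrank F W = j},
        Covered F (fun (x : Fin k → M) c => (d.comb c).realize x) (j + 1)
          {x | P M (Sum.elim (b ∘ Sum.inl) x) ∧ x ∈ affineSet (fun (x : Fin k → M) c =>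
            (d.comb c).realize x) W.1 (fun l => (d.comb l).realize (b ∘ Sum.inr))} := by
      refine hP.and (UDef.finite_forall fun W => ((h1 W.1).subst (Sum.elim
        (fun a => .var (Sum.inl a)) fun l => (d.comb l).relabel Sum.inr)).of_iff
          fun M _ _ _ b => ?_)
      refine Eq.to_iff ?_
      congr 1
      ext x
      simp only [Set.mem_ofPred_eq, Function.comp_def, Sum.elim_inl, Term.realize_var, Sum.elim_inr,
        Term.realize_relabel]
    refine ((UDef.finite_forall fun W : {W : Submodule F (Fin k → F) // Module.finrank F W = j} =>
      (h1 W.1).not.setFinite hT).and (ih h2)).of_iff fun M _ _ _ b => ?_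
    obtain ⟨_, _, _⟩ := hd M
    have hlin (x : Fin k → M) : IsLinearMap F fun c => (d.comb c).realize x := by
      refine ⟨fun c c' => ?_, fun a c => ?_⟩
      · simp [d.realize_comb, add_smul, Finset.sum_add_distrib]
      · simp [d.realize_comb, Finset.smul_sum, mul_smul]
    refine Iff.trans ?_ (covered_iff hlin).symm
    simp only [Sum.elim_comp_inl, Sum.elim_comp_inr, Set.mem_ofPred_eq]

/-- There is a linearly independent realisation in an elementary extension if and only if the
realisations in `M` are not covered by finitely many proper affine subspaces. -/
theorem indepRealizable_iff (hd : IsLinearTheory.{u, v, max u v} d T) {k m : ℕ}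
    (φ : L.Formula (Fin k ⊕ Fin m)) (M : Type (max u v)) [L.Structure M] [Nonempty M] [M ⊨ T]
    (b : Fin m → M) :
    IndepRealizable d φ M b ↔ ¬ Covered F (fun (x : Fin k → M) c => (d.comb c).realize x) 1
      {x | φ.Realize (Sum.elim x b)} := by
  classical
  obtain ⟨_, _, _⟩ := hd M
  constructor
  · rintro ⟨N, _, f, a, ha, hind⟩ ⟨H, hH, hH1, hcov⟩
    have : Finite H := hH
    -- One nonzero functional from each member suffices: "every solution of φ satisfies one of these
    -- finitely many equations" is first-order, so it passes to N and contradicts the independence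
    -- of `a`.
    choose! c hcW hc0 using fun h (hh : h ∈ H) =>
      (Submodule.exists_mem_ne_zero_of_ne_bot (p := h.1) (by
        rintro h0
        have := hH1 h hh
        rw [h0, finrank_bot] at this
        omega))
    have e : H ≃ Fin (Nat.card H) := Finite.equivFin H
    have hdef : UDef.{u, v, max u v} T fun M _ (b : (Fin m ⊕ Fin (Nat.card H)) → M) => ∀ x : Fin k → M,
        φ.Realize (Sum.elim x (b ∘ Sum.inl)) →
          ∃ h : H, (d.comb (c h)).realize x = b (Sum.inr (e h)) := by
      refine UDef.forall_tuple (P := fun M _ b => φ.Realize (Sum.elim (b ∘ Sum.inr)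
        ((b ∘ Sum.inl) ∘ Sum.inl)) → ∃ h : H, (d.comb (c h)).realize (b ∘ Sum.inr) =
          (b ∘ Sum.inl) (Sum.inr (e h))) (UDef.imp ?_ ?_)
      · refine ((UDef.formula φ).comp (Sum.elim Sum.inr fun a => Sum.inl (Sum.inl a))).of_iff
          fun M _ _ _ b => ?_
        refine Eq.to_iff (congrArg _ (funext fun x => ?_))
        cases x <;> rfl
      · refine UDef.finite_exists fun h => (UDef.equal ((d.comb (c h)).relabel Sum.inr)
          (.var (Sum.inl (Sum.inr (e h))))).of_iff fun M _ _ _ b => ?_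
        rw [Term.realize_relabel]; rfl
    let z : H → M := fun h => h.1.2 ⟨_, hcW h.1 h.2⟩
    let b' : Fin m ⊕ Fin (Nat.card H) → M := Sum.elim b (z ∘ e.symm)
    have h1 := (hdef.map_iff f b').2 (by
      intro x hx
      obtain ⟨h, hh, hxh⟩ := hcov x hx
      refine ⟨⟨h, hh⟩, ?_⟩
      simp only [b', Sum.elim_inr, Function.comp_apply, Equiv.symm_apply_apply]
      exact hxh ⟨_, hcW h hh⟩) a ha
    obtain ⟨h, hh⟩ := h1
    exact hind _ (hc0 h h.2) _ hh
  · intro hcov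
    let Γ : Set (L.Formula (M ⊕ Fin k)) :=
      {γ | ∃ γ' ∈ elementaryDiagramFormulas L M, γ = γ'.relabel Sum.inl} ∪
      {φ.relabel (Sum.elim Sum.inr fun i => Sum.inl (b i))} ∪
      {γ | ∃ (c : Fin k → F) (m : M), c ≠ 0 ∧
        γ = (Term.equal ((d.comb c).relabel Sum.inr) (.var (Sum.inl m))).not}
    -- If a finite part of Γ had no solution in M, each solution of φ would violate one of its
    -- inequations. Each violated inequation is an affine condition in the direction spanned by c,
    -- so these finitely many conditions would cover the solution set.
    have hΓ : ∀ Γ₀ : Finset (L.Formula (M ⊕ Fin k)), ↑Γ₀ ⊆ Γ → ∃ x : Fin k → M,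
        ∀ γ ∈ Γ₀, γ.Realize (Sum.elim id x) := by
      intro Γ₀ hΓ₀
      by_contra! hno
      refine hcov ((Covered.biUnion (tr := fun (x : Fin k → M) c => (d.comb c).realize x) (j := 1)
        (F := F) Γ₀.finite_toSet (D := fun γ => {x | φ.Realize (Sum.elim x b) ∧
          ¬ γ.Realize (Sum.elim id x)}) ?_).mono ?_)
      · intro γ hγ
        rcases hΓ₀ hγ with (⟨γ', hγ', rfl⟩ | hγ') | ⟨c, m, hc, rfl⟩
        · convert! Covered.empty
          refine Set.eq_empty_iff_forall_notMem.2 fun x hx => hx.2 ?_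
          rw [Formula.realize_relabel]
          exact realize_of_mem_elementaryDiagramFormulas hγ'
        · convert! Covered.empty
          refine Set.eq_empty_iff_forall_notMem.2 fun x hx => hx.2 ?_
          rw [Set.mem_singleton_iff.1 hγ', Formula.realize_relabel]
          convert! hx.1 using 1
          ext i; cases i <;> rfl
        · refine covered_of_constant (Submodule.span F {c}) (finrank_span_singleton hc).ge ?_
          rintro x ⟨-, hx⟩ y ⟨-, hy⟩ l hl
          obtain ⟨s, rfl⟩ := Submodule.mem_span_singleton.1 hl
          rw [Formula.realize_not, not_not, Formula.realize_equal, Term.realize_relabel] at hx hy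
          have hx' : (d.comb c).realize x = m := hx
          have hy' : (d.comb c).realize y = m := hy
          rw [d.realize_comb] at hx' hy'
          simp only [d.realize_comb, Pi.smul_apply, smul_eq_mul, mul_smul, ← Finset.smul_sum,
            hx', hy']
      · intro x hx
        obtain ⟨γ, hγ, hγx⟩ := hno x
        exact Set.mem_biUnion hγ ⟨hx, hγx⟩
    -- The lift only places the variables in the universe demanded by the compactness lemma.
    have e : M ⊕ Fin k ≃ M ⊕ ULift.{max u v} (Fin k) := Equiv.sumCongr (Equiv.refl _) Equiv.ulift.symm
    obtain ⟨N, _, _, _, g, hg⟩ := exists_realize_of_finite (T := T)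
      ((fun γ : L.Formula (M ⊕ Fin k) => (γ.relabel e : L.Formula (M ⊕ ULift.{max u v} (Fin k)))) '' Γ)
      (by
        intro Γ₀ hΓ₀
        obtain ⟨Γ₁, h1, rfl⟩ := Finset.subset_set_image_iff.1 hΓ₀
        obtain ⟨x, hx⟩ := hΓ Γ₁ h1
        refine ⟨M, inferInstance, inferInstance, inferInstance, Sum.elim id x ∘ e.symm,
          fun γ hγ => ?_⟩
        obtain ⟨γ', hγ', rfl⟩ := Finset.mem_image.1 hγ
        rw [Formula.realize_relabel, Function.comp_assoc, Equiv.symm_comp_self]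
        exact hx γ' hγ')
    have hg' : ∀ γ ∈ Γ, γ.Realize (g ∘ e) := fun γ hγ => by
      have := hg _ ⟨γ, hγ, rfl⟩
      rwa [Formula.realize_relabel] at this
    let f : M ↪ₑ[L] N := elementaryOfDiagram (g ∘ e ∘ Sum.inl) fun γ hγ => by
      have := hg' _ (Or.inl (Or.inl ⟨γ, hγ, rfl⟩))
      rwa [Formula.realize_relabel] at this
    refine ⟨N, inferInstance, f, g ∘ e ∘ Sum.inr, ?_, ?_⟩
    · have := hg' _ (Or.inl (Or.inr rfl))
      rw [Formula.realize_relabel] at this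
      convert! this using 1
      ext i; cases i <;> rfl
    · intro c hc m
      have := hg' _ (Or.inr ⟨c, m, hc, rfl⟩)
      rw [Formula.realize_not, Formula.realize_equal, Term.realize_relabel] at this
      exact this

/-- If `T` eliminates `∃^∞`, then the existence of a linearly independent realisation in an
elementary extension is uniformly definable. -/
theorem UDef.indepRealizable [Finite F] (hd : IsLinearTheory.{u, v, max u v} d T)
    (hT : EliminatesExistsInfinity.{u, v, max u v} T) {k m : ℕ} (φ : L.Formula (Fin k ⊕ Fin m)) :
    UDef.{u, v, max u v} T fun M _ (b : Fin m → M) => IndepRealizable d φ M b := by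
  -- After k steps down from codimension k + 1, the codimension is 1.
  have := UDef.covered hd hT (k := k) k ((UDef.formula φ).comp (Sum.swap : Fin k ⊕ Fin m → Fin m ⊕ Fin k))
  refine this.not.of_iff fun M _ _ _ b => ?_
  rw [indepRealizable_iff hd, Nat.add_sub_cancel_left]
  have : ∀ x : Fin k → M, Sum.elim b x ∘ Sum.swap = Sum.elim x b := by
    intro x; ext i; cases i <;> rfl
  simp only [this]

end Linear

/-! ### Structures with unary predicates -/

section Predicates

variable {L : FirstOrder.Language.{u, v}} {n : ℕ}

/-- The set `M` with the subsets `V 0, …, V (n - 1)`. -/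
def WithPred {M : Type w} (_ : Fin n → Set M) : Type w := M

namespace WithPred

variable {M : Type w} {N : Type w'} (V : Fin n → Set M)

instance [S : L.Structure M] : L.Structure (WithPred V) := S

instance [h : Nonempty M] : Nonempty (WithPred V) := h

instance : (predLang n).Structure (WithPred V) where
  funMap f := f.elim
  RelMap r x := match r, x with
    | PredRel.pred i, x => x 0 ∈ V i

theorem relMap_predSym [L.Structure M] (i : Fin n) (x : Fin 1 → WithPred V) :
    Structure.RelMap (L := L.sum (predLang n)) (predSym L i) x ↔ x 0 ∈ V i := Iff.rfl

/-- Each structure for `L` with `n` unary predicates is an `L`-structure with `n` subsets. -/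
theorem forall_structure {p : ∀ (M : Type w) [(L.sum (predLang n)).Structure M], Prop}
    (h : ∀ (M : Type w) [L.Structure M] (V : Fin n → Set M), p (WithPred V)) (M : Type w)
    [S : (L.sum (predLang n)).Structure M] : p M := by
  let _ : L.Structure M := (LHom.sumInl : L →ᴸ L.sum (predLang n)).reduct M
  let V : Fin n → Set M := fun i =>
    {x | Structure.RelMap (L := L.sum (predLang n)) (predSym L i) ![x]}
  have hS : S = (inferInstance : (L.sum (predLang n)).Structure (WithPred V)) := by
    refine Structure.ext ?_ ?_
    · ext k f x
      rcases f with f | f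
      · rfl
      · exact f.elim
    · ext k r x
      rcases r with r | r
      · rfl
      · cases r with
        | pred i =>
          have : x = ![x 0] := by ext j; fin_cases j; rfl
          rw [this]
          rfl
  rw [hS]
  exact h M V

variable {V} {V' : Fin n → Set N}

/-- An embedding that respects the predicates. -/
def embedding [L.Structure M] [L.Structure N] (f : M ↪[L] N) (h : ∀ i x, f x ∈ V' i ↔ x ∈ V i) :
    WithPred V ↪[L.sum (predLang n)] WithPred V' where
  toFun := f
  inj' := f.injective
  map_fun' {k} g x := by
    rcases g with g | g
    · exact f.map_fun g x
    · exact g.elim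
  map_rel' {k} r x := by
    rcases r with r | r
    · exact f.map_rel r x
    · cases r with
      | pred i => exact h i (x 0)

/-- The underlying embedding of `L`-structures. -/
def baseEmbedding [L.Structure M] [L.Structure N]
    (f : WithPred V ↪[L.sum (predLang n)] WithPred V') : M ↪[L] N where
  toFun := f
  inj' := f.injective
  map_fun' {k} g x := f.map_fun (Sum.inl g : (L.sum (predLang n)).Functions k) x
  map_rel' {k} r x := f.map_rel (Sum.inl r : (L.sum (predLang n)).Relations k) x

theorem baseEmbedding_mem [L.Structure M] [L.Structure N]
    (f : WithPred V ↪[L.sum (predLang n)] WithPred V') (i : Fin n) (x : M) :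
    f x ∈ V' i ↔ x ∈ V i :=
  f.map_rel (predSym L i) fun _ => x

theorem realize_onFormula [L.Structure M] {α : Type*} (φ : L.Formula α) (x : α → M) :
    ((LHom.sumInl : L →ᴸ L.sum (predLang n)).onFormula φ).Realize (M := WithPred V) x ↔
      φ.Realize x :=
  LHom.realize_onFormula (M := WithPred V) LHom.sumInl φ

theorem model_onTheory [L.Structure M] (T : L.Theory) :
    WithPred V ⊨ (LHom.sumInl : L →ᴸ L.sum (predLang n)).onTheory T ↔ M ⊨ T :=
  LHom.onTheory_model (M := WithPred V) LHom.sumInl T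

theorem realize_predFormula [L.Structure M] (i : Fin n) {k : ℕ}
    (t : (L.sum (predLang n)).Term (Empty ⊕ Fin k)) (x : Fin k → WithPred V) :
    (predFormula i t).Realize (M := WithPred V) default x ↔
      t.realize (M := WithPred V) (Sum.elim default x) ∈ V i := by
  rw [predFormula, Relations.boundedFormula₁, BoundedFormula.realize_rel]
  rfl

theorem realize_closureAxiom [L.Structure M] (i : Fin n) {k : ℕ} (f : L.Functions k) :
    WithPred V ⊨ closureAxiom i f ↔
      ∀ x : Fin k → M, (∀ j, x j ∈ V i) → Structure.funMap f x ∈ V i := by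
  rw [closureAxiom, Sentence.Realize, BoundedFormula.realize_alls]
  refine forall_congr' fun x => ?_
  rw [BoundedFormula.realize_imp, BoundedFormula.realize_iInf]
  refine imp_congr (forall_congr' fun j => realize_predFormula i _ _) (realize_predFormula i _ _)

theorem realize_cardAxiom [L.Structure M] (i : Fin n) (k : ℕ) :
    WithPred V ⊨ cardAxiom L i k ↔ ∃ x : Fin k → M, (∀ j, x j ∈ V i) ∧ Function.Injective x := by
  rw [cardAxiom, Sentence.Realize, BoundedFormula.realize_exs]
  refine exists_congr fun x => ?_
  rw [BoundedFormula.realize_inf, BoundedFormula.realize_iInf, BoundedFormula.realize_iInf]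
  refine and_congr (forall_congr' fun j => realize_predFormula i _ _) ?_
  simp only [BoundedFormula.realize_not, BoundedFormula.realize_bdEqual]
  constructor
  · intro h a b hab
    by_contra hne
    exact h ⟨(a, b), hne⟩ hab
  · intro h p hp
    exact p.2 (h hp)

theorem model_substructureTheory {L₀ : FirstOrder.Language.{u₀, v₀}} (ι : L₀ →ᴸ L) (T : L.Theory)
    [L.Structure M] :
    WithPred V ⊨ substructureTheory ι T n ↔ M ⊨ T ∧ ∀ (i : Fin n) (k : ℕ) (f : L₀.Functions k)
      (x : Fin k → M), (∀ j, x j ∈ V i) → Structure.funMap (ι.onFunction f) x ∈ V i := by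
  rw [substructureTheory, Theory.model_union_iff, model_onTheory]
  refine and_congr Iff.rfl ⟨fun h i k f => ?_, fun h => ?_⟩
  · exact (realize_closureAxiom i _).1 (h.realize_of_mem _ ⟨i, k, f, rfl⟩)
  · refine ⟨?_⟩
    rintro _ ⟨i, k, f, rfl⟩
    exact (realize_closureAxiom i _).2 (h i k f)

theorem model_infiniteSubstructureTheory {L₀ : FirstOrder.Language.{u₀, v₀}} (ι : L₀ →ᴸ L)
    (T : L.Theory) [L.Structure M] :
    WithPred V ⊨ infiniteSubstructureTheory ι T n ↔
      WithPred V ⊨ substructureTheory ι T n ∧ ∀ i, (V i).Infinite := by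
  rw [infiniteSubstructureTheory, Theory.model_union_iff]
  refine and_congr Iff.rfl ⟨fun h i => ?_, fun h => ?_⟩
  · intro hfin
    obtain ⟨x, hx, hinj⟩ := (realize_cardAxiom i (hfin.toFinset.card + 1)).1
      (h.realize_of_mem _ ⟨i, _, rfl⟩)
    have := Finset.card_le_card (s := Finset.univ.map ⟨x, hinj⟩) (t := hfin.toFinset)
      (fun y hy => by
        obtain ⟨j, -, rfl⟩ := Finset.mem_map.1 hy
        exact hfin.mem_toFinset.2 (hx j))
    simp at this
  · refine ⟨?_⟩
    rintro _ ⟨i, k, rfl⟩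
    have := (h i).to_subtype
    refine (realize_cardAxiom i k).2 ⟨fun j => Infinite.natEmbedding (V i) j, fun j => by simp,
      fun a b hab => ?_⟩
    exact Fin.ext ((Infinite.natEmbedding (V i)).injective (Subtype.ext hab))

end WithPred

end Predicates

/-! ### Axioms for generic predicates -/

section Axioms

variable {F : Type} {L : FirstOrder.Language.{u, v}} {n : ℕ} (d : LinData F L)

/-- The linear combinations of `x` that lie in the predicates `V` are those in `S`. -/
def Trace {M : Type w} [L.Structure M] (V : Fin n → Set M) {α : Type} [Fintype α] (x : α → M)
    (S : Fin n → Set (α → F)) : Prop :=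
  ∀ i c, (d.comb c).realize x ∈ V i ↔ c ∈ S i

open Classical in
/-- The formula that expresses `Trace`. -/
noncomputable def traceFormula [Finite F] {α : Type} [Fintype α] (S : Fin n → Set (α → F)) :
    (L.sum (predLang n)).Formula α :=
  Formula.iInf fun p : Fin n × (α → F) =>
    if p.2 ∈ S p.1 then (predSym L p.1).formula₁ (LHom.sumInl.onTerm (d.comb p.2))
    else ((predSym L p.1).formula₁ (LHom.sumInl.onTerm (d.comb p.2))).not

theorem realize_traceFormula [Finite F] {M : Type w} [L.Structure M] (V : Fin n → Set M) {α : Type} [Fintype α]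
    (S : Fin n → Set (α → F)) (x : α → M) :
    (traceFormula d S).Realize (M := WithPred V) x ↔ Trace d V x S := by
  refine Formula.realize_iInf.trans (Prod.forall.trans ?_)
  refine forall_congr' fun i => forall_congr' fun c => ?_
  have h : ((predSym L i).formula₁ (LHom.sumInl.onTerm (d.comb c))).Realize (M := WithPred V) x ↔
      (d.comb c).realize x ∈ V i := by
    refine Formula.realize_rel₁.trans ((WithPred.relMap_predSym V i _).trans ?_)
    exact Eq.to_iff (congrArg (· ∈ V i) (LHom.realize_onTerm (M := WithPred V)
      (LHom.sumInl : L →ᴸ L.sum (predLang n)) _ x))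
  split_ifs with hc
  · exact h.trans (by simp [hc])
  · exact Formula.realize_not.trans (h.not.trans (by simp [hc]))

variable [Field F]

variable (F) in
/-- The conditions that `S` imposes on the parameters. -/
def restrictParam {k m : ℕ} (S : Fin n → Submodule F (Fin k ⊕ Fin m → F)) :
    Fin n → Set (Fin m → F) :=
  fun i => {c | Sum.elim (0 : Fin k → F) c ∈ S i}

/-- Every consistent description of a generic tuple by an `L`-formula and its linear relations with
the predicates is realised. -/
def IsGeneric {M : Type w} [L.Structure M] (V : Fin n → Set M) : Prop :=
  ∀ (k m : ℕ) (φ : L.Formula (Fin k ⊕ Fin m)) (S : Fin n → Submodule F (Fin k ⊕ Fin m → F))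
    (b : Fin m → M), IndepRealizable d φ M b → Trace d V b (restrictParam F S) →
      ∃ x : Fin k → M, φ.Realize (Sum.elim x b) ∧ Trace d V (Sum.elim x b) fun i => S i

variable [Finite F]

/-- There is a realisation of `φ` with the prescribed linear relations. -/
noncomputable def witnessFormula {k m : ℕ} (φ : L.Formula (Fin k ⊕ Fin m))
    (S : Fin n → Submodule F (Fin k ⊕ Fin m → F)) : (L.sum (predLang n)).Formula (Fin m) :=
  Formula.iExs (Fin k)
    ((LHom.sumInl.onFormula φ ⊓ traceFormula d fun i => (S i : Set _)).relabel Sum.swap)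

theorem realize_witnessFormula {M : Type w} [L.Structure M] (V : Fin n → Set M) {k m : ℕ}
    (φ : L.Formula (Fin k ⊕ Fin m)) (S : Fin n → Submodule F (Fin k ⊕ Fin m → F)) (b : Fin m → M) :
    (witnessFormula d φ S).Realize (M := WithPred V) b ↔
      ∃ x : Fin k → M, φ.Realize (Sum.elim x b) ∧ Trace d V (Sum.elim x b) fun i => S i := by
  refine (Formula.realize_iExs (M := WithPred V)).trans (exists_congr fun x : Fin k → M => ?_)
  have : Sum.elim b x ∘ Sum.swap = Sum.elim x b := by ext i; cases i <;> rfl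
  refine Formula.realize_relabel.trans (Formula.realize_inf.trans ?_)
  refine (and_congr (WithPred.realize_onFormula φ (Sum.elim b x ∘ Sum.swap))
    (realize_traceFormula d V _ (Sum.elim b x ∘ Sum.swap))).trans ?_
  rw [this]

/-- An axiom of the theory of generic predicates. -/
noncomputable def genericAxiom {k m : ℕ} (φ : L.Formula (Fin k ⊕ Fin m)) (θ : L.Formula (Fin m))
    (S : Fin n → Submodule F (Fin k ⊕ Fin m → F)) : (L.sum (predLang n)).Sentence :=
  Formula.iAlls (Fin m) (((LHom.sumInl.onFormula θ ⊓ traceFormula d (restrictParam F S)).imp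
    (witnessFormula d φ S)).relabel Sum.inr : (L.sum (predLang n)).Formula (Empty ⊕ Fin m))

theorem realize_genericAxiom {M : Type w} [L.Structure M] (V : Fin n → Set M) {k m : ℕ}
    (φ : L.Formula (Fin k ⊕ Fin m)) (θ : L.Formula (Fin m))
    (S : Fin n → Submodule F (Fin k ⊕ Fin m → F)) :
    WithPred V ⊨ genericAxiom d φ θ S ↔ ∀ b : Fin m → M, θ.Realize b →
      Trace d V b (restrictParam F S) →
      ∃ x : Fin k → M, φ.Realize (Sum.elim x b) ∧ Trace d V (Sum.elim x b) fun i => S i := by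
  rw [genericAxiom, Sentence.Realize, Formula.realize_iAlls]
  refine forall_congr' fun b => ?_
  refine Formula.realize_relabel.trans (Formula.realize_imp.trans ?_)
  refine (imp_congr_left Formula.realize_inf).trans (and_imp.trans ?_)
  exact imp_congr (WithPred.realize_onFormula θ _) (imp_congr (realize_traceFormula d V _ _)
    (realize_witnessFormula d V φ S _))

/-- The theory of models of `T` with `n` generic predicates for substructures. -/
def genericTheory {L₀ : FirstOrder.Language.{u₀, v₀}} (ι : L₀ →ᴸ L) (T : L.Theory) (n : ℕ) :
    (L.sum (predLang n)).Theory :=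
  substructureTheory ι T n ∪ {σ | ∃ (k m : ℕ) (φ : L.Formula (Fin k ⊕ Fin m))
    (θ : L.Formula (Fin m)) (S : Fin n → Submodule F (Fin k ⊕ Fin m → F)),
    (∀ (M : Type (max u v)) [L.Structure M] [Nonempty M] [M ⊨ T] (b : Fin m → M), θ.Realize b ↔
      IndepRealizable d φ M b) ∧ σ = genericAxiom d φ θ S}

/-- Elimination of `∃^∞` supplies at least one θ for each φ, so every instance of genericity is
among the axioms. Letting θ range over all suitable formulas avoids choosing one. -/
theorem model_genericTheory {L₀ : FirstOrder.Language.{u₀, v₀}} (ι : L₀ →ᴸ L) {T : L.Theory}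
    (hd : IsLinearTheory.{u, v, max u v} d T) (hT : EliminatesExistsInfinity.{u, v, max u v} T)
    {M : Type (max u v)} [L.Structure M] [Nonempty M] (V : Fin n → Set M) :
    WithPred V ⊨ genericTheory d ι T n ↔ WithPred V ⊨ substructureTheory ι T n ∧ IsGeneric d V := by
  rw [genericTheory, Theory.model_union_iff]
  refine and_congr_right fun hM => ?_
  have := ((WithPred.model_substructureTheory ι T).1 hM).1
  constructor
  · intro h k m φ S b hb
    obtain ⟨θ, hθ⟩ := UDef.indepRealizable hd hT φ
    exact (realize_genericAxiom d V φ θ S).1 (h.realize_of_mem _ ⟨k, m, φ, θ, S, hθ, rfl⟩) b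
      ((hθ M b).2 hb)
  · intro h
    refine ⟨?_⟩
    rintro _ ⟨k, m, φ, θ, S, hθ, rfl⟩
    exact (realize_genericAxiom d V φ θ S).2 fun b hb => h k m φ S b ((hθ M b).1 hb)

end Axioms

/-! ### Existence of generic extensions -/

section Existence

variable {F : Type} {L : FirstOrder.Language.{u, v}} {n : ℕ} {d : LinData F L}

theorem realize_comb_comp {M N : Type*} [L.Structure M] [L.Structure N]
    {α : Type} [Fintype α] (c : α → F) (f : M ↪[L] N) (x : α → M) :
    (d.comb c).realize (f ∘ x) = f ((d.comb c).realize x) :=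
  HomClass.realize_term f

theorem Trace.comp_iff {M N : Type w} [L.Structure M] [L.Structure N] {V : Fin n → Set M}
    {V' : Fin n → Set N} (f : M ↪[L] N) (hf : ∀ i x, f x ∈ V' i ↔ x ∈ V i) {α : Type} [Fintype α]
    (x : α → M) (S : Fin n → Set (α → F)) : Trace d V' (f ∘ x) S ↔ Trace d V x S := by
  refine forall_congr' fun i => forall_congr' fun c => ?_
  rw [realize_comb_comp, hf]

variable [Field F]

/-- In models of `T` the subsets closed under the functions named in `L₀` are the subspaces. -/
def ClosedIffSubspace {L₀ : FirstOrder.Language.{u₀, v₀}} (d : LinData F L) (ι : L₀ →ᴸ L)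
    (T : L.Theory) : Prop :=
  ∀ (M : Type w) [L.Structure M] [Nonempty M] [M ⊨ T] [AddCommGroup M] [Module F M] [LinCompat d M]
    (X : Set M), (∀ (k : ℕ) (f : L₀.Functions k) (x : Fin k → M), (∀ j, x j ∈ X) →
      Structure.funMap (ι.onFunction f) x ∈ X) ↔ ∃ W : Submodule F M, (W : Set M) = X

theorem LinData.realize_comb_eq (d : LinData F L) {M : Type w} [L.Structure M] [AddCommGroup M]
    [Module F M] [LinCompat d M] {α : Type} [Fintype α] (c : α → F) (x : α → M) :
    (d.comb c).realize x = Fintype.linearCombination F x c := by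
  rw [d.realize_comb, Fintype.linearCombination_apply]

theorem model_substructureTheory_iff {L₀ : FirstOrder.Language.{u₀, v₀}} {ι : L₀ →ᴸ L}
    {T : L.Theory} (hι : ClosedIffSubspace.{u, v, u₀, v₀, w} d ι T) {M : Type w} [L.Structure M]
    [Nonempty M] [M ⊨ T] [AddCommGroup M] [Module F M] [LinCompat d M] (V : Fin n → Set M) :
    WithPred V ⊨ substructureTheory ι T n ↔ ∃ W : Fin n → Submodule F M, V = fun i => ↑(W i) := by
  rw [WithPred.model_substructureTheory]
  simp only [hι M, (inferInstance : M ⊨ T), true_and]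
  constructor
  · intro h
    choose W hW using h
    exact ⟨W, funext fun i => (hW i).symm⟩
  · rintro ⟨W, rfl⟩ i
    exact ⟨W i, rfl⟩

/-- An extension that realises one description of a generic tuple. -/
theorem exists_extension_realizing {T : L.Theory} (hd : IsLinearTheory.{u, v, w} d T) {M : Type w}
    [L.Structure M] [Nonempty M] [M ⊨ T] [AddCommGroup M] [Module F M] [LinCompat d M]
    (V : Fin n → Submodule F M) {k m : ℕ} (φ : L.Formula (Fin k ⊕ Fin m))
    (S : Fin n → Submodule F (Fin k ⊕ Fin m → F)) (b : Fin m → M) (h : IndepRealizable d φ M b)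
    (ht : Trace d (fun i => (V i : Set M)) b (restrictParam F S)) :
    ∃ (N : Type w) (_ : L.Structure N) (_ : AddCommGroup N) (_ : Module F N) (_ : LinCompat d N)
      (f : M ↪ₑ[L] N) (V' : Fin n → Submodule F N), (∀ i x, f x ∈ V' i ↔ x ∈ V i) ∧
        ∃ x : Fin k → N, φ.Realize (Sum.elim x (f ∘ b)) ∧
          Trace d (fun i => (V' i : Set N)) (Sum.elim x (f ∘ b)) fun i => S i := by
  obtain ⟨N, _, f, a, ha, hind⟩ := h
  have : Nonempty N := Nonempty.map f inferInstance
  have : N ⊨ T := (f.theory_model_iff T).1 inferInstance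
  obtain ⟨_, _, _⟩ := hd N
  let fl := d.linearMap f.toEmbedding
  let lc := Fintype.linearCombination F (Sum.elim a (f ∘ b))
  have hfl : ∀ x, fl x = f x := fun _ => rfl
  have hlc (c : Fin k ⊕ Fin m → F) : lc c = Fintype.linearCombination F a (c ∘ Sum.inl) +
      fl (Fintype.linearCombination F b (c ∘ Sum.inr)) := by
    simp only [lc, Fintype.linearCombination_apply, Fintype.sum_sum_type, map_sum, map_smul]
    rfl
  -- A combination of `a` and the parameters that falls into M involves no entry of `a`, by
  -- independence; on such combinations S is tied to V by the hypothesis on the parameters.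
  have key (i : Fin n) (c : Fin k ⊕ Fin m → F) (x : M) (hc : lc c = f x) : x ∈ V i ↔ c ∈ S i := by
    have h0 : c ∘ Sum.inl = 0 := by
      by_contra hne
      refine hind _ hne (x - Fintype.linearCombination F b (c ∘ Sum.inr)) ?_
      rw [d.realize_comb_eq, ← hfl, map_sub, eq_sub_iff_add_eq, ← hlc, hc, hfl]
    rw [hlc, h0, map_zero, zero_add, hfl, f.injective.eq_iff] at hc
    have hc' : c = Sum.elim (0 : Fin k → F) (c ∘ Sum.inr) := by
      rw [← h0, Sum.elim_comp_inl_inr]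
    have := ht i (c ∘ Sum.inr)
    rw [d.realize_comb_eq, hc] at this
    rw [hc']
    exact this
  -- The new subspaces are the least possible ones: the image of V plus the combinations prescribed
  -- by S. By `key`, the two summands agree on their overlap, so neither the trace on M nor the
  -- trace on the tuple grows.
  refine ⟨N, inferInstance, inferInstance, inferInstance, inferInstance, f,
    fun i => (V i).map fl ⊔ (S i).map lc, fun i x => ⟨fun hx => ?_, fun hx => ?_⟩, a, ha,
      fun i c => ?_⟩
  · obtain ⟨_, ⟨v, hv, rfl⟩, _, ⟨s, hs, rfl⟩, hvs⟩ := Submodule.mem_sup.1 hx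
    have : x - v ∈ V i := by
      refine (key i s (x - v) ?_).2 hs
      rw [← hfl, map_sub, eq_sub_iff_add_eq', hvs, hfl]
    simpa using (V i).add_mem this hv
  · exact Submodule.mem_sup_left ⟨x, hx, rfl⟩
  · change _ ∈ ((V i).map fl ⊔ (S i).map lc) ↔ c ∈ S i
    rw [d.realize_comb_eq]
    constructor
    · intro hx
      obtain ⟨_, ⟨v, hv, rfl⟩, _, ⟨s, hs, rfl⟩, hvs⟩ := Submodule.mem_sup.1 hx
      have : c - s ∈ S i := by
        refine (key i (c - s) v ?_).1 hv
        rw [map_sub, sub_eq_iff_eq_add, ← hfl, hvs]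
      simpa using (S i).add_mem this hs
    · exact fun hc => Submodule.mem_sup_right ⟨c, hc, rfl⟩

/-- A description of a generic tuple, with parameters in `M`. -/
structure Description (F : Type) [Field F] (L : FirstOrder.Language.{u, v}) (n : ℕ) (M : Type w) where
  k : ℕ
  m : ℕ
  φ : L.Formula (Fin k ⊕ Fin m)
  S : Fin n → Submodule F (Fin k ⊕ Fin m → F)
  b : Fin m → M

/-- The description is consistent. -/
def Description.IsConsistent {M : Type w} [L.Structure M] (d : LinData F L) (V : Fin n → Set M)
    (D : Description F L n M) : Prop :=
  IndepRealizable d D.φ M D.b ∧ Trace d V D.b (restrictParam F D.S)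

/-- The description is realised in the extension `f : M → N`. -/
def Description.IsRealized {M N : Type w} [L.Structure N] (d : LinData F L) (V : Fin n → Set N)
    (f : M → N) (D : Description F L n M) : Prop :=
  ∃ x : Fin D.k → N, D.φ.Realize (Sum.elim x (f ∘ D.b)) ∧
    Trace d V (Sum.elim x (f ∘ D.b)) fun i => D.S i

variable [Finite F]

/-- The descriptions are realised one after another. A consistent description stays consistent
because independent realisability is uniformly definable, hence invariant under elementary
embeddings; a realised one stays realised because later embeddings are elementary and respect the
predicates. -/
theorem exists_extension_realizing_finset {T : L.Theory}
    (hd : IsLinearTheory.{u, v, max u v} d T)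
    (hT : EliminatesExistsInfinity.{u, v, max u v} T) {M : Type (max u v)}
    [L.Structure M] [Nonempty M] [M ⊨ T] [AddCommGroup M] [Module F M] [LinCompat d M]
    (V : Fin n → Submodule F M) (I : Finset (Description F L n M))
    (hI : ∀ D ∈ I, D.IsConsistent d fun i => V i) :
    ∃ (N : Type (max u v)) (_ : L.Structure N) (_ : AddCommGroup N) (_ : Module F N)
      (_ : LinCompat d N) (f : M ↪ₑ[L] N) (V' : Fin n → Submodule F N),
      (∀ i x, f x ∈ V' i ↔ x ∈ V i) ∧ ∀ D ∈ I, D.IsRealized d (fun i => (V' i : Set N)) f := by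
  classical
  induction I using Finset.induction_on with
  | empty =>
    exact ⟨M, inferInstance, inferInstance, inferInstance, inferInstance,
      ElementaryEmbedding.refl L M, V, fun _ _ => Iff.rfl, by simp⟩
  | insert D I _ ih =>
    obtain ⟨N, _, _, _, _, f, V', hf, hI'⟩ := ih fun D' hD' => hI D' (Finset.mem_insert_of_mem hD')
    have : Nonempty N := Nonempty.map f inferInstance
    have : N ⊨ T := (f.theory_model_iff T).1 inferInstance
    obtain ⟨h1, h2⟩ := hI D (Finset.mem_insert_self _ _)
    obtain ⟨N', _, _, _, _, g, V'', hg, hN'⟩ := exists_extension_realizing hd V' D.φ D.S (f ∘ D.b)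
      (((UDef.indepRealizable hd hT D.φ).map_iff f D.b).2 h1)
      ((Trace.comp_iff f.toEmbedding hf D.b _).2 h2)
    refine ⟨N', inferInstance, inferInstance, inferInstance, inferInstance, g.comp f, V'',
      fun i x => (hg i _).trans (hf i x), fun D' hD' => ?_⟩
    rcases Finset.mem_insert.1 hD' with rfl | hD'
    · exact hN'
    · obtain ⟨x, hx, hx'⟩ := hI' D' hD'
      have hcomp : Sum.elim (g ∘ x) (⇑(g.comp f) ∘ D'.b) = g ∘ Sum.elim x (f ∘ D'.b) := by
        rw [Sum.comp_elim]; rfl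
      refine ⟨g ∘ x, ?_, ?_⟩
      · rw [hcomp, g.map_formula]
        exact hx
      · rw [hcomp]
        exact (Trace.comp_iff g.toEmbedding hg _ _).2 hx'

/-- An extension that realises all consistent descriptions of generic tuples over `M`. -/
theorem exists_extension_realizing_all {L₀ : FirstOrder.Language.{u₀, v₀}} {ι : L₀ →ᴸ L}
    {T : L.Theory} (hd : IsLinearTheory.{u, v, max u v} d T)
    (hT : EliminatesExistsInfinity.{u, v, max u v} T)
    (hι : ClosedIffSubspace.{u, v, u₀, v₀, max u v} d ι T) {M : Type (max u v)}
    [L.Structure M] [Nonempty M] (V : Fin n → Set M) (hV : WithPred V ⊨ substructureTheory ι T n) :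
    ∃ (N : Type (max u v)) (_ : L.Structure N) (f : M ↪ₑ[L] N) (V' : Fin n → Set N),
      WithPred V' ⊨ substructureTheory ι T n ∧ (∀ i x, f x ∈ V' i ↔ x ∈ V i) ∧
        ∀ D : Description F L n M, D.IsConsistent d V → D.IsRealized d V' f := by
  classical
  have hM : M ⊨ T := ((WithPred.model_substructureTheory ι T).1 hV).1
  obtain ⟨_, _, _⟩ := hd M
  obtain ⟨W, rfl⟩ := (model_substructureTheory_iff hι V).1 hV
  let L' := L.sum (predLang n)
  let Γ₁ : Set (L'.Formula M) := LHom.sumInl.onFormula '' elementaryDiagramFormulas L M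
  let Γ₂ : Set (L'.Formula M) := {γ | ∃ i, ∃ x ∈ W i, γ = (predSym L i).formula₁ (.var x)}
  let Γ₃ : Set (L'.Formula M) := {γ | ∃ i, ∃ x ∉ W i, γ = ((predSym L i).formula₁ (.var x)).not}
  let Γ₄ : Set (L'.Formula M) := (fun D : Description F L n M =>
    (witnessFormula d D.φ D.S).relabel D.b) '' {D | D.IsConsistent d fun i => W i}
  obtain ⟨N, S, hne, hN, e, he⟩ := exists_realize_of_finite (T := substructureTheory ι T n)
    (Γ₁ ∪ Γ₂ ∪ Γ₃ ∪ Γ₄) (by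
      intro Γ₀ hΓ₀
      -- Only the finitely many descriptions named in the finite set have to be realised; the
      -- diagram and the literals hold in every such extension.
      obtain ⟨I, hI, hI'⟩ := Finset.subset_set_image_iff.1
        (show ↑(Γ₀.filter (· ∈ Γ₄)) ⊆ Γ₄ from fun γ hγ => (Finset.mem_filter.1 hγ).2)
      obtain ⟨N, _, _, _, _, f, V', hf, hN⟩ := exists_extension_realizing_finset hd hT W I hI
      have : Nonempty N := Nonempty.map f inferInstance
      have : N ⊨ T := (f.theory_model_iff T).1 inferInstance
      refine ⟨WithPred fun i => (V' i : Set N), inferInstance, inferInstance,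
        (model_substructureTheory_iff hι _).2 ⟨V', rfl⟩, f, fun γ hγ => ?_⟩
      rcases hΓ₀ hγ with ((⟨γ', ⟨j, φ, x, hx, rfl⟩, rfl⟩ | ⟨i, x, hx, rfl⟩) | ⟨i, x, hx, rfl⟩) | hγ'
      · refine (WithPred.realize_onFormula _ _).2 (Formula.realize_relabel.2 ?_)
        rwa [f.map_formula]
      · exact Formula.realize_rel₁.2 ((hf i x).2 hx)
      · exact Formula.realize_not.2 fun h => hx ((hf i x).1 (Formula.realize_rel₁.1 h))
      · have : γ ∈ I.image fun D : Description F L n M =>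
          (witnessFormula d D.φ D.S).relabel D.b := by
          rw [hI']
          exact Finset.mem_filter.2 ⟨hγ, hγ'⟩
        obtain ⟨D, hD, rfl⟩ := Finset.mem_image.1 this
        exact Formula.realize_relabel.2 ((realize_witnessFormula d _ _ _ _).2 (hN D hD)))
  revert e hN hne
  refine WithPred.forall_structure (L := L) (n := n) (p := fun N _ => Nonempty N →
    N ⊨ substructureTheory ι T n → ∀ e : M → N, (∀ γ ∈ Γ₁ ∪ Γ₂ ∪ Γ₃ ∪ Γ₄, γ.Realize e) → _) ?_ N
  intro N _ V' _ hN e he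
  let f : M ↪ₑ[L] N := elementaryOfDiagram e fun γ hγ =>
    (WithPred.realize_onFormula γ e).1 (he _ (Or.inl (Or.inl (Or.inl ⟨γ, hγ, rfl⟩))))
  refine ⟨N, inferInstance, f, V', hN, fun i x => ⟨fun hx => ?_, fun hx => ?_⟩, fun D hD => ?_⟩
  · by_contra hn
    exact Formula.realize_not.1 (he _ (Or.inl (Or.inr ⟨i, x, hn, rfl⟩))) (Formula.realize_rel₁.2 hx)
  · exact Formula.realize_rel₁.1 (he _ (Or.inl (Or.inl (Or.inr ⟨i, x, hx, rfl⟩))))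
  · exact (realize_witnessFormula d _ _ _ _).1
      (Formula.realize_relabel.1 (he _ (Or.inr ⟨D, hD, rfl⟩)))

end Existence

/-! ### Unions of chains -/

section Union

variable {L : FirstOrder.Language.{u, v}}

/-- The union is the direct limit of the underlying embeddings; Tarski's theorem makes the canonical
maps elementary. -/
theorem exists_union_of_chain {G : ℕ → Type w} [∀ i, L.Structure (G i)]
    (e : ∀ i, G i ↪ₑ[L] G (i + 1)) :
    ∃ (Z : Type w) (_ : L.Structure Z) (g : ∀ i, G i ↪ₑ[L] Z),
      (∀ i x, g (i + 1) (e i x) = g i x) ∧ ∀ z, ∃ i x, g i x = z := by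
  let f := fun i => (e i).toEmbedding
  let g₀ := fun i => DirectLimit.of L ℕ G (fun i j h => DirectedSystem.natLERec f i j h) i
  have hg : ∀ i x, g₀ (i + 1) (f i x) = g₀ i x := by
    intro i x
    rw [← DirectLimit.of_f (hij := Nat.le_succ i)]
    congr 1
    rw [DirectedSystem.coe_natLERec]
    exact (Nat.leRecOn_succ' (C := G) (next := fun {k} => ⇑(f k)) x).symm
  have hZ : ∀ z, ∃ i x, g₀ i x = z := DirectLimit.exists_of
  have hel := fun {α : Type} {n : ℕ} (φ : L.BoundedFormula α n) =>
    realize_iff_of_chain e g₀ hg hZ φ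
  refine ⟨_, inferInstance, fun i => ⟨g₀ i, fun n φ x => ?_⟩, hg, hZ⟩
  have := hel φ i x default
  rwa [Unique.eq_default (g₀ i ∘ default)] at this

end Union

/-! ### Generic extensions as unions of countable chains -/

section Existence

variable {F : Type} [Field F] [Finite F] {L : FirstOrder.Language.{u, v}} {n : ℕ} {d : LinData F L}
  {L₀ : FirstOrder.Language.{u₀, v₀}} {ι : L₀ →ᴸ L} {T : L.Theory}

/-- A model of `T` with predicates for substructures. -/
structure PredModel (ι : L₀ →ᴸ L) (T : L.Theory) (n : ℕ) where
  carrier : Type (max u v)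
  [str : L.Structure carrier]
  [nonempty : Nonempty carrier]
  V : Fin n → Set carrier
  model : WithPred V ⊨ substructureTheory ι T n

attribute [instance] PredModel.str PredModel.nonempty

/-- Each model of `T` with predicates for subspaces has a generic extension. -/
theorem exists_generic_extension (hd : IsLinearTheory.{u, v, max u v} d T)
    (hT : EliminatesExistsInfinity.{u, v, max u v} T)
    (hι : ClosedIffSubspace.{u, v, u₀, v₀, max u v} d ι T) {M : Type (max u v)}
    [L.Structure M] [Nonempty M] (V : Fin n → Set M) (hV : WithPred V ⊨ substructureTheory ι T n) :
    ∃ (N : Type (max u v)) (_ : L.Structure N) (f : M ↪ₑ[L] N) (V' : Fin n → Set N),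
      WithPred V' ⊨ substructureTheory ι T n ∧ (∀ i x, f x ∈ V' i ↔ x ∈ V i) ∧
        IsGeneric d V' := by
  have hstep : ∀ P : PredModel ι T n, ∃ (Q : PredModel ι T n) (f : P.carrier ↪ₑ[L] Q.carrier),
      (∀ i x, f x ∈ Q.V i ↔ x ∈ P.V i) ∧
        ∀ D : Description F L n P.carrier, D.IsConsistent d P.V → D.IsRealized d Q.V f := by
    intro P
    obtain ⟨N, _, f, V', h1, h2, h3⟩ := exists_extension_realizing_all hd hT hι P.V P.model
    have : Nonempty N := Nonempty.map f inferInstance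
    exact ⟨⟨N, V', h1⟩, f, h2, h3⟩
  choose next f hf hreal using hstep
  let P : ℕ → PredModel ι T n := fun i =>
    Nat.rec (motive := fun _ => PredModel ι T n) ⟨M, V, hV⟩ (fun _ => next) i
  let str : ∀ i, L.Structure (P i).carrier := fun i => (P i).str
  let e : ∀ i, @ElementaryEmbedding L (P i).carrier (P (i + 1)).carrier (P i).str (P (i + 1)).str :=
    fun i => f (P i)
  obtain ⟨Z, _, g, hg, hZ⟩ := exists_union_of_chain (G := fun i => (P i).carrier) e
  -- The predicates on the limit are unions of images; since the chain maps reflect the predicates,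
  -- each stage recovers its own ones.
  let VZ : Fin n → Set Z := fun i => {z | ∃ j x, x ∈ (P j).V i ∧ g j x = z}
  have lift : ∀ i j, i ≤ j → ∃ E : (P i).carrier → (P j).carrier, (∀ x, g j (E x) = g i x) ∧
      ∀ a x, E x ∈ (P j).V a ↔ x ∈ (P i).V a := by
    intro i j hij
    induction j, hij using Nat.le_induction with
    | base => exact ⟨id, fun _ => rfl, fun _ _ => Iff.rfl⟩
    | succ j _ ih =>
      obtain ⟨E, hE, hE'⟩ := ih
      exact ⟨e j ∘ E, fun x => (hg j _).trans (hE x), fun a x => (hf (P j) a _).trans (hE' a x)⟩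
  have hVZ : ∀ j i x, g j x ∈ VZ i ↔ x ∈ (P j).V i := by
    intro j i x
    refine ⟨?_, fun hx => ⟨j, x, hx, rfl⟩⟩
    rintro ⟨j', x', hx', hgx⟩
    obtain ⟨E, hE, hEV⟩ := lift j (max j j') (le_max_left _ _)
    obtain ⟨E', hE', hEV'⟩ := lift j' (max j j') (le_max_right _ _)
    have : E x = E' x' := (g _).injective (by rw [hE, hE', hgx])
    rw [← hEV, this, hEV']
    exact hx'
  have hfin {α : Type} [Finite α] (z : α → Z) :
      ∃ j, ∃ x : α → (P j).carrier, z = g j ∘ x := by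
    choose j x hx using fun a => hZ (z a)
    obtain ⟨s, hs⟩ := (Set.finite_range j).bddAbove
    choose E hE _ using fun a => lift (j a) s (hs ⟨a, rfl⟩)
    exact ⟨s, fun a => E a (x a), funext fun a => by rw [Function.comp_apply, hE, hx]⟩
  have hZT : Z ⊨ T := by
    refine ((g 0).theory_model_iff T).1 ?_
    exact ((WithPred.model_substructureTheory ι T).1 (P 0).model).1
  refine ⟨Z, inferInstance, g 0, VZ, ?_, fun i x => hVZ 0 i x, ?_⟩
  · refine (WithPred.model_substructureTheory ι T).2 ⟨hZT, fun i k h x hx => ?_⟩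
    obtain ⟨j, y, rfl⟩ := hfin x
    have := ((WithPred.model_substructureTheory ι T).1 (P j).model).2 i k h y
      fun a => (hVZ j i _).1 (hx a)
    rw [← (g j).map_fun]
    exact (hVZ j i _).2 this
  · intro k m φ S b hb ht
    -- Finitely many parameters live at one stage j. Consistency descends to that stage, and stage j
    -- + 1 was built to realise the description.
    obtain ⟨j, y, rfl⟩ := hfin b
    have hPT : (P j).carrier ⊨ T := ((WithPred.model_substructureTheory ι T).1 (P j).model).1
    obtain ⟨x, hx, hx'⟩ := hreal (P j) ⟨k, m, φ, S, y⟩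
      ⟨((UDef.indepRealizable hd hT φ).map_iff (g j) y).1 hb,
        (Trace.comp_iff (g j).toEmbedding (fun i x => hVZ j i x) y _).1 ht⟩
    have hcomp : Sum.elim (g (j + 1) ∘ x) (g j ∘ y) =
        g (j + 1) ∘ Sum.elim x (f (P j) ∘ y) := by
      rw [Sum.comp_elim, ← Function.comp_assoc]
      congr 1
      exact funext fun a => (hg j _).symm
    refine ⟨g (j + 1) ∘ x, ?_, ?_⟩
    · rw [hcomp, (g (j + 1)).map_formula]
      exact hx
    · rw [hcomp]
      exact (Trace.comp_iff (g (j + 1)).toEmbedding (fun i x => hVZ (j + 1) i x) _ _).2 hx'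

end Existence

/-! ### Model completeness of the theory of generic predicates -/

section ModelComplete

variable {F : Type} [Field F] {L : FirstOrder.Language.{u, v}} {n : ℕ} {d : LinData F L}
  {L₀ : FirstOrder.Language.{u₀, v₀}} {ι : L₀ →ᴸ L} {T : L.Theory}

theorem realize_congr_freeVar {M : Type*} [L.Structure M] {α : Type*} [DecidableEq α]
    (χ : L.Formula α) {e e' : α → M}
    (h : ∀ x ∈ BoundedFormula.freeVarFinset χ, e x = e' x) : χ.Realize e ↔ χ.Realize e' := by
  have key (e : α → M) := BoundedFormula.realize_restrictFreeVar' (φ := χ)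
    (s := ↑(BoundedFormula.freeVarFinset χ)) subset_rfl (v := e) (xs := default)
  rw [Formula.Realize, Formula.Realize, ← key, ← key]
  have : e ∘ ((↑) : ↑(BoundedFormula.freeVarFinset χ : Set α) → α) = e' ∘ (↑) :=
    funext fun x => h x x.2
  rw [this]

/-- Generic structures are existentially closed. -/
theorem IsGeneric.exists_specialization {M N : Type w}
    [L.Structure M] [AddCommGroup M] [Module F M] [LinCompat d M] [L.Structure N] {V : Fin n → Set M} [AddCommGroup N] [Module F N] [LinCompat d N]
    (V' : Fin n → Submodule F N) (f : M ↪ₑ[L] N)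
    (hf : ∀ i x, f x ∈ V' i ↔ x ∈ V i) (hV : IsGeneric d V) (χ : L.Formula N) (hχ : χ.Realize id)
    (B : Finset N) : ∃ e : N → M, (∀ x, e (f x) = x) ∧ χ.Realize e ∧
      ∀ x ∈ B, ∀ i, e x ∈ V i ↔ x ∈ V' i := by
  classical
  let fl := d.linearMap f.toEmbedding
  have hfl : ∀ x, fl x = f x := fun _ => rfl
  let B' : Finset N := B ∪ BoundedFormula.freeVarFinset χ
  let π := fl.range.mkQ
  -- Lifts of a basis of this finite-dimensional space form a tuple `a` independent over M, and each
  -- element of `B'` is a combination of `a` plus an element of M.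
  let P : Submodule F (N ⧸ fl.range) := Submodule.span F (π '' B')
  have : Module.Finite F P := Module.Finite.span_of_finite F (B'.finite_toSet.image π)
  let bP := Module.finBasis F P
  choose a ha using fun j => fl.range.mkQ_surjective (bP j : N ⧸ fl.range)
  have hrep : ∀ x : B', ∃ (c : Fin (Module.finrank F P) → F) (m : M),
      (x : N) = Fintype.linearCombination F a c + f m := by
    intro x
    let px : P := ⟨π x, Submodule.subset_span ⟨x, x.2, rfl⟩⟩
    have h1 : π (x - Fintype.linearCombination F a (bP.repr px)) = 0 := by
      rw [map_sub, Fintype.linearCombination_apply, map_sum]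
      simp only [map_smul, π, ha]
      have := congrArg (Submodule.subtype P) (bP.sum_repr px)
      rw [map_sum] at this
      simp only [map_smul, Submodule.subtype_apply] at this
      rw [this, sub_self]
    obtain ⟨m, hm⟩ := (Submodule.Quotient.mk_eq_zero _).1 h1
    exact ⟨_, m, by rw [← hfl, hm]; abel⟩
  choose c m hcm using hrep
  have hind : ∀ c : Fin (Module.finrank F P) → F, c ≠ 0 → ∀ m : M,
      (d.comb c).realize a ≠ f m := by
    intro c hc m hm
    rw [d.realize_comb_eq] at hm
    apply hc
    have h1 : π (Fintype.linearCombination F a c) = 0 := by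
      rw [hm]
      exact (Submodule.Quotient.mk_eq_zero _).2 ⟨m, rfl⟩
    rw [Fintype.linearCombination_apply, map_sum] at h1
    simp only [map_smul, π, ha] at h1
    have h2 : ∑ j, c j • bP j = 0 := by
      apply Subtype.ext
      rw [← Submodule.subtype_apply, map_sum]
      simpa using h1
    exact funext (Fintype.linearIndependent_iff.1 bP.linearIndependent c h2)
  let eB := B'.equivFin
  let y : Fin B'.card → M := fun i => m (eB.symm i)
  -- Coordinates of an element of `B'` with respect to `a` and the list `y` of elements of M; each
  -- element has its own entry of `y` as its M-component.
  let κ : B' → (Fin (Module.finrank F P) ⊕ Fin B'.card → F) :=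
    fun x => Sum.elim (c x) (Pi.single (eB x) 1)
  have hsplit {K : Type w} [AddCommGroup K] [Module F K] (a : Fin (Module.finrank F P) → K)
      (y : Fin B'.card → K) (x : B') : Fintype.linearCombination F (Sum.elim a y) (κ x) =
        Fintype.linearCombination F a (c x) + y (eB x) := by
    simp [Fintype.linearCombination_apply, κ, Pi.single_apply]
  have hκ (x : B') : (d.comb (κ x)).realize (Sum.elim a (f ∘ y)) = (x : N) := by
    rw [d.realize_comb_eq, hsplit, hcm x]
    simp [y]
  -- All linear relations with the predicates that hold for the tuple in N.
  let S : Fin n → Submodule F (Fin (Module.finrank F P) ⊕ Fin B'.card → F) :=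
    fun i => (V' i).comap (Fintype.linearCombination F (Sum.elim a (f ∘ y)))
  -- Outside `B'` the substituted term is arbitrary, since `B'` contains the free variables of χ.
  let ψ : L.Formula (Fin (Module.finrank F P) ⊕ Fin B'.card) := BoundedFormula.subst χ
    fun x => if h : x ∈ B' then d.comb (κ ⟨x, h⟩) else d.comb 0
  have hψ : ψ.Realize (Sum.elim a (f ∘ y)) := by
    refine BoundedFormula.realize_subst.2 ((realize_congr_freeVar χ fun x hx => ?_).2 hχ)
    have hxB : x ∈ B' := Finset.mem_union_right _ hx
    rw [dif_pos hxB, hκ]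
    rfl
  obtain ⟨a', ha', htr⟩ := hV _ _ ψ S y ⟨N, inferInstance, f, a, hψ, hind⟩ (by
    intro i c
    have h1 : Fintype.linearCombination F (Sum.elim a (f ∘ y)) (Sum.elim 0 c) =
        f ((d.comb c).realize y) := by
      rw [d.realize_comb_eq, ← hfl]
      simp only [Fintype.linearCombination_apply, Fintype.sum_sum_type, map_sum, map_smul]
      simp [hfl]
    change _ ↔ Fintype.linearCombination F (Sum.elim a (f ∘ y)) (Sum.elim 0 c) ∈ V' i
    rw [h1, hf])
  -- The map inverts f on its range and uses the copied coordinates on the rest of `B'`; the value 0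
  -- elsewhere never matters. `heB` checks agreement on the overlap: for an element of f(M) the
  -- coordinates along `a` vanish by independence.
  let e : N → M := fun x => if h : ∃ m, f m = x then h.choose else
    if h : x ∈ B' then (d.comb (κ ⟨x, h⟩)).realize (Sum.elim a' y) else 0
  have hef : ∀ x, e (f x) = x := by
    intro x
    have h : ∃ m, f m = f x := ⟨x, rfl⟩
    simp only [e]
    rw [dif_pos h]
    exact f.injective h.choose_spec
  have heB : ∀ x (h : x ∈ B'), e x = (d.comb (κ ⟨x, h⟩)).realize (Sum.elim a' y) := by
    intro x h
    by_cases hx : ∃ m, f m = x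
    · obtain ⟨m₀, rfl⟩ := hx
      rw [hef, d.realize_comb_eq, hsplit]
      have h1 := hcm ⟨f m₀, h⟩
      have h0 : c ⟨f m₀, h⟩ = 0 := by
        by_contra hne
        refine hind _ hne (m₀ - m ⟨f m₀, h⟩) ?_
        have h2 : fl (m₀ - m ⟨f m₀, h⟩) = fl m₀ - fl (m ⟨f m₀, h⟩) := map_sub _ _ _
        rw [d.realize_comb_eq]
        exact (eq_sub_of_add_eq h1.symm).trans h2.symm
      rw [h0, map_zero, zero_add] at h1 ⊢
      simp only [y, Equiv.symm_apply_apply]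
      exact f.injective h1
    · simp only [e]
      rw [dif_neg hx, dif_pos h]
  refine ⟨e, hef, ?_, fun x hx i => ?_⟩
  · refine (realize_congr_freeVar χ fun x hx => ?_).1 (BoundedFormula.realize_subst.1 ha')
    have hxB : x ∈ B' := Finset.mem_union_right _ hx
    rw [dif_pos hxB, heB x hxB]
  · have hxB : x ∈ B' := Finset.mem_union_left _ hx
    rw [heB x hxB]
    refine (htr i _).trans ?_
    change Fintype.linearCombination F (Sum.elim a (f ∘ y)) (κ ⟨x, hxB⟩) ∈ V' i ↔ _
    rw [← d.realize_comb_eq, hκ]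

end ModelComplete

/-! ### The model companion -/

section Companion

variable {F : Type} [Field F] {L : FirstOrder.Language.{u, v}} {n : ℕ} {d : LinData F L}
  {L₀ : FirstOrder.Language.{u₀, v₀}} {ι : L₀ →ᴸ L} {T : L.Theory}

/-- An extension of a generic structure embeds, over it, in an elementary extension. -/
theorem IsGeneric.exists_elementary (hmc : IsModelComplete.{u, v, max u v} T)
    (hd : IsLinearTheory.{u, v, max u v} d T)
    (hι : ClosedIffSubspace.{u, v, u₀, v₀, max u v} d ι T) {M N : Type (max u v)}
    [L.Structure M] [Nonempty M] [L.Structure N] [Nonempty N] {V : Fin n → Set M}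
    {V' : Fin n → Set N} (hM : WithPred V ⊨ substructureTheory ι T n)
    (hN : WithPred V' ⊨ substructureTheory ι T n) (hV : IsGeneric d V)
    (f : WithPred V ↪[L.sum (predLang n)] WithPred V') :
    ∃ (Z : Type (max u v)) (_ : (L.sum (predLang n)).Structure Z)
      (g : WithPred V' ↪[L.sum (predLang n)] Z) (e : WithPred V ↪ₑ[L.sum (predLang n)] Z),
      ⇑g ∘ ⇑f = ⇑e := by
  classical
  have hMT : M ⊨ T := ((WithPred.model_substructureTheory ι T).1 hM).1
  have hNT : N ⊨ T := ((WithPred.model_substructureTheory ι T).1 hN).1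
  obtain ⟨_, _, _⟩ := hd M
  obtain ⟨_, _, _⟩ := hd N
  obtain ⟨W, rfl⟩ := (model_substructureTheory_iff hι V').1 hN
  -- Model completeness of T makes the embedding elementary for L, which is what allows N to witness
  -- independent realisability over M.
  let f₀ : M ↪ₑ[L] N := hmc.elementary (WithPred.baseEmbedding f)
  let L' := L.sum (predLang n)
  let Γ₁ : Set (L'.Formula N) := LHom.sumInl.onFormula '' elementaryDiagramFormulas L N
  let lit : Fin n × N → L'.Formula N := fun p =>
    if p.2 ∈ W p.1 then (predSym L p.1).formula₁ (.var p.2)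
    else ((predSym L p.1).formula₁ (.var p.2)).not
  let Γ₃ : Set (L'.Formula N) := (fun γ : L'.Formula (WithPred V) => γ.relabel f) ''
    elementaryDiagramFormulas L' (WithPred V)
  -- A model of these formulas is an elementary extension of (M, V) that contains (N, V') over M.
  -- Each finite part is realised in (M, V) itself by specialising the finitely many elements of N
  -- involved.
  obtain ⟨Z, S, hne, -, e, he⟩ := exists_realize_of_finite (T := (∅ : L'.Theory))
    (Γ₁ ∪ lit '' Set.univ ∪ Γ₃) (by
      intro Γ₀ hΓ₀
      obtain ⟨I, hI, hI'⟩ := Finset.subset_set_image_iff.1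
        (show ↑(Γ₀.filter (· ∈ Γ₁)) ⊆ Γ₁ from fun γ hγ => (Finset.mem_filter.1 hγ).2)
      obtain ⟨J, hJ, hJ'⟩ := Finset.subset_set_image_iff.1
        (show ↑(Γ₀.filter (· ∈ lit '' Set.univ)) ⊆ lit '' Set.univ
          from fun γ hγ => (Finset.mem_filter.1 hγ).2)
      obtain ⟨e, hef, heχ, heV⟩ := hV.exists_specialization W f₀
        (fun i x => WithPred.baseEmbedding_mem f i x) (Formula.iInf fun γ : I => (γ : L.Formula N))
        (Formula.realize_iInf.2 fun γ => realize_of_mem_elementaryDiagramFormulas (hI γ.2))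
        (J.image Prod.snd)
      refine ⟨WithPred V, inferInstance, inferInstance, inferInstance, e, fun γ hγ => ?_⟩
      rcases hΓ₀ hγ with (hγ' | hγ') | ⟨γ', hγ', rfl⟩
      · have : γ ∈ I.image LHom.sumInl.onFormula := by
          rw [hI']
          exact Finset.mem_filter.2 ⟨hγ, hγ'⟩
        obtain ⟨γ', hγ'', rfl⟩ := Finset.mem_image.1 this
        exact (WithPred.realize_onFormula _ _).2 (Formula.realize_iInf.1 heχ ⟨γ', hγ''⟩)
      · have : γ ∈ J.image lit := by
          rw [hJ']
          exact Finset.mem_filter.2 ⟨hγ, hγ'⟩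
        obtain ⟨p, hp, rfl⟩ := Finset.mem_image.1 this
        have hpV := heV p.2 (Finset.mem_image_of_mem _ hp) p.1
        simp only [lit]
        split_ifs with h
        · exact Formula.realize_rel₁.2 (hpV.2 h)
        · exact Formula.realize_not.2 fun h' => h (hpV.1 (Formula.realize_rel₁.1 h'))
      · refine Formula.realize_relabel.2 ?_
        exact (congrArg (fun z : WithPred V → WithPred V => γ'.Realize z)
          (funext hef : (fun x => e (f x)) = id)).mpr
            (realize_of_mem_elementaryDiagramFormulas hγ'))
  revert e hne
  refine WithPred.forall_structure (L := L) (n := n) (p := fun Z _ => Nonempty Z →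
    ∀ e : N → Z, (∀ γ ∈ Γ₁ ∪ lit '' Set.univ ∪ Γ₃, γ.Realize e) → _) ?_ Z
  intro Z _ VZ _ e he
  let g : N ↪ₑ[L] Z := elementaryOfDiagram e fun γ hγ =>
    (WithPred.realize_onFormula γ e).1 (he _ (Or.inl (Or.inl ⟨γ, hγ, rfl⟩)))
  refine ⟨WithPred VZ, inferInstance, WithPred.embedding g.toEmbedding fun i x => ?_,
    elementaryOfDiagram (e ∘ f) fun γ hγ =>
      Formula.realize_relabel.1 (he _ (Or.inr ⟨γ, hγ, rfl⟩)), rfl⟩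
  have := he _ (Or.inl (Or.inr ⟨(i, x), trivial, rfl⟩))
  simp only [lit] at this
  split_ifs at this with h
  · exact iff_of_true (Formula.realize_rel₁.1 this) h
  · exact iff_of_false (fun h' => Formula.realize_not.1 this (Formula.realize_rel₁.2 h')) h

theorem isModelComplete_genericTheory [Finite F] (hmc : IsModelComplete.{u, v, max u v} T)
    (hd : IsLinearTheory.{u, v, max u v} d T)
    (hT : EliminatesExistsInfinity.{u, v, max u v} T)
    (hι : ClosedIffSubspace.{u, v, u₀, v₀, max u v} d ι T) :
    IsModelComplete.{u, v, max u v} (genericTheory d ι T n) := by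
  refine isModelComplete_of_complete_to_elementary fun M N _ _ _ _ _ _ f => ?_
  suffices H : ∀ (M : Type (max u v)) [(L.sum (predLang n)).Structure M] (N : Type (max u v))
      [(L.sum (predLang n)).Structure N] [Nonempty M] [Nonempty N] [M ⊨ genericTheory d ι T n]
      [N ⊨ genericTheory d ι T n] (f : M ↪[L.sum (predLang n)] N), ∃ (Z : Type (max u v))
      (_ : (L.sum (predLang n)).Structure Z) (g : N ↪[L.sum (predLang n)] Z)
      (e : M ↪ₑ[L.sum (predLang n)] Z), ⇑g ∘ ⇑f = ⇑e from H M N f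
  clear! M N
  intro M
  refine WithPred.forall_structure (L := L) (n := n) (p := fun M _ => ∀ (N : Type (max u v))
    [(L.sum (predLang n)).Structure N] [Nonempty M] [Nonempty N] [M ⊨ genericTheory d ι T n]
    [N ⊨ genericTheory d ι T n] (f : M ↪[L.sum (predLang n)] N), ∃ (Z : Type (max u v))
    (_ : (L.sum (predLang n)).Structure Z) (g : N ↪[L.sum (predLang n)] Z)
    (e : M ↪ₑ[L.sum (predLang n)] Z), ⇑g ∘ ⇑f = ⇑e) ?_ M
  intro M _ V N
  refine WithPred.forall_structure (L := L) (n := n) (p := fun N _ => ∀ [Nonempty (WithPred V)]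
    [Nonempty N] [WithPred V ⊨ genericTheory d ι T n] [N ⊨ genericTheory d ι T n]
    (f : WithPred V ↪[L.sum (predLang n)] N), ∃ (Z : Type (max u v))
    (_ : (L.sum (predLang n)).Structure Z) (g : N ↪[L.sum (predLang n)] Z)
    (e : WithPred V ↪ₑ[L.sum (predLang n)] Z), ⇑g ∘ ⇑f = ⇑e) ?_ N
  intro N _ V' hMne hNne hM hN f
  have : Nonempty M := hMne
  have : Nonempty N := hNne
  obtain ⟨h1, h2⟩ := (model_genericTheory d ι hd hT V).1 hM
  obtain ⟨h3, h4⟩ := (model_genericTheory d ι hd hT V').1 hN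
  exact h2.exists_elementary hmc hd hι h1 h3 f

/-- Generic predicates are infinite. -/
theorem IsGeneric.infinite (hd : IsLinearTheory.{u, v, max u v} d T) {M : Type (max u v)}
    [L.Structure M] [Nonempty M] [M ⊨ T] [AddCommGroup M] [Module F M] [LinCompat d M] [Infinite M]
    (V : Fin n → Submodule F M) (hV : IsGeneric d fun i => (V i : Set M)) (i : Fin n) :
    (V i : Set M).Infinite := by
  intro hfin
  have : Finite (V i) := hfin
  let b : Fin (Nat.card (V i)) → M := fun j => ((Finite.equivFin (V i)).symm j : V i)
  have hb : ∀ x ∈ V i, ∃ j, b j = x := fun x hx => ⟨Finite.equivFin (V i) ⟨x, hx⟩, by simp [b]⟩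
  -- If V i were finite, avoiding its listed elements would be expressible. The relations below
  -- treat the generic element as if it were 0, hence force it into V i: a contradiction.
  let φ : L.Formula (Fin 1 ⊕ Fin (Nat.card (V i))) :=
    Formula.iInf fun j => (Term.equal (.var (Sum.inl 0)) (.var (Sum.inr j))).not
  have hφ (x : Fin 1 → M) : φ.Realize (Sum.elim x b) ↔ x 0 ∉ V i := by
    simp only [φ, Formula.realize_iInf, Formula.realize_not, Formula.realize_equal, Term.realize_var,
      Sum.elim_inl, Sum.elim_inr]
    constructor
    · intro h hx
      obtain ⟨j, hj⟩ := hb _ hx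
      exact h j hj.symm
    · rintro h j hj
      exact h (hj ▸ ((Finite.equivFin (V i)).symm j : V i).2)
  let S : Fin n → Submodule F (Fin 1 ⊕ Fin (Nat.card (V i)) → F) := fun i' =>
    (V i').comap (Fintype.linearCombination F (Sum.elim (fun _ => 0) b))
  obtain ⟨x, hx, htr⟩ := hV 1 _ φ S b (by
    rw [indepRealizable_iff hd]
    rintro ⟨H, hH, hH1, hcov⟩
    -- In one variable a proper affine set is at most a point, so a finite cover would make the
    -- complement of V i, and then M, finite.
    have hsub : ∀ h ∈ H, {x : Fin 1 → M | x ∈ affineSet (fun x c => (d.comb c).realize x)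
        h.1 h.2}.Subsingleton := by
      intro h hh x hx y hy
      have h0 : h.1 ≠ ⊥ := by
        intro h0
        have := hH1 h hh
        rw [h0, finrank_bot] at this
        omega
      obtain ⟨c, hc, hc0⟩ := Submodule.exists_mem_ne_zero_of_ne_bot h0
      have h1 := (hx ⟨c, hc⟩).trans (hy ⟨c, hc⟩).symm
      simp only [d.realize_comb, Finset.univ_unique, Fin.default_eq_zero, Fin.isValue,
        Finset.sum_singleton] at h1
      have hc0' : c 0 ≠ 0 := fun h => hc0 (funext fun j => by rw [Subsingleton.elim j 0, h]; rfl)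
      ext j
      rw [Subsingleton.elim j 0]
      exact smul_right_injective M hc0' h1
    have hfin' : {x : Fin 1 → M | x 0 ∉ V i}.Finite := by
      refine (hH.biUnion fun h hh => (hsub h hh).finite).subset fun x hx => ?_
      obtain ⟨h, hh, hxh⟩ := hcov x ((hφ x).2 hx)
      exact Set.mem_biUnion hh hxh
    have : (Set.univ : Set M).Finite := by
      refine (hfin.union (hfin'.image fun x => x 0)).subset fun x _ => ?_
      by_cases hx : x ∈ V i
      · exact Or.inl hx
      · exact Or.inr ⟨fun _ => x, hx, rfl⟩
    exact Set.infinite_univ this) (by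
    intro i' c
    rw [d.realize_comb_eq]
    change _ ↔ Fintype.linearCombination F (Sum.elim (fun _ => 0) b) (Sum.elim (0 : Fin 1 → F) c) ∈ V i'
    simp [Fintype.linearCombination_apply])
  refine (hφ x).1 hx ?_
  have := (htr i (Sum.elim 1 0)).2 (by
    change Fintype.linearCombination F (Sum.elim (fun _ => 0) b) (Sum.elim 1 0) ∈ V i
    simp [Fintype.linearCombination_apply])
  simpa [d.realize_comb] using this

/-- The theory of generic predicates is the model companion of the theory of predicates for
subspaces, and of the theory of predicates for infinite subspaces. -/
theorem genericTheory_isModelCompanion [Finite F] (hmc : IsModelComplete.{u, v, max u v} T)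
    (hd : IsLinearTheory.{u, v, max u v} d T)
    (hT : EliminatesExistsInfinity.{u, v, max u v} T)
    (hι : ClosedIffSubspace.{u, v, u₀, v₀, max u v} d ι T)
    (hinf : ∀ (M : Type (max u v)) [L.Structure M] [Nonempty M] [M ⊨ T], Infinite M) (n : ℕ) :
    IsModelCompanion.{u, v, max u v} (genericTheory d ι T n) (infiniteSubstructureTheory ι T n) ∧
      IsModelCompanion.{u, v, max u v} (genericTheory d ι T n) (substructureTheory ι T n) := by
  have h1 : EmbedsIn.{u, v, max u v} (substructureTheory ι T n) (genericTheory d ι T n) := by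
    intro M
    refine WithPred.forall_structure (L := L) (n := n) (p := fun M _ => ∀ [Nonempty M]
      [M ⊨ substructureTheory ι T n], ∃ (N : Type (max u v))
      (_ : (L.sum (predLang n)).Structure N) (_ : Nonempty N), N ⊨ genericTheory d ι T n ∧
        Nonempty (M ↪[L.sum (predLang n)] N)) ?_ M
    intro M _ V hne hM
    have : Nonempty M := hne
    obtain ⟨N, _, f, V', h1, h2, h3⟩ := exists_generic_extension hd hT hι V hM
    have : Nonempty N := Nonempty.map f inferInstance
    exact ⟨WithPred V', inferInstance, inferInstance, (model_genericTheory d ι hd hT V').2 ⟨h1, h3⟩,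
      ⟨WithPred.embedding f.toEmbedding h2⟩⟩
  -- Generic models already have infinite predicates, so one theory is the companion with and
  -- without the infinity axioms.
  have h2 : ∀ (M : Type (max u v)) [(L.sum (predLang n)).Structure M], Nonempty M →
      M ⊨ genericTheory d ι T n → M ⊨ infiniteSubstructureTheory ι T n := by
    intro M
    refine WithPred.forall_structure (L := L) (n := n) (p := fun M _ => Nonempty M →
      M ⊨ genericTheory d ι T n → M ⊨ infiniteSubstructureTheory ι T n) ?_ M
    intro M _ V hne hM
    have : Nonempty M := hne
    obtain ⟨h1, h2⟩ := (model_genericTheory d ι hd hT V).1 hM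
    have : M ⊨ T := ((WithPred.model_substructureTheory ι T).1 h1).1
    obtain ⟨_, _, _⟩ := hd M
    obtain ⟨W, rfl⟩ := (model_substructureTheory_iff hι V).1 h1
    have := hinf M
    exact (WithPred.model_infiniteSubstructureTheory ι T).2 ⟨h1, h2.infinite hd W⟩
  have hmc' := isModelComplete_genericTheory (n := n) hmc hd hT hι
  refine ⟨⟨hmc', ?_, ?_⟩, ⟨hmc', h1, ?_⟩⟩
  · intro M _ _ hM
    have : M ⊨ substructureTheory ι T n := hM.mono Set.subset_union_left
    exact h1 M
  · intro M _ _ hM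
    exact ⟨M, inferInstance, inferInstance, h2 M inferInstance hM, ⟨Embedding.refl _ M⟩⟩
  · intro M _ _ hM
    exact ⟨M, inferInstance, inferInstance, hM.mono Set.subset_union_left, ⟨Embedding.refl _ M⟩⟩

end Companion

/-! ### The theory of infinite vector spaces -/

section VectorSpaceTheory

variable {F : Type}

/-- The operations named by the symbols of the language of vector spaces. -/
def vecData (F : Type) : LinData F (vecLang F) where
  zero := VecFunc.zero
  add := VecFunc.add
  smul a := Functions.apply₁ (VecFunc.smul a : (vecLang F).Functions 1) (.var ())

section Ops

variable (M : Type w) [(vecLang F).Structure M]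

def opZero : M := Structure.funMap (L := vecLang F) (VecFunc.zero : (vecLang F).Functions 0) ![]

variable (F) in
def opAdd (x y : M) : M :=
  Structure.funMap (L := vecLang F) (VecFunc.add : (vecLang F).Functions 2) ![x, y]

def opSmul (a : F) (x : M) : M :=
  Structure.funMap (L := vecLang F) (VecFunc.smul a : (vecLang F).Functions 1) ![x]

theorem realize_tZero {k : ℕ} (x : Empty ⊕ Fin k → M) :
    (tZero : (vecLang F).Term (Empty ⊕ Fin k)).realize x = opZero (F := F) M := by
  rw [tZero, Constants.term, Term.realize_func, opZero]
  congr 1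
  exact Subsingleton.elim _ _

theorem realize_tAdd {k : ℕ} (s t : (vecLang F).Term (Empty ⊕ Fin k)) (x : Empty ⊕ Fin k → M) :
    (tAdd s t).realize x = opAdd F M (s.realize x) (t.realize x) :=
  Term.realize_functions_apply₂

theorem realize_tSmul {k : ℕ} (a : F) (t : (vecLang F).Term (Empty ⊕ Fin k))
    (x : Empty ⊕ Fin k → M) : (tSmul a t).realize x = opSmul M a (t.realize x) :=
  Term.realize_functions_apply₁

variable [Field F]

/-- The vector space axioms, for the operations of an arbitrary structure. -/
structure OpsAreVectorSpace : Prop where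
  add_assoc : ∀ x y z, opAdd F M (opAdd F M x y) z = opAdd F M x (opAdd F M y z)
  add_comm : ∀ x y, opAdd F M x y = opAdd F M y x
  zero_add : ∀ x, opAdd F M (opZero (F := F) M) x = x
  neg_add : ∀ x, opAdd F M (opSmul M (-1 : F) x) x = opZero (F := F) M
  one_smul : ∀ x, opSmul M (1 : F) x = x
  mul_smul : ∀ (a b : F) x, opSmul M (a * b) x = opSmul M a (opSmul M b x)
  add_smul : ∀ (a b : F) x, opSmul M (a + b) x = opAdd F M (opSmul M a x) (opSmul M b x)
  smul_add : ∀ (a : F) x y, opSmul M a (opAdd F M x y) = opAdd F M (opSmul M a x) (opSmul M a y)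

theorem model_vecAxiom_iff : M ⊨ {σ : (vecLang F).Sentence | VecAxiom σ} ↔
    OpsAreVectorSpace (F := F) M := by
  have h0 : ∀ x : M, (Fin.snoc default x : Fin 1 → M) 0 = x := fun x => rfl
  have h20 : ∀ x y : M, (Fin.snoc (Fin.snoc default x : Fin 1 → M) y : Fin 2 → M) 0 = x :=
    fun x y => rfl
  have h21 : ∀ x y : M, (Fin.snoc (Fin.snoc default x : Fin 1 → M) y : Fin 2 → M) 1 = y :=
    fun x y => rfl
  have h30 : ∀ x y z : M, (Fin.snoc (Fin.snoc (Fin.snoc default x : Fin 1 → M) y : Fin 2 → M) z :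
    Fin 3 → M) 0 = x := fun x y z => rfl
  have h31 : ∀ x y z : M, (Fin.snoc (Fin.snoc (Fin.snoc default x : Fin 1 → M) y : Fin 2 → M) z :
    Fin 3 → M) 1 = y := fun x y z => rfl
  have h32 : ∀ x y z : M, (Fin.snoc (Fin.snoc (Fin.snoc default x : Fin 1 → M) y : Fin 2 → M) z :
    Fin 3 → M) 2 = z := fun x y z => rfl
  constructor
  · intro h
    have H := fun {σ} (hσ : VecAxiom σ) => h.realize_of_mem σ hσ
    have a1 := H VecAxiom.add_assoc
    have a2 := H VecAxiom.add_comm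
    have a3 := H VecAxiom.zero_add
    have a4 := H VecAxiom.neg_add
    have a5 := H VecAxiom.one_smul
    have a6 := fun a b => H (VecAxiom.mul_smul a b)
    have a7 := fun a b => H (VecAxiom.add_smul a b)
    have a8 := fun a => H (VecAxiom.smul_add a)
    simp only [Sentence.Realize, Formula.Realize, BoundedFormula.realize_all,
      BoundedFormula.realize_bdEqual, realize_tAdd, realize_tSmul, realize_tZero, Term.realize_var,
      Sum.elim_inr, Function.comp_apply, h0, h20, h21, h30, h31, h32] at a1 a2 a3 a4 a5 a6 a7 a8
    exact ⟨a1, a2, a3, a4, a5, a6, a7, a8⟩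
  · rintro ⟨a1, a2, a3, a4, a5, a6, a7, a8⟩
    refine ⟨?_⟩
    rintro σ (_ | _)
    all_goals
      simp only [Sentence.Realize, Formula.Realize, BoundedFormula.realize_all,
        BoundedFormula.realize_bdEqual, realize_tAdd, realize_tSmul, realize_tZero,
        Term.realize_var, Sum.elim_inr, Function.comp_apply, h0, h20, h21, h30, h31, h32]
    exacts [a1, a2, a3, a4, a5, a6 _ _, a7 _ _, a8 _]

end Ops

variable [Field F]

theorem opZero_eq (M : Type w) [(vecLang F).Structure M] [AddCommGroup M] [Module F M]
    [LinCompat (vecData F) M] : opZero (F := F) M = 0 := LinCompat.zero (d := vecData F) _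

theorem opAdd_eq {M : Type w} [(vecLang F).Structure M] [AddCommGroup M] [Module F M]
    [LinCompat (vecData F) M] (x y : M) : opAdd F M x y = x + y :=
  LinCompat.add (d := vecData F) ![x, y]

theorem opSmul_eq {M : Type w} [(vecLang F).Structure M] [AddCommGroup M] [Module F M]
    [LinCompat (vecData F) M] (a : F) (x : M) : opSmul M a x = a • x := by
  exact Term.realize_functions_apply₁.symm.trans
    (LinCompat.smul (d := vecData F) a fun _ : Unit => x)

theorem OpsAreVectorSpace.exists_compat {M : Type w} [(vecLang F).Structure M]
    (h : OpsAreVectorSpace (F := F) M) :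
    ∃ (_ : AddCommGroup M) (_ : Module F M), LinCompat (vecData F) M := by
  let _ : Zero M := ⟨opZero (F := F) M⟩
  let _ : Add M := ⟨opAdd F M⟩
  let _ : Neg M := ⟨opSmul M (-1 : F)⟩
  have hz : ∀ a : M, a + 0 = a := fun a => (h.add_comm a _).trans (h.zero_add a)
  let G : AddCommGroup M :=
    { add_assoc := h.add_assoc
      zero_add := h.zero_add
      add_zero := hz
      add_comm := h.add_comm
      neg_add_cancel := h.neg_add
      nsmul := nsmulRec
      zsmul := zsmulRec }
  have hs0 : ∀ x : M, opSmul M (0 : F) x = 0 := fun x => by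
    have := h.add_smul (0 : F) 0 x
    rw [add_zero] at this
    exact left_eq_add.1 this
  have hs0' : ∀ a : F, opSmul M a (0 : M) = 0 := fun a => by
    have := h.smul_add a (0 : M) 0
    rw [show opAdd F M (0 : M) 0 = (0 : M) + 0 from rfl, add_zero] at this
    exact left_eq_add.1 this
  let mod : Module F M :=
    { smul := opSmul M
      one_smul := h.one_smul
      mul_smul := h.mul_smul
      smul_zero := hs0'
      smul_add := h.smul_add
      add_smul := h.add_smul
      zero_smul := hs0 }
  refine ⟨G, mod, ⟨fun x => ?_, fun x => ?_, fun a x => ?_⟩⟩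
  · rw [Subsingleton.elim x (![])]
    rfl
  · have : x = ![x 0, x 1] := by ext i; fin_cases i <;> rfl
    rw [this]
    rfl
  · exact Term.realize_functions_apply₁

theorem model_infVecTheory_iff (M : Type w) [(vecLang F).Structure M] :
    M ⊨ infVecTheory F ↔ OpsAreVectorSpace (F := F) M ∧ Infinite M := by
  rw [infVecTheory, Theory.model_union_iff, model_vecAxiom_iff, model_infiniteTheory_iff]

theorem isLinearTheory_infVecTheory : IsLinearTheory.{0, 0, w} (vecData F) (infVecTheory F) :=
  fun M _ _ h => ((model_infVecTheory_iff M).1 h).1.exists_compat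

end VectorSpaceTheory

/-! ### Algebraic closure in vector spaces -/

section Span

variable {F : Type} [Field F] {M : Type w} [AddCommGroup M] [Module F M]

theorem isPregeometry_span : IsPregeometry fun A : Set M => (Submodule.span F A : Set M) where
  subset_cl _ := Submodule.subset_span
  mono _ _ h := Submodule.span_mono h
  cl_cl A := by rw [Submodule.span_span]
  finitary A x hx := by
    obtain ⟨B, hB, h⟩ := Submodule.mem_span_finite_of_mem_span hx
    exact ⟨B, hB, B.finite_toSet, h⟩
  exchange A a b h h' := by
    rw [Set.union_singleton] at h ⊢
    exact mem_span_insert_exchange h h'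

/-- If x = b + y with b in B and y in the span of the remaining elements of X ⊆ A, then b = x - y
lies in A ∩ B, so the dependence already holds over A ∩ B. -/
theorem isModular_span : IsModular fun A : Set M => (Submodule.span F A : Set M) := by
  intro A B hA hB X hX hI x hx h
  refine hI x hx ?_
  rw [Set.union_eq_self_of_subset_left Set.inter_subset_right, SetLike.mem_coe,
    Submodule.span_union] at h
  obtain ⟨b, hb, y, hy, rfl⟩ := Submodule.mem_sup.1 h
  have hyA : y ∈ A := by
    rw [← hA]
    exact Submodule.span_mono (Set.sdiff_subset.trans hX) hy
  have hbA : b ∈ A := by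
    have : b + y - y ∈ Submodule.span F A :=
      sub_mem (Submodule.subset_span (hX hx)) (Submodule.subset_span hyA)
    rw [add_sub_cancel_right] at this
    exact hA ▸ this
  exact add_mem (Submodule.subset_span (Or.inl ⟨hbA, hB ▸ hb⟩))
    (Submodule.span_mono Set.subset_union_right hy)

/-- Independence over W is linear independence in the quotient by W. -/
theorem isIndepTupleOver_span_iff (W : Submodule F M) {n : ℕ} (a : Fin n → M) :
    IsIndepTupleOver (fun A : Set M => (Submodule.span F A : Set M)) W a ↔
      ∀ c : Fin n → F, c ≠ 0 → ∑ i, c i • a i ∉ W := by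
  have h : ∀ i, a i ∈ Submodule.span F ((W : Set M) ∪ a '' {j | j ≠ i}) ↔
      (W.mkQ ∘ a) i ∈ Submodule.span F ((W.mkQ ∘ a) '' (Set.univ \ {i})) := fun i => by
    rw [Submodule.span_union, Submodule.span_eq, ← Submodule.comap_map_mkQ, Submodule.mem_comap,
      Submodule.map_span, ← Set.image_comp]
    congr! 3
    ext j
    simp
  have h' := linearIndependent_iff_notMem_span (K := F) (v := W.mkQ ∘ a)
  refine (forall_congr' fun i => not_congr (h i)).trans (h'.symm.trans ?_)
  rw [Fintype.linearIndependent_iff]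
  refine forall_congr' fun c => ?_
  rw [← Submodule.Quotient.mk_eq_zero, ← Submodule.mkQ_apply, map_sum]
  simp only [map_smul, Function.comp_apply]
  rw [not_imp_not, funext_iff]
  rfl

theorem exists_linear_functional_eq {W : Submodule F M} {x : M} (hx : x ∉ W) :
    ∃ f : M →ₗ[F] F, f x = 1 ∧ W ≤ LinearMap.ker f := by
  obtain ⟨f, hf, hW⟩ := Submodule.exists_le_ker_of_notMem hx
  refine ⟨(f x)⁻¹ • f, inv_mul_cancel₀ hf, fun w hw => ?_⟩
  have h : f w = 0 := hW hw
  simp [h]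

/-- The kernel has finite codimension; were it finite, M would be finite-dimensional over a finite
field, hence finite. -/
theorem infinite_ker [Finite F] [Infinite M] (f : M →ₗ[F] F) : Infinite (LinearMap.ker f) := by
  by_contra h
  rw [not_infinite_iff_finite] at h
  have h1 : Module.Finite F (M ⧸ LinearMap.ker f) :=
    Module.Finite.equiv f.quotKerEquivRange.symm
  have h2 := Module.Finite.of_submodule_quotient (LinearMap.ker f)
  have := Module.finite_of_finite F (M := M)
  exact not_finite M

variable [(vecLang F).Structure M] [LinCompat (vecData F) M]

theorem funMap_smul (a : F) (x : Fin 1 → M) : Structure.funMap (L := vecLang F)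
    (VecFunc.smul a : (vecLang F).Functions 1) x = a • x 0 := by
  rw [← opSmul_eq, opSmul]
  congr 1
  ext i
  fin_cases i
  rfl

/-- A linear automorphism is an automorphism of structures. -/
def equivOfLinearEquiv (g : M ≃ₗ[F] M) : M ≃[vecLang F] M where
  toEquiv := g.toEquiv
  map_fun' {n} f x := by
    cases f with
    | zero =>
      refine (congr_arg g (LinCompat.zero (d := vecData F) x)).trans ?_
      exact (map_zero g).trans (LinCompat.zero (d := vecData F) _).symm
    | add =>
      refine (congr_arg g (LinCompat.add (d := vecData F) x)).trans ?_
      exact (map_add g _ _).trans (LinCompat.add (d := vecData F) (g ∘ x)).symm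
    | smul α =>
      exact (congr_arg g (funMap_smul α x)).trans
        ((map_smul g α _).trans (funMap_smul α (g ∘ x)).symm)
  map_rel' r := r.elim

/-- For x outside the span of A, take a functional f with f(x) = 1 that kills A. The transvections
along vectors y of the infinite kernel of f fix A pointwise and move x to x + y, so x lies in no
finite A-definable set. Conversely, elements of the span are values of terms. -/
theorem acl_vecLang [Finite F] [Infinite M] (A : Set M) :
    acl (vecLang F) A = (Submodule.span F A : Set M) := by
  ext x
  constructor
  · rintro ⟨S, hS, hSf, hx⟩
    obtain ⟨A₀, hA₀, hS⟩ := Set.definable_iff_finitely_definable.1 hS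
    obtain ⟨φ, hφ⟩ := Set.definable_iff_exists_formula_sum.1 hS
    refine Submodule.span_mono hA₀ ?_
    by_contra hxA
    obtain ⟨f, hf, hA⟩ := exists_linear_functional_eq hxA
    have mem (y : M) : y ∈ S ↔ φ.Realize (Sum.elim (fun a : (A₀ : Set M) => (a : M)) fun _ => y) := by
      rw [← Set.mem_ofPred (p := fun v : Fin 1 → M => φ.Realize (Sum.elim (↑) v))
        (a := fun _ => y), ← hφ]
      rfl
    refine (Set.infinite_coe_iff.1 (infinite_ker f)).mono ?_ (hSf.preimage (add_right_injective x).injOn)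
    intro y hy
    refine (mem _).2 ?_
    have key := (StrongHomClass.realize_formula
      (equivOfLinearEquiv (LinearEquiv.transvection (f := f) (v := y) hy)) φ).2 ((mem x).1 hx)
    convert key using 1
    ext (a | i)
    · have : f a = 0 := hA (Submodule.subset_span a.2)
      change (a : M) = a + f a • y
      simp [this]
    · change x + y = x + f x • y
      simp [hf]
  · intro hx
    have : ∃ t : (vecLang F).Term A, t.realize (fun a : A => (a : M)) = x := by
      induction hx using Submodule.span_induction with
      | mem x h => exact ⟨.var ⟨x, h⟩, rfl⟩
      | zero =>
        exact ⟨Constants.term (VecFunc.zero : (vecLang F).Functions 0),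
          Term.realize_constants.trans (LinCompat.zero (d := vecData F) _)⟩
      | add x y _ _ h h' =>
        obtain ⟨s, rfl⟩ := h
        obtain ⟨t, rfl⟩ := h'
        exact ⟨Functions.apply₂ (VecFunc.add : (vecLang F).Functions 2) s t,
          Term.realize_functions_apply₂.trans (opAdd_eq _ _)⟩
      | smul α x _ h =>
        obtain ⟨s, rfl⟩ := h
        exact ⟨Functions.apply₁ (VecFunc.smul α : (vecLang F).Functions 1) s,
          Term.realize_functions_apply₁.trans (opSmul_eq _ _)⟩
    obtain ⟨t, ht⟩ := this
    refine ⟨{x}, Set.definable_iff_exists_formula_sum.2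
      ⟨((t.relabel Sum.inl).equal (.var (Sum.inr 0)) : (vecLang F).Formula (A ⊕ Fin 1)), ?_⟩,
      Set.finite_singleton x, rfl⟩
    ext y
    simp only [Set.mem_ofPred_eq, Formula.realize_equal, Term.realize_relabel, Term.realize_var,
      Sum.elim_inr, Set.mem_singleton_iff]
    rw [show (Sum.elim (fun a : A => (a : M)) y) ∘ Sum.inl = fun a : A => (a : M) from rfl, ht]
    exact eq_comm

end Span

/-! ### Model completeness and closed substructures of infinite vector spaces -/

section VecTheory

variable {F : Type} [Field F]

/-- Tarski–Vaught test. Given a witness a outside f(M), choose b in M outside the finite span of the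
parameters. A functional that kills the parameters and a - f(b), with value 1 at f(b), also has
value 1 at a. The transvection along f(b) - a then fixes the parameters and carries a to f(b). -/
theorem isModelComplete_infVecTheory [Finite F] : IsModelComplete.{0, 0, w} (infVecTheory F) := by
  intro M N _ _ _ _ hM hN f n φ x
  have hinf := ((model_infVecTheory_iff M).1 hM).2
  obtain ⟨_, _, _⟩ := isLinearTheory_infVecTheory (F := F) M
  obtain ⟨_, _, _⟩ := isLinearTheory_infVecTheory (F := F) N
  refine f.isElementary_of_exists (fun n φ x a h => ?_) φ x
  by_cases ha : a ∈ Set.range f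
  · obtain ⟨b, rfl⟩ := ha
    exact ⟨b, h⟩
  let ℓ := (vecData F).linearMap f
  let W := Submodule.span F (Set.range x)
  have hW : Finite W := by
    have : Module.Finite F W := Module.Finite.span_of_finite F (Set.finite_range x)
    exact Module.finite_of_finite F
  obtain ⟨b, hb⟩ : ∃ b, b ∉ W := by
    by_contra! h
    exact Set.infinite_univ ((Set.toFinite (W : Set M)).subset fun b _ => h b)
  have hW' : Submodule.map ℓ W = Submodule.span F (Set.range (f ∘ x)) := by
    rw [Submodule.map_span, ← Set.range_comp]
    rfl
  have hfb : f b ∉ Submodule.map ℓ W ⊔ Submodule.span F {a - f b} := by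
    intro h
    obtain ⟨_, ⟨m, hm, rfl⟩, z, hz, hmz⟩ := Submodule.mem_sup.1 h
    obtain ⟨c, rfl⟩ := Submodule.mem_span_singleton.1 hz
    by_cases hc : c = 0
    · rw [hc, zero_smul, add_zero] at hmz
      rw [← f.injective hmz] at hb
      exact hb hm
    · refine ha ⟨c⁻¹ • (b - m) + b, ?_⟩
      change ℓ (c⁻¹ • (b - m) + b) = a
      rw [map_add, map_smul, map_sub]
      have : ℓ b - ℓ m = c • (a - ℓ b) := by rw [sub_eq_iff_eq_add']; exact hmz.symm
      rw [this, smul_smul, inv_mul_cancel₀ hc, one_smul, sub_add_cancel]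
  obtain ⟨g, hg, hgW⟩ := exists_linear_functional_eq hfb
  have hga : g (f b - a) = 0 := by
    have : g (a - f b) = 0 :=
      hgW (Submodule.mem_sup_right (Submodule.mem_span_singleton_self _))
    rw [← neg_sub, map_neg, this, neg_zero]
  have hga' : g a = 1 := by rw [map_sub, hg, sub_eq_zero] at hga; exact hga.symm
  refine ⟨b, ?_⟩
  have key := (StrongHomClass.realize_boundedFormula
    (equivOfLinearEquiv (LinearEquiv.transvection (f := g) hga)) φ).2 h
  convert key using 1
  ext i
  refine Fin.lastCases ?_ (fun i => ?_) i
  · change _ = (_ + g _ • (f b - a))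
    simp [hga']
  · have : g (f (x i)) = 0 := hgW (Submodule.mem_sup_left
      (hW' ▸ Submodule.subset_span (Set.mem_range_self i)))
    change _ = (_ + g _ • (f b - a))
    simp [this]

theorem OpsAreVectorSpace.of_embedding {M N : Type*} [(vecLang F).Structure M]
    [(vecLang F).Structure N] (f : M ↪[vecLang F] N) (h : OpsAreVectorSpace (F := F) N) :
    OpsAreVectorSpace (F := F) M := by
  have z : f (opZero (F := F) M) = opZero (F := F) N :=
    (f.map_fun _ _).trans (congr_arg _ (Subsingleton.elim _ _))
  have A : ∀ x y, f (opAdd F M x y) = opAdd F N (f x) (f y) := fun x y =>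
    (f.map_fun _ _).trans (congr_arg _ (by ext i; fin_cases i <;> rfl))
  have S : ∀ (a : F) x, f (opSmul M a x) = opSmul N a (f x) := fun a x =>
    (f.map_fun _ _).trans (congr_arg _ (by ext i; fin_cases i; rfl))
  obtain ⟨a1, a2, a3, a4, a5, a6, a7, a8⟩ := h
  constructor <;> intros <;> apply f.injective <;> simp only [z, A, S]
  exacts [a1 _ _ _, a2 _ _, a3 _, a4 _, a5 _, a6 _ _ _, a7 _ _ _, a8 _ _ _]

theorem exists_substructure_eq_acl [Finite F] (N : Type w) [(vecLang F).Structure N] [Nonempty N]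
    [hN : N ⊨ infVecTheory F] (A : Set N) (hA : A.Infinite) :
    ∃ S : (vecLang F).Substructure N, (S : Set N) = acl (vecLang F) A ∧ S ⊨ infVecTheory F := by
  have hinf := ((model_infVecTheory_iff N).1 hN).2
  obtain ⟨_, _, _⟩ := isLinearTheory_infVecTheory (F := F) N
  let S : (vecLang F).Substructure N :=
    { carrier := acl (vecLang F) A
      fun_mem := by
        rw [acl_vecLang]
        intro n f x hx
        cases f with
        | zero => exact (LinCompat.zero (d := vecData F) x) ▸ zero_mem (Submodule.span F A)
        | add =>
          exact (LinCompat.add (d := vecData F) x) ▸ add_mem (hx 0) (hx 1)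
        | smul α =>
          exact (funMap_smul α x) ▸ Submodule.smul_mem _ _ (hx 0) }
  refine ⟨S, rfl, (model_infVecTheory_iff S).2
    ⟨OpsAreVectorSpace.of_embedding S.subtype ((model_infVecTheory_iff N).1 hN).1, ?_⟩⟩
  refine Set.infinite_coe_iff.2 (hA.mono ?_)
  change A ⊆ acl (vecLang F) A
  rw [acl_vecLang]
  exact Submodule.subset_span

end VecTheory

/-! ### Vector subspaces over a finite field -/

section Reducts

variable {F : Type} [Field F] {L₀ : FirstOrder.Language.{u₀, v₀}} {L : FirstOrder.Language.{u, v}}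

/-- Names in `L₀` for the vector space operations are names in an extension of `L₀`. -/
def LinData.map (d : LinData F L₀) (ι : L₀ →ᴸ L) : LinData F L where
  zero := ι.onFunction d.zero
  add := ι.onFunction d.add
  smul a := ι.onTerm (d.smul a)

theorem linCompat_map_iff (d : LinData F L₀) (ι : L₀ →ᴸ L) (M : Type w) [L.Structure M]
    [AddCommGroup M] [Module F M] :
    LinCompat (d.map ι) M ↔ @LinCompat F _ L₀ d M (ι.reduct M) _ _ := by
  let _ := ι.reduct M
  have := ι.isExpansionOn_reduct M
  have h (a : F) (x : Unit → M) : ((d.map ι).smul a).realize x = (d.smul a).realize x :=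
    LHom.realize_onTerm ι (d.smul a) x
  constructor
  · rintro ⟨h1, h2, h3⟩
    exact ⟨h1, h2, fun a x => (h a x).symm.trans (h3 a x)⟩
  · rintro ⟨h1, h2, h3⟩
    exact ⟨h1, h2, fun a x => (h a x).trans (h3 a x)⟩

theorem ContainsTheory.reduct_model {ι : L₀ →ᴸ L} {T : L.Theory} {T₀ : L₀.Theory}
    (h : ContainsTheory ι T T₀) (M : Type w) [L.Structure M] [Nonempty M] [M ⊨ T] :
    letI := ι.reduct M
    M ⊨ T₀ := by
  let _ := ι.reduct M
  have := ι.isExpansionOn_reduct M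
  exact ⟨fun σ hσ => (LHom.realize_onSentence M ι σ).1 ((h σ hσ).realize_sentence M)⟩

end Reducts

/-! ### The suitable triple and the companion for vector subspaces -/

section Subspaces

variable {F : Type} [Field F] {L : FirstOrder.Language.{u, v}} {ι : vecLang F →ᴸ L} {T : L.Theory}

theorem ContainsTheory.isLinearTheory (h : ContainsTheory ι T (infVecTheory F)) :
    IsLinearTheory.{u, v, w} ((vecData F).map ι) T := by
  intro M _ _ _
  let _ := ι.reduct M
  have := h.reduct_model M
  obtain ⟨i, j, k⟩ := isLinearTheory_infVecTheory (F := F) M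
  exact ⟨i, j, (linCompat_map_iff _ ι M).2 k⟩

theorem ContainsTheory.infinite (h : ContainsTheory ι T (infVecTheory F)) (M : Type w)
    [L.Structure M] [Nonempty M] [M ⊨ T] : Infinite M := by
  let _ := ι.reduct M
  exact ((model_infVecTheory_iff (F := F) M).1 (h.reduct_model M)).2

theorem closedIffSubspace_vecLang :
    ClosedIffSubspace.{u, v, 0, 0, w} ((vecData F).map ι) ι T := by
  intro M _ _ _ _ _ hM X
  let _ := ι.reduct M
  have := (linCompat_map_iff _ ι M).1 hM
  constructor
  · intro h
    refine ⟨{ carrier := X, zero_mem' := ?_, add_mem' := ?_, smul_mem' := ?_ }, rfl⟩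
    · intro x y hx hy
      have := h 2 VecFunc.add ![x, y] (by intro j; fin_cases j <;> assumption)
      exact (opAdd_eq (F := F) x y) ▸ this
    · exact (opZero_eq (F := F) M) ▸ h 0 VecFunc.zero _ fun j => j.elim0
    · intro a x hx
      have := h 1 (VecFunc.smul a) ![x] (by intro j; fin_cases j; exact hx)
      exact (opSmul_eq (F := F) a x) ▸ this
  · rintro ⟨W, rfl⟩ k f x hx
    cases f with
    | zero => exact (LinCompat.zero (d := vecData F) x).symm ▸ zero_mem W
    | add => exact (LinCompat.add (d := vecData F) x).symm ▸ add_mem (hx 0) (hx 1)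
    | smul a => exact (funMap_smul a x).symm ▸ W.smul_mem a (hx 0)

theorem isSuitableTriple_vecLang [Finite F] (h : ContainsTheory ι T (infVecTheory F))
    (hmc : IsModelComplete.{u, v, max u v} T) (hT : EliminatesExistsInfinity.{u, v, max u v} T) :
    IsSuitableTriple.{u, v, 0, 0, max u v} ι T (infVecTheory F) where
  contains := h
  modelComplete := hmc
  modelComplete₀ := isModelComplete_infVecTheory
  acl_model N _ _ _ A hA := exists_substructure_eq_acl N A hA
  pregeometry N _ _ hN := by
    have := ((model_infVecTheory_iff N).1 hN).2
    obtain ⟨_, _, _⟩ := isLinearTheory_infVecTheory (F := F) N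
    rw [funext acl_vecLang]
    exact isPregeometry_span
  modular N _ _ hN := by
    have := ((model_infVecTheory_iff N).1 hN).2
    obtain ⟨_, _, _⟩ := isLinearTheory_infVecTheory (F := F) N
    rw [funext acl_vecLang]
    exact isModular_span
  -- Since algebraic closure in the reduct is the span, independence over the elementary submodel is
  -- the linear independence in `IndepRealizable`.
  definable n m φ := by
    obtain ⟨θ, hθ⟩ := UDef.indepRealizable h.isLinearTheory hT φ
    refine ⟨θ, fun M _ _ _ b => (hθ M b).trans ?_⟩
    refine exists_congr fun N => exists_congr fun _ => exists_congr fun f => exists_congr fun a =>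
      and_congr_right fun _ => ?_
    have : N ⊨ T := (f.theory_model_iff T).1 inferInstance
    have : Nonempty N := (inferInstance : Nonempty M).map f
    obtain ⟨_, _, hN⟩ := h.isLinearTheory N
    obtain ⟨_, _, hM⟩ := h.isLinearTheory M
    have hinf := h.infinite N
    let _ := ι.reduct N
    have := (linCompat_map_iff _ ι N).1 hN
    have hacl : aclReduct ι = fun A : Set N => (Submodule.span F A : Set N) :=
      funext fun A => acl_vecLang A
    let ℓ := ((vecData F).map ι).linearMap f.toEmbedding
    have hr : Set.range f = (LinearMap.range ℓ : Set N) := rfl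
    rw [hacl, hr, isIndepTupleOver_span_iff]
    refine forall_congr' fun c => imp_congr_right fun _ => ?_
    simp only [LinData.realize_comb]
    exact ⟨fun H ⟨m, hm⟩ => H m hm.symm, fun H m hm => H ⟨m, hm.symm⟩⟩

theorem exists_modelCompanion_subspaces [Finite F] (h : ContainsTheory ι T (infVecTheory F))
    (hmc : IsModelComplete.{u, v, max u v} T) (hT : EliminatesExistsInfinity.{u, v, max u v} T)
    (n : ℕ) : ∃ TV : (L.sum (predLang n)).Theory,
      IsModelCompanion.{u, v, max u v} TV (infiniteSubstructureTheory ι T n) ∧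
        IsModelCompanion.{u, v, max u v} TV (substructureTheory ι T n) :=
  ⟨_, genericTheory_isModelCompanion hmc h.isLinearTheory hT closedIffSubspace_vecLang
    (fun M _ _ _ => h.infinite M) n⟩

end Subspaces

/-! ### Additive subgroups of fields -/

section Fields

variable {L : FirstOrder.Language.{u, v}}

/-- The names in a language of rings for the `ZMod p`-vector space operations. -/
def ringData (p : ℕ) (ι : Language.ring →ᴸ L) : LinData (ZMod p) L where
  zero := ι.onFunction Ring.zeroFunc
  add := ι.onFunction Ring.addFunc
  smul a := (fun t => Functions.apply₂ (ι.onFunction Ring.addFunc) (Term.var ()) t)^[a.val]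
    (Constants.term (ι.onFunction Ring.zeroFunc))

theorem linCompat_ringData (p : ℕ) [Fact p.Prime] (ι : Language.ring →ᴸ L) (M : Type w)
    [L.Structure M] [Field M] (hM : IsCompatible ι M) [CharP M p] :
    letI := ZMod.algebra M p
    LinCompat (ringData p ι) M := by
  let _ := ZMod.algebra M p
  refine ⟨hM.zero, hM.add, fun a x => ?_⟩
  have h (k : ℕ) : ((fun t => Functions.apply₂ (ι.onFunction Ring.addFunc) (Term.var ()) t)^[k]
      (Constants.term (ι.onFunction Ring.zeroFunc))).realize x = k • x () := by
    induction k with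
    | zero =>
      rw [zero_nsmul]
      exact Term.realize_constants.trans (hM.zero _)
    | succ k ih =>
      rw [Function.iterate_succ_apply', Term.realize_functions_apply₂, ih, hM.add, succ_nsmul']
      rfl
  refine (h a.val).trans ?_
  rw [← Nat.cast_smul_eq_nsmul (ZMod p), ZMod.natCast_zmod_val]

theorem isLinearTheory_of_fields (p : ℕ) [Fact p.Prime] {ι : Language.ring →ᴸ L} {T : L.Theory}
    (h : ModelsAreFields.{u, v, w} ι T fun K _ => CharP K p ∧ Infinite K) :
    IsLinearTheory.{u, v, w} (ringData p ι) T := by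
  intro M _ _ _
  obtain ⟨_, hM, _, _⟩ := h M
  let _ := ZMod.algebra M p
  exact ⟨inferInstance, inferInstance, linCompat_ringData p ι M hM⟩

theorem closedIffSubspace_addGroupToRing (p : ℕ) [Fact p.Prime] {ι : Language.ring →ᴸ L}
    {T : L.Theory} (h : ModelsAreFields.{u, v, w} ι T fun K _ => CharP K p ∧ Infinite K) :
    ClosedIffSubspace.{u, v, 0, 0, w} (ringData p ι) (ι.comp addGroupToRing) T := by
  intro M _ _ _ _ _ hM X
  -- The vector space structure on M is an arbitrary compatible one, not necessarily that of the
  -- field. The identity -x + x = 0 is therefore stated in symbols, so that it transfers and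
  -- identifies the negation symbol with the additive inverse.
  have H : ∀ x : Fin 1 → M, Structure.funMap (ι.onFunction Ring.addFunc)
      ![Structure.funMap (ι.onFunction Ring.negFunc) x, x 0] =
        Structure.funMap (ι.onFunction Ring.zeroFunc) ![] := by
    obtain ⟨K, hK, _, _⟩ := h M
    intro x
    rw [hK.add, hK.zero]
    exact (congr_arg₂ _ (hK.neg x) rfl).trans (neg_add_cancel (x 0))
  have h0 : ∀ x, Structure.funMap (M := M) (ι.onFunction Ring.zeroFunc) x = 0 := hM.zero
  have hadd : ∀ x, Structure.funMap (M := M) (ι.onFunction Ring.addFunc) x = x 0 + x 1 := hM.add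
  have hneg : ∀ x, Structure.funMap (M := M) (ι.onFunction Ring.negFunc) x = -x 0 := fun x =>
    eq_neg_of_add_eq_zero_left ((hadd _).symm.trans ((H x).trans (h0 _)))
  constructor
  · intro h
    have hX : ∀ x ∈ X, ∀ y ∈ X, x + y ∈ X := fun x hx y hy => by
      have := h 2 AddGroupFunc.add ![x, y] (by intro j; fin_cases j <;> assumption)
      exact (hadd ![x, y]) ▸ this
    have hX0 : (0 : M) ∈ X := (h0 ![]) ▸ h 0 AddGroupFunc.zero _ fun j => j.elim0
    refine ⟨⟨⟨⟨X, fun hx hy => hX _ hx _ hy⟩, hX0⟩, ?_⟩, rfl⟩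
    intro a x hx
    -- Scalars of `ZMod p` act as iterated sums, so closure under addition gives closure under
    -- scalars.
    rw [← ZMod.natCast_zmod_val a, Nat.cast_smul_eq_nsmul]
    induction a.val with
    | zero => rw [zero_nsmul]; exact hX0
    | succ k ih => rw [succ_nsmul]; exact hX _ ih _ hx
  · rintro ⟨W, rfl⟩ k f x hx
    cases f with
    | zero => exact (h0 x).symm ▸ zero_mem W
    | neg => exact (hneg x).symm ▸ neg_mem (hx 0)
    | add => exact (hadd x).symm ▸ add_mem (hx 0) (hx 1)

theorem exists_modelCompanion_additiveSubgroups (p : ℕ) [Fact p.Prime] {ι : Language.ring →ᴸ L}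
    {T : L.Theory} (h : ModelsAreFields.{u, v, max u v} ι T fun K _ => CharP K p ∧ Infinite K)
    (hmc : IsModelComplete.{u, v, max u v} T) (hT : EliminatesExistsInfinity.{u, v, max u v} T)
    (n : ℕ) : ∃ TG : (L.sum (predLang n)).Theory,
      IsModelCompanion.{u, v, max u v} TG (additiveSubgroupTheory ι T n) :=
  ⟨_, (genericTheory_isModelCompanion hmc (isLinearTheory_of_fields p h) hT
    (closedIffSubspace_addGroupToRing p h) (fun M _ _ _ => (h M).choose_spec.2.2) n).2⟩

end Fields

/-! ### Fields that are existentially closed in their fields of Laurent series -/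

section Laurent

theorem algebraMap_laurentSeries {K E : Type*} [Field K] [Field E] [Algebra K E] (a : K) :
    algebraMap K (LaurentSeries E) a = HahnSeries.C (algebraMap K E a) := by
  rw [HahnSeries.algebraMap_apply', PowerSeries.algebraMap_apply, HahnSeries.ofPowerSeries_C]

/-- Change of coefficients for Laurent series. -/
def laurentMap {K E : Type*} [Field K] [Field E] [Algebra K E] :
    LaurentSeries K →ₐ[K] LaurentSeries E where
  toFun x := x.map (algebraMap K E)
  map_one' := by
    ext n
    rw [HahnSeries.map_coeff, HahnSeries.coeff_one, HahnSeries.coeff_one]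
    split_ifs <;> simp
  map_mul' x y := by
    ext n
    simp only [HahnSeries.map_coeff, HahnSeries.coeff_mul, map_sum, map_mul]
    refine Finset.sum_congr ?_ fun _ _ => rfl
    ext ⟨i, j⟩
    simp
  map_zero' := by
    ext n
    simp
  map_add' x y := by
    ext n
    simp
  commutes' a := by
    ext n
    rw [HahnSeries.map_coeff, algebraMap_laurentSeries, algebraMap_laurentSeries,
      HahnSeries.C_apply, HahnSeries.C_apply, HahnSeries.coeff_single, HahnSeries.coeff_single]
    split_ifs <;> simp

/-- Linear disjointness inside a common field Ω: expanding over a basis of the algebraic closure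
shows that the product map from the tensor product to Ω is injective, so the tensor product is a
domain. -/
theorem isRegularExtension_of_linearIndependent {K E : Type w} {Ω : Type*} [Field K] [Field E]
    [Algebra K E] [Field Ω] [Algebra K Ω] (c : AlgebraicClosure K →ₐ[K] Ω) (g : E →ₐ[K] Ω)
    (h : ∀ {ι : Type w} (b : ι → AlgebraicClosure K) (s : Finset ι) (x : ι → E),
      LinearIndependent K b → ∑ i ∈ s, c (b i) * g (x i) = 0 → ∀ i ∈ s, x i = 0) :
    IsRegularExtension K E := by
  classical
  let Φ : AlgebraicClosure K ⊗[K] E →ₐ[K] Ω := Algebra.TensorProduct.productMap c g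
  have hΦ : Function.Injective Φ := by
    rw [injective_iff_map_eq_zero]
    intro z hz
    let b := Module.Basis.ofVectorSpace K (AlgebraicClosure K)
    obtain ⟨x, rfl⟩ := (TensorProduct.equivFinsuppOfBasisLeft (N := E) b).symm.surjective z
    suffices x = 0 by rw [this, map_zero]
    rw [TensorProduct.equivFinsuppOfBasisLeft_symm_apply, Finsupp.sum, map_sum] at hz
    simp only [Φ, Algebra.TensorProduct.productMap_apply_tmul] at hz
    ext i
    by_cases hi : i ∈ x.support
    · exact h b x.support x b.linearIndependent hz i hi
    · exact Finsupp.notMem_support_iff.1 hi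
  exact hΦ.isDomain Φ

/-- Inside the Laurent series over the algebraic closure, a linear relation with coefficients in
K((X)) splits into one relation over K for each power of X. -/
theorem isRegularExtension_laurentSeries (K : Type w) [Field K] :
    IsRegularExtension K (LaurentSeries K) := by
  let c : AlgebraicClosure K →ₐ[K] LaurentSeries (AlgebraicClosure K) :=
    { (HahnSeries.C : AlgebraicClosure K →+* LaurentSeries (AlgebraicClosure K)) with
      commutes' := fun a => (algebraMap_laurentSeries a).symm }
  refine isRegularExtension_of_linearIndependent c laurentMap fun b s x hb h i hi => ?_
  ext n
  refine linearIndependent_iff'.1 hb s (fun i => (x i).coeff n) ?_ i hi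
  have := congr_arg (fun y : LaurentSeries (AlgebraicClosure K) => y.coeff n) h
  rw [HahnSeries.coeff_sum, HahnSeries.coeff_zero] at this
  rw [← this]
  refine Finset.sum_congr rfl fun i _ => ?_
  change _ = (HahnSeries.C (b i) * (x i).map (algebraMap K (AlgebraicClosure K))).coeff n
  rw [HahnSeries.C_mul_eq_smul, HahnSeries.coeff_smul, HahnSeries.map_coeff, smul_eq_mul, Algebra.smul_def, mul_comm]

/-- The field `K` is existentially closed in the field of Laurent series over it. -/
def IsLaurentClosed (K : Type w) [Field K] : Prop :=
  ∀ (n : ℕ) (S : Finset (MvPolynomial (Fin n) K)),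
    (∃ x : Fin n → LaurentSeries K, ∀ f ∈ S, MvPolynomial.aeval x f = 0) →
      ∃ x : Fin n → K, ∀ f ∈ S, MvPolynomial.eval x f = 0

theorem IsPAC.isLaurentClosed {K : Type w} [Field K] (h : IsPAC K) : IsLaurentClosed K :=
  h (LaurentSeries K) (isRegularExtension_laurentSeries K)

/-- Hilbert's Nullstellensatz: the points of a variety over an algebraically closed field. -/
theorem exists_algHom_of_isAlgClosed (K : Type w) [Field K] [IsAlgClosed K] (A : Type w')
    [CommRing A] [Nontrivial A] [Algebra K A] [Algebra.FiniteType K A] : Nonempty (A →ₐ[K] K) := by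
  obtain ⟨m, hm⟩ := Ideal.exists_maximal A
  let _ := Ideal.Quotient.field m
  have : Algebra.FiniteType K (A ⧸ m) := inferInstance
  have : Module.Finite K (A ⧸ m) := finite_of_finite_type_of_isJacobsonRing K (A ⧸ m)
  have hb : Function.Bijective (algebraMap K (A ⧸ m)) :=
    IsAlgClosed.algebraMap_bijective_of_isIntegral
  let e := AlgEquiv.ofBijective (Algebra.ofId K (A ⧸ m)) hb
  exact ⟨e.symm.toAlgHom.comp (Ideal.Quotient.mkₐ K m)⟩

theorem exists_algHom_adjoin_of_isAlgClosed {K : Type w} [Field K] [IsAlgClosed K] {E : Type w'}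
    [Field E] [Algebra K E] {S : Set E} (hS : S.Finite) : Nonempty (Algebra.adjoin K S →ₐ[K] K) := by
  have : Algebra.FiniteType K (Algebra.adjoin K S) :=
    (Subalgebra.fg_iff_finiteType _).1 (Subalgebra.fg_def.2 ⟨_, hS, rfl⟩)
  exact exists_algHom_of_isAlgClosed K _

/-- A solution generates a finitely generated K-algebra, and the Nullstellensatz gives it a K-point.
-/
theorem isLaurentClosed_of_isAlgClosed (K : Type w) [Field K] [IsAlgClosed K] :
    IsLaurentClosed K := by
  rintro n S ⟨x, hx⟩
  obtain ⟨g⟩ := exists_algHom_adjoin_of_isAlgClosed (K := K) (Set.finite_range x)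
  let y : Fin n → Algebra.adjoin K (Set.range x) := fun i => ⟨x i, Algebra.subset_adjoin ⟨i, rfl⟩⟩
  refine ⟨fun i => g (y i), fun f hf => ?_⟩
  have h1 : MvPolynomial.aeval y f = 0 := by
    apply Subtype.val_injective
    have := MvPolynomial.comp_aeval_apply y (Algebra.adjoin K (Set.range x)).val f
    exact this.trans (hx f hf)
  have h2 := MvPolynomial.comp_aeval_apply y g f
  rw [h1, map_zero, MvPolynomial.aeval_eq_eval] at h2
  exact h2.symm

theorem IsLaurentClosed.exists_solution {K : Type w} [Field K] (h : IsLaurentClosed K) {σ : Type*}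
    [Finite σ] (S : Finset (MvPolynomial σ K))
    (hS : ∃ x : σ → LaurentSeries K, ∀ f ∈ S, MvPolynomial.aeval x f = 0) :
    ∃ x : σ → K, ∀ f ∈ S, MvPolynomial.eval x f = 0 := by
  classical
  obtain ⟨x, hx⟩ := hS
  obtain ⟨n, ⟨e⟩⟩ := Finite.exists_equiv_fin σ
  obtain ⟨y, hy⟩ := h n (S.image (MvPolynomial.rename e)) ⟨x ∘ e.symm, fun f hf => by
    obtain ⟨g, hg, rfl⟩ := Finset.mem_image.1 hf
    rw [MvPolynomial.aeval_rename]
    convert hx g hg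
    ext i
    simp⟩
  refine ⟨y ∘ e, fun f hf => ?_⟩
  have := hy _ (Finset.mem_image_of_mem _ hf)
  rwa [MvPolynomial.eval_rename] at this

/-- If K were finite, the product of all X - a would vanish identically on K, yet it is invertible
at the Laurent variable. -/
theorem IsLaurentClosed.infinite {K : Type w} [Field K] (h : IsLaurentClosed K) : Infinite K := by
  by_contra hK
  rw [not_infinite_iff_finite] at hK
  have := Fintype.ofFinite K
  let f : MvPolynomial Bool K :=
    (∏ a : K, (MvPolynomial.X true - MvPolynomial.C a)) * MvPolynomial.X false - 1
  obtain ⟨x, hx⟩ := h.exists_solution {f} ⟨fun b => bif b then HahnSeries.single 1 1 else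
    (∏ a : K, (HahnSeries.single 1 1 - algebraMap K (LaurentSeries K) a))⁻¹, fun g hg => by
      rw [Finset.mem_singleton.1 hg]
      simp only [f, map_sub, map_mul, map_prod, MvPolynomial.aeval_X, MvPolynomial.aeval_C,
        map_one, cond_true, cond_false]
      rw [mul_inv_cancel₀, sub_self]
      refine Finset.prod_ne_zero_iff.2 fun a _ h0 => ?_
      have := congr_arg (fun y : LaurentSeries K => y.coeff 1) h0
      simp [algebraMap_laurentSeries, HahnSeries.C_apply] at this⟩
  have := hx f (Finset.mem_singleton_self f)
  simp only [f, map_sub, map_mul, map_prod, MvPolynomial.eval_X, MvPolynomial.eval_C,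
        map_one] at this
  rw [Finset.prod_eq_zero (Finset.mem_univ (x true)) (sub_self _)] at this
  simp at this

end Laurent

/-! ### Smooth points -/

section BiEval

variable {R A B σ : Type*} [CommRing R] [CommRing A] [CommRing B]

/-- The value at `(u, y)` of a polynomial over the polynomials in variables `σ`. -/
noncomputable def biEval (f : R →+* A) (x : σ → A) (y : A) :
    Polynomial (MvPolynomial σ R) →+* A :=
  Polynomial.eval₂RingHom (MvPolynomial.eval₂Hom f x) y

theorem biEval_apply (f : R →+* A) (x : σ → A) (y : A) (p : Polynomial (MvPolynomial σ R)) :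
    biEval f x y p = p.eval₂ (MvPolynomial.eval₂Hom f x) y := rfl

theorem map_biEval (g : A →+* B) (f : R →+* A) (x : σ → A) (y : A)
    (p : Polynomial (MvPolynomial σ R)) :
    g (biEval f x y p) = biEval (g.comp f) (g ∘ x) (g y) p := by
  rw [biEval_apply, biEval_apply, Polynomial.hom_eval₂]
  congr 1
  ext <;> simp

theorem biEval_eq_eval_map (f : R →+* A) (x : σ → A) (y : A) (p : Polynomial (MvPolynomial σ R)) :
    biEval f x y p = (p.map (MvPolynomial.eval₂Hom f x)).eval y := by
  rw [biEval_apply, Polynomial.eval_map]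

/-- A polynomial over the polynomials in variables `σ`, as a polynomial with one more variable. -/
noncomputable def flatten (p : Polynomial (MvPolynomial σ R)) : MvPolynomial (σ ⊕ Bool) R :=
  biEval MvPolynomial.C (fun i => MvPolynomial.X (Sum.inl i)) (MvPolynomial.X (Sum.inr true)) p

/-- The variable `inr true` carries the polynomial variable. The variable `inr false` does not occur
in `flatten p`; it is reserved for the inverse in the Rabinowitsch trick. -/
theorem eval₂Hom_flatten (f : R →+* A) (x : σ ⊕ Bool → A) (p : Polynomial (MvPolynomial σ R)) :
    MvPolynomial.eval₂Hom f x (flatten p) = biEval f (x ∘ Sum.inl) (x (Sum.inr true)) p := by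
  rw [flatten, map_biEval]
  congr 1
  · congr 1
    · ext; simp
    · ext; simp
    · simp

end BiEval

/-- If `K` is existentially closed in `K((X))`, then near a smooth point there are enough other
points to avoid any given hypersurface. -/
theorem IsLaurentClosed.exists_generic_point {K : Type w} [Field K] (h : IsLaurentClosed K)
    {σ : Type*} [Finite σ] (P : Polynomial (MvPolynomial σ K)) (hP : P.Monic) (x₀ : σ → K) (y₀ : K)
    (h₀ : biEval (RingHom.id K) x₀ y₀ P = 0)
    (h₁ : biEval (RingHom.id K) x₀ y₀ (Polynomial.derivative P) ≠ 0)
    (Q : MvPolynomial σ K) (hQ : Q ≠ 0) :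
    ∃ x y, biEval (RingHom.id K) x y P = 0 ∧ MvPolynomial.eval x Q ≠ 0 := by
  classical
  have := h.infinite
  obtain ⟨x₁, hx₁⟩ : ∃ x₁, MvPolynomial.eval x₁ Q ≠ 0 := by
    by_contra! H
    exact hQ (MvPolynomial.funext fun x => by rw [H, map_zero])
  -- The line through `x₀` at parameter 0 and `x₁` at parameter 1, where Q does not vanish.
  let ℓ : σ → Polynomial K := fun i =>
    Polynomial.C (x₀ i) + Polynomial.X * Polynomial.C (x₁ i - x₀ i)
  let κ : Polynomial K →+* PowerSeries K := Polynomial.coeToPowerSeries.ringHom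
  let x : σ → PowerSeries K := fun i => κ (ℓ i)
  let c : K →+* PowerSeries K := PowerSeries.C
  let f := P.map (MvPolynomial.eval₂Hom c x)
  have hcc : (PowerSeries.constantCoeff : PowerSeries K →+* K).comp c = RingHom.id K := by
    ext; simp [c]
  have hcx : (PowerSeries.constantCoeff : PowerSeries K →+* K) ∘ x = x₀ := by
    ext i
    simp [x, ℓ, κ, Polynomial.coeToPowerSeries.ringHom_apply]
  have val (p : Polynomial (MvPolynomial σ K)) :
      PowerSeries.constantCoeff (biEval c x (c y₀) p) = biEval (RingHom.id K) x₀ y₀ p := by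
    rw [map_biEval, hcc, hcx]
    simp [c]
  -- The simple root `y₀` at parameter 0 lifts to a power series root along the line.
  obtain ⟨y, hy, -⟩ := HenselianRing.is_henselian
    (I := (Ideal.span {PowerSeries.X} : Ideal (PowerSeries K))) f (hP.map _) (c y₀)
    (by
      rw [Ideal.mem_span_singleton, PowerSeries.X_dvd_iff]
      exact (congr_arg _ (biEval_eq_eval_map _ _ _ _).symm).trans ((val P).trans h₀))
    (by
      refine IsUnit.map _ (PowerSeries.isUnit_iff_constantCoeff.2 (isUnit_iff_ne_zero.2 ?_))
      rw [Polynomial.derivative_map, ← biEval_eq_eval_map, val]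
      exact h₁)
  have hy : biEval c x y P = 0 := by
    rw [biEval_eq_eval_map]
    exact hy
  -- Along the line Q is a polynomial in the parameter, nonzero because its value at 1 is Q(`x₁`).
  have hQx : MvPolynomial.eval₂Hom c x Q ≠ 0 := by
    have e : MvPolynomial.eval₂Hom c x Q = κ (MvPolynomial.eval₂Hom Polynomial.C ℓ Q) := by
      rw [← RingHom.comp_apply]
      congr 1
      ext <;> simp [c, κ, x, Polynomial.coeToPowerSeries.ringHom_apply]
    rw [e]
    intro h0
    have h0 : MvPolynomial.eval₂Hom Polynomial.C ℓ Q = 0 :=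
      Polynomial.coe_injective K (h0.trans Polynomial.coe_zero.symm)
    refine hx₁ ?_
    have := congr_arg (Polynomial.evalRingHom (1 : K)) h0
    rw [← RingHom.comp_apply, map_zero] at this
    rw [← this]
    congr 1
    ext <;> simp [ℓ]
  let j : PowerSeries K →+* LaurentSeries K := HahnSeries.ofPowerSeries ℤ K
  have hj : Function.Injective j := HahnSeries.ofPowerSeries_injective
  have hjc : j.comp c = algebraMap K (LaurentSeries K) := by
    ext1 a
    rw [algebraMap_laurentSeries]
    exact HahnSeries.ofPowerSeries_C a
  -- The inequation Q ≠ 0 is turned into an equation with an extra variable for the inverse.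
  let q : MvPolynomial (σ ⊕ Bool) K :=
    MvPolynomial.rename Sum.inl Q * MvPolynomial.X (Sum.inr false) - 1
  obtain ⟨z, hz⟩ := h.exists_solution {flatten P, q}
    ⟨Sum.elim (j ∘ x) fun b => bif b then j y else (j (MvPolynomial.eval₂Hom c x Q))⁻¹, by
      intro g hg
      rw [Finset.mem_insert, Finset.mem_singleton] at hg
      rcases hg with rfl | rfl
      · refine (eval₂Hom_flatten _ _ _).trans ?_
        refine Eq.trans ?_ ((congr_arg j hy).trans (map_zero j))
        rw [map_biEval, hjc]
        rfl
      · simp only [q, map_sub, map_mul, map_one, MvPolynomial.aeval_X, Sum.elim_inr, cond_false]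
        rw [MvPolynomial.aeval_rename, Sum.elim_comp_inl]
        have : MvPolynomial.aeval (j ∘ x) Q = j (MvPolynomial.eval₂Hom c x Q) := by
          rw [← RingHom.comp_apply, MvPolynomial.comp_eval₂Hom, hjc]
          rfl
        rw [this, mul_inv_cancel₀, sub_self]
        exact fun h0 => hQx (hj (h0.trans (map_zero j).symm))⟩
  refine ⟨z ∘ Sum.inl, z (Sum.inr true), ?_, ?_⟩
  · rw [← eval₂Hom_flatten]
    exact hz _ (Finset.mem_insert_self _ _)
  · intro h0
    have := hz q (Finset.mem_insert_of_mem (Finset.mem_singleton_self _))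
    simp only [q, map_sub, map_mul, map_one, MvPolynomial.eval_rename, h0, zero_mul] at this
    simp at this

open IntermediateField.algebraAdjoinAdjoin in
/-- A finitely generated extension of a perfect field is generated by a smooth point of a
hypersurface. -/
theorem exists_smooth_presentation (K : Type w) (E : Type w') [Field K] [Field E] [Algebra K E] [PerfectField K]
    [Algebra.EssFiniteType K E] :
    ∃ (s : Finset E) (P : Polynomial (MvPolynomial s K)) (y : E), P.Monic ∧
      biEval (algebraMap K E) Subtype.val y P = 0 ∧
      biEval (algebraMap K E) Subtype.val y (Polynomial.derivative P) ≠ 0 ∧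
      ∀ (Ω : Type w) [Field Ω] [Algebra K Ω] (x : s → Ω) (z : Ω), AlgebraicIndependent K x →
        biEval (algebraMap K Ω) x z P = 0 → Nonempty (E →ₐ[K] Ω) := by
  obtain ⟨s, hs, hsep⟩ := exists_isTranscendenceBasis_and_isSeparable_of_perfectField K E
  have hsr : (s : Set E) = Set.range (Subtype.val : s → E) := Subtype.range_coe.symm
  rw [hsr] at hsep
  let R := Algebra.adjoin K (Set.range (Subtype.val : s → E))
  let F := IntermediateField.adjoin K (Set.range (Subtype.val : s → E))
  have : Algebra.EssFiniteType F E := Algebra.EssFiniteType.of_comp K F E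
  have : FiniteDimensional F E := Algebra.finite_of_essFiniteType_of_isAlgebraic
  obtain ⟨α, hα⟩ := Field.exists_primitive_element F E
  have hαR : IsAlgebraic R α :=
    (IsFractionRing.isAlgebraic_iff R F E).2 (Algebra.IsAlgebraic.isAlgebraic α)
  -- Replacing the primitive element by an integral multiple makes its minimal polynomial monic over
  -- the polynomial ring R.
  obtain ⟨r, hr, hy⟩ := hαR.exists_integral_multiple
  set y := r • α with hy_def
  have hyF : IntermediateField.adjoin F {y} = ⊤ := by
    rw [← top_le_iff, ← hα, IntermediateField.adjoin_simple_le_iff]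
    have hr' : algebraMap R F r ≠ 0 := by
      rwa [Ne, FaithfulSMul.algebraMap_eq_zero_iff]
    have : α = (algebraMap R F r)⁻¹ • y := by
      rw [hy_def, ← algebraMap_smul F r α, smul_smul, inv_mul_cancel₀ hr', one_smul]
    rw [this]
    exact IntermediateField.smul_mem _ (IntermediateField.mem_adjoin_simple_self F y)
  let e : MvPolynomial s K ≃ₐ[K] R := hs.1.aevalEquiv
  have : IsIntegrallyClosed R := IsIntegrallyClosed.of_equiv e.toRingEquiv
  -- R is a polynomial ring, hence integrally closed, so the minimal polynomials over R and over its
  -- fraction field agree. Separability then gives a nonzero derivative at y.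
  have hmin : minpoly F y = (minpoly R y).map (algebraMap R F) :=
    minpoly.isIntegrallyClosed_eq_field_fractions F E hy
  have hF : (MvPolynomial.eval₂Hom (algebraMap K E) Subtype.val).comp
      (e.symm : R →+* MvPolynomial s K) = algebraMap R E := by
    ext1 a
    obtain ⟨q, rfl⟩ := e.surjective a
    simp only [RingHom.comp_apply, RingHom.coe_coe, AlgEquiv.symm_apply_apply]
    exact (hs.1.algebraMap_aevalEquiv q).symm
  let P := (minpoly R y).map (e.symm : R →+* MvPolynomial s K)
  refine ⟨s, P, y, (minpoly.monic hy).map _, ?_, ?_, ?_⟩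
  · rw [biEval_apply, Polynomial.eval₂_map, hF]
    exact minpoly.aeval R y
  · rw [Polynomial.derivative_map, biEval_apply, Polynomial.eval₂_map, hF]
    have := (Algebra.IsSeparable.isSeparable F y).aeval_derivative_ne_zero (minpoly.aeval F y)
    rwa [hmin, Polynomial.derivative_map, Polynomial.aeval_map_algebraMap] at this
  · intro Ω _ _ x z hx hz
    -- Algebraic independence of x embeds the rational function field in Ω; the root z then extends
    -- this embedding to E = F(y).
    let g : F →ₐ[K] Ω := (IntermediateField.val _).comp
      (hs.1.aevalEquivField.symm.trans hx.aevalEquivField).toAlgHom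
    have hg : (g : F →+* Ω).comp (algebraMap R F) =
        (MvPolynomial.eval₂Hom (algebraMap K Ω) x).comp (e.symm : R →+* MvPolynomial s K) := by
      ext1 a
      obtain ⟨q, rfl⟩ := e.surjective a
      have : algebraMap R F (e q) = hs.1.aevalEquivField (algebraMap _ _ q) :=
        Subtype.ext ((hs.1.algebraMap_aevalEquiv q).trans
          (hs.1.aevalEquivField_algebraMap_apply_coe q).symm)
      simp only [RingHom.comp_apply, RingHom.coe_coe, AlgEquiv.symm_apply_apply, this]
      refine Eq.trans ?_ (hx.aevalEquivField_algebraMap_apply_coe q)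
      exact congr_arg (fun a => (hx.aevalEquivField a : Ω)) (AlgEquiv.symm_apply_apply _ _)
    let _ : Algebra F Ω := (g : F →+* Ω).toAlgebra
    have : IsScalarTower K F Ω := IsScalarTower.of_algebraMap_eq fun a => (g.commutes a).symm
    have hyi : IsIntegral F y := Algebra.IsIntegral.isIntegral y
    have hz' : z ∈ (minpoly F y).aroots Ω := by
      rw [Polynomial.mem_aroots]
      refine ⟨minpoly.ne_zero hyi, ?_⟩
      rw [hmin, Polynomial.aeval_def, Polynomial.eval₂_map]
      rw [biEval_apply, Polynomial.eval₂_map, ← hg] at hz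
      exact hz
    let θ := (IntermediateField.algHomAdjoinIntegralEquiv F hyi).symm ⟨z, hz'⟩
    rw [hyF] at θ
    exact ⟨(θ.comp IntermediateField.topEquiv.symm.toAlgHom).restrictScalars K⟩

/-! ### Elementary extensions and finite definable sets -/

section ElementaryExtensions

variable {L : FirstOrder.Language.{u, v}}

/-- A set of formulas with parameters in `M` that is finitely realised in `M` is realised in an
elementary extension. -/
theorem exists_elementaryExtension {M : Type (max u v)} [L.Structure M] [Nonempty M]
    {σ : Type (max u v)} (Γ : Set (L.Formula (M ⊕ σ)))
    (h : ∀ Γ₀ : Finset (L.Formula (M ⊕ σ)), ↑Γ₀ ⊆ Γ →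
      ∃ x : σ → M, ∀ γ ∈ Γ₀, γ.Realize (Sum.elim id x)) :
    ∃ (N : Type (max u v)) (_ : L.Structure N) (e : M ↪ₑ[L] N) (x : σ → N),
      ∀ γ ∈ Γ, γ.Realize (Sum.elim e x) := by
  classical
  obtain ⟨N, _, _, _, e, he⟩ := exists_realize_of_finite (T := (∅ : L.Theory))
    (Γ ∪ (fun γ => γ.relabel Sum.inl) '' elementaryDiagramFormulas L M) fun Γ₀ hΓ₀ => by
      obtain ⟨x, hx⟩ := h (Γ₀.filter (· ∈ Γ)) fun γ hγ => by simp at hγ; exact hγ.2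
      refine ⟨M, inferInstance, inferInstance, inferInstance, Sum.elim id x, fun γ hγ => ?_⟩
      by_cases hγ' : γ ∈ Γ
      · exact hx γ (Finset.mem_filter.2 ⟨hγ, hγ'⟩)
      · obtain ⟨δ, hδ, rfl⟩ := (hΓ₀ hγ).resolve_left hγ'
        rw [Formula.realize_relabel]
        exact realize_of_mem_elementaryDiagramFormulas hδ
  refine ⟨N, inferInstance, elementaryOfDiagram (e ∘ Sum.inl) fun γ hγ => ?_, e ∘ Sum.inr,
    fun γ hγ => ?_⟩
  · rw [← Formula.realize_relabel]
    exact he _ (Or.inr ⟨γ, hγ, rfl⟩)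
  · have : e = Sum.elim (e ∘ Sum.inl) (e ∘ Sum.inr) := (Sum.elim_comp_inl_inr e).symm
    have h' := he γ (Or.inl hγ)
    rw [this] at h'
    exact h'

/-- "Every realisation is one of these listed elements" is a first-order statement about the list,
so an elementary extension adds no realisation. -/
theorem mem_range_of_finite {M N : Type w} [L.Structure M] [L.Structure N] [Nonempty M]
    (e : M ↪ₑ[L] N) {m : ℕ} (φ : L.Formula (Unit ⊕ Fin m)) (b : Fin m → M)
    (hfin : {t : M | φ.Realize (Sum.elim (fun _ => t) b)}.Finite) {t : N}
    (ht : φ.Realize (Sum.elim (fun _ => t) (e ∘ b))) : t ∈ Set.range e := by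
  obtain ⟨k, s, hs⟩ := hfin.fin_param
  have U : UDef.{u, v, w} (∅ : L.Theory) fun M _ (c : Fin m ⊕ Fin k → M) =>
      ∀ t : Unit → M, φ.Realize (Sum.elim t (c ∘ Sum.inl)) → ∃ i, c (Sum.inr i) = t () := by
    refine UDef.forall_tuple (P := fun M _ c => φ.Realize (Sum.elim (c ∘ Sum.inr)
      (c ∘ Sum.inl ∘ Sum.inl)) → ∃ i, c (Sum.inl (Sum.inr i)) = c (Sum.inr ())) (UDef.imp ?_ ?_)
    · refine ((UDef.formula φ).comp (Sum.elim Sum.inr (Sum.inl ∘ Sum.inl))).of_iff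
        fun M _ _ _ c => ?_
      rw [Sum.comp_elim]
    · exact UDef.finite_exists fun i =>
        UDef.equal (.var (Sum.inl (Sum.inr i))) (.var (Sum.inr ()))
  obtain ⟨i, hi⟩ := (U.map_iff e (Sum.elim b s)).2 (fun t ht => by
    have : t () ∈ Set.range s := by
      rw [hs.2]
      exact ht
    exact this) (fun _ => t) ht
  exact ⟨s i, hi⟩

/-- Compactness: an infinite solution set contains points avoiding any finite set of elements of M.
-/
theorem exists_new_realization {M : Type (max u v)} [L.Structure M] [Nonempty M] {m : ℕ}
    (φ : L.Formula (Unit ⊕ Fin m)) (b : Fin m → M)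
    (hinf : {t : M | φ.Realize (Sum.elim (fun _ => t) b)}.Infinite) :
    ∃ (N : Type (max u v)) (_ : L.Structure N) (e : M ↪ₑ[L] N) (t : N),
      φ.Realize (Sum.elim (fun _ => t) (e ∘ b)) ∧ t ∉ Set.range e := by
  classical
  let ne (a : M) : L.Formula (M ⊕ PUnit.{max u v + 1}) :=
    ((Term.var (Sum.inr PUnit.unit)).equal (Term.var (Sum.inl a))).not
  obtain ⟨N, _, e, x, hx⟩ := exists_elementaryExtension
    ({(φ.relabel (Sum.elim (fun _ => Sum.inr PUnit.unit) (Sum.inl ∘ b)) :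
      L.Formula (M ⊕ PUnit.{max u v + 1}))} ∪ Set.range ne) fun Γ₀ hΓ₀ => by
      have hf : {a : M | ne a ∈ Γ₀}.Finite := by
        refine Γ₀.finite_toSet.preimage fun a _ c _ hac => ?_
        have := congr_arg (fun γ => γ.Realize (Sum.elim id fun _ => a)) hac
        simpa [ne] using this
      obtain ⟨t, ht, ht'⟩ := hinf.exists_notMem_finset hf.toFinset
      refine ⟨fun _ => t, fun γ hγ => ?_⟩
      rcases hΓ₀ hγ with rfl | ⟨a, rfl⟩
      · rw [Formula.realize_relabel]
        refine (congr_arg φ.Realize ?_).mp ht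
        ext (i | i) <;> rfl
      · simp only [ne, Formula.realize_not, Formula.realize_equal, Term.realize_var, Sum.elim_inr,
          Sum.elim_inl, id]
        rintro rfl
        exact ht' (hf.mem_toFinset.2 hγ)
  refine ⟨N, inferInstance, e, x PUnit.unit, ?_, ?_⟩
  · have := hx _ (Or.inl rfl)
    rw [Formula.realize_relabel] at this
    convert this using 1
    ext (i | i) <;> rfl
  · rintro ⟨a, ha⟩
    have := hx _ (Or.inr ⟨a, rfl⟩)
    simp only [ne, Formula.realize_not, Formula.realize_equal, Term.realize_var, Sum.elim_inr,
      Sum.elim_inl] at this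
    exact this ha.symm

end ElementaryExtensions

/-! ### Polynomials and terms -/

section Terms

variable {L : FirstOrder.Language.{u, v}} (ι : Language.ring →ᴸ L)

/-- The polynomials represented by terms form a subring containing the variables. Coefficients are
integers so that one term serves all fields; other coefficients are treated as variables and
substituted by `spec`. -/
theorem exists_term_eq_eval {α : Type w'} (q : MvPolynomial α ℤ) :
    ∃ t : L.Term α, ∀ (M : Type w) [Field M] [L.Structure M], IsCompatible ι M →
      ∀ x : α → M, t.realize x = MvPolynomial.eval₂Hom (Int.castRingHom M) x q := by
  let S : Subring (MvPolynomial α ℤ) :=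
    { carrier := {q | ∃ t : L.Term α, ∀ (M : Type w) [Field M] [L.Structure M], IsCompatible ι M →
        ∀ x : α → M, t.realize x = MvPolynomial.eval₂Hom (Int.castRingHom M) x q}
      zero_mem' := ⟨Constants.term (ι.onFunction Ring.zeroFunc), fun M _ _ hM x => by
        rw [map_zero]
        exact Term.realize_constants.trans (hM.zero _)⟩
      one_mem' := ⟨Constants.term (ι.onFunction Ring.oneFunc), fun M _ _ hM x => by
        rw [map_one]
        exact Term.realize_constants.trans (hM.one _)⟩
      add_mem' := by
        rintro a b ⟨s, hs⟩ ⟨t, ht⟩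
        refine ⟨Functions.apply₂ (ι.onFunction Ring.addFunc) s t, fun M _ _ hM x => ?_⟩
        rw [map_add, ← hs M hM, ← ht M hM]
        exact Term.realize_functions_apply₂.trans (hM.add _)
      mul_mem' := by
        rintro a b ⟨s, hs⟩ ⟨t, ht⟩
        refine ⟨Functions.apply₂ (ι.onFunction Ring.mulFunc) s t, fun M _ _ hM x => ?_⟩
        rw [map_mul, ← hs M hM, ← ht M hM]
        exact Term.realize_functions_apply₂.trans (hM.mul _)
      neg_mem' := by
        rintro a ⟨s, hs⟩
        refine ⟨Functions.apply₁ (ι.onFunction Ring.negFunc) s, fun M _ _ hM x => ?_⟩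
        rw [map_neg, ← hs M hM]
        exact Term.realize_functions_apply₁.trans (hM.neg _) }
  change q ∈ S
  induction q using MvPolynomial.induction_on with
  | C a =>
    rw [show (MvPolynomial.C a : MvPolynomial α ℤ) = (a : MvPolynomial α ℤ) from
      (eq_intCast MvPolynomial.C a)]
    exact intCast_mem S a
  | add p q hp hq => exact add_mem hp hq
  | mul_X p i hp =>
    refine mul_mem hp ⟨Term.var i, fun M _ _ _ x => ?_⟩
    simp

variable {κ σ R A : Type*} [CommRing R] [CommRing A]

/-- Specialisation of some of the variables of an integral polynomial. -/
noncomputable def spec (σ : Type*) (a : κ → R) : MvPolynomial (κ ⊕ σ) ℤ →+* MvPolynomial σ R :=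
  MvPolynomial.eval₂Hom (Int.castRingHom _) (Sum.elim (fun i => MvPolynomial.C (a i)) MvPolynomial.X)

theorem eval₂Hom_comp_spec (f : R →+* A) (x : σ → A) (a : κ → R) :
    (MvPolynomial.eval₂Hom f x).comp (spec σ a) =
      MvPolynomial.eval₂Hom (Int.castRingHom A) (Sum.elim (f ∘ a) x) := by
  ext i
  · simp
  · rcases i with i | i <;> simp [spec]

theorem eval₂Hom_spec (f : R →+* A) (x : σ → A) (a : κ → R) (q : MvPolynomial (κ ⊕ σ) ℤ) :
    MvPolynomial.eval₂Hom f x (spec σ a q) =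
      MvPolynomial.eval₂Hom (Int.castRingHom A) (Sum.elim (f ∘ a) x) q := by
  rw [← eval₂Hom_comp_spec, RingHom.comp_apply]

theorem biEval_map_spec (f : R →+* A) (x : σ → A) (y : A) (a : κ → R)
    (p : Polynomial (MvPolynomial (κ ⊕ σ) ℤ)) :
    biEval f x y (p.map (spec σ a)) = biEval (Int.castRingHom A) (Sum.elim (f ∘ a) x) y p := by
  rw [biEval_apply, Polynomial.eval₂_map, eval₂Hom_comp_spec]
  rfl

theorem spec_id_surjective : Function.Surjective (spec σ (id : R → R)) := by
  intro q
  induction q using MvPolynomial.induction_on with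
  | C a => exact ⟨MvPolynomial.X (Sum.inl a), by simp [spec]⟩
  | add p q hp hq =>
    obtain ⟨p, rfl⟩ := hp
    obtain ⟨q, rfl⟩ := hq
    exact ⟨p + q, map_add _ _ _⟩
  | mul_X p i hp =>
    obtain ⟨p, rfl⟩ := hp
    exact ⟨p * MvPolynomial.X (Sum.inr i), by simp [spec]⟩

/-- With each coefficient turned into a variable, the equation can be transferred to other fields,
in particular to the coordinates of an ultraproduct, without losing monicity. -/
theorem exists_monic_map_spec_eq (P : Polynomial (MvPolynomial σ R)) (hP : P.Monic) :
    ∃ p : Polynomial (MvPolynomial (R ⊕ σ) ℤ), p.Monic ∧ p.map (spec σ id) = P := by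
  obtain ⟨p, hp, -, hm⟩ := Polynomial.lifts_and_natDegree_eq_and_monic
    (f := spec σ (id : R → R)) (Polynomial.map_surjective _ spec_id_surjective P) hP
  exact ⟨p, hm, hp⟩

end Terms

/-! ### Models that are fields -/

section FieldModels

variable {L : FirstOrder.Language.{u, v}} {ι : Language.ring →ᴸ L}

theorem exists_formula_eval_eq_zero (ι : Language.ring →ᴸ L) {α : Type w'} (q : MvPolynomial α ℤ) :
    ∃ φ : L.Formula α, ∀ (M : Type w) [Field M] [L.Structure M], IsCompatible ι M →
      ∀ x : α → M, φ.Realize x ↔ MvPolynomial.eval₂Hom (Int.castRingHom M) x q = 0 := by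
  obtain ⟨t, ht⟩ := exists_term_eq_eval ι q
  refine ⟨t.equal (Constants.term (ι.onFunction Ring.zeroFunc)), fun M _ _ hM x => ?_⟩
  rw [Formula.realize_equal, ht M hM, Term.realize_constants]
  exact Eq.congr_right (hM.zero _)

/-- Embeddings of fields as structures are ring homomorphisms. -/
def IsCompatible.ringHom {M N : Type*} [Field M] [Field N] [L.Structure M] [L.Structure N]
    (hM : IsCompatible ι M) (hN : IsCompatible ι N) (f : M ↪[L] N) : M →+* N where
  toFun := f
  map_zero' := by
    have := f.map_fun (ι.onFunction Ring.zeroFunc) ![]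
    rwa [hM.zero, hN.zero] at this
  map_one' := by
    have := f.map_fun (ι.onFunction Ring.oneFunc) ![]
    rwa [hM.one, hN.one] at this
  map_add' x y := by
    have := f.map_fun (ι.onFunction Ring.addFunc) ![x, y]
    rwa [hM.add, hN.add] at this
  map_mul' x y := by
    have := f.map_fun (ι.onFunction Ring.mulFunc) ![x, y]
    rwa [hM.mul, hN.mul] at this

/-- The language `L` consists of the ring symbols and constants. -/
structure IsRingWithConstants (ι : Language.ring →ᴸ L) : Prop where
  rel : ∀ n, IsEmpty (L.Relations n)
  func : ∀ n (f : L.Functions n), n = 0 ∨ ∃ f', ι.onFunction f' = f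

/-- Ring homomorphisms that preserve the constants are embeddings. -/
def IsRingWithConstants.embedding (hι : IsRingWithConstants ι) {M N : Type*} [Field M] [Field N]
    [L.Structure M] [L.Structure N] (hM : IsCompatible ι M) (hN : IsCompatible ι N) (g : M →+* N)
    (hg : ∀ c : L.Constants, g (c : M) = (c : N)) : M ↪[L] N where
  toFun := g
  inj' := g.injective
  map_fun' {n} f x := by
    rcases hι.func n f with rfl | ⟨f', rfl⟩
    · have := hg f
      rw [Subsingleton.elim (g ∘ x) default, Subsingleton.elim x default]
      exact this
    · cases f' with
      | add => rw [hM.add, hN.add, map_add]; rfl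
      | mul => rw [hM.mul, hN.mul, map_mul]; rfl
      | neg => rw [hM.neg, hN.neg, map_neg]; rfl
      | zero => rw [hM.zero, hN.zero, map_zero]
      | one => rw [hM.one, hN.one, map_one]
  map_rel' {n} r := ((hι.rel n).false r).elim

/-- A point of a hypersurface over `M` that is generic over `M`, in an elementary extension. -/
theorem exists_elementaryExtension_generic {M : Type (max u v)} [Field M] [L.Structure M]
    (hM : IsCompatible ι M) (hlc : IsLaurentClosed M) {κ σ : Type (max u v)} [Finite σ] (a : κ → M)
    (p : Polynomial (MvPolynomial (κ ⊕ σ) ℤ)) (hp : p.Monic) (x₀ : σ → M) (y₀ : M)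
    (h₀ : biEval (Int.castRingHom M) (Sum.elim a x₀) y₀ p = 0)
    (h₁ : biEval (Int.castRingHom M) (Sum.elim a x₀) y₀ (Polynomial.derivative p) ≠ 0) :
    ∃ (N : Type (max u v)) (_ : L.Structure N) (e : M ↪ₑ[L] N) (x : σ → N) (y : N),
      ∀ (_ : Field N), IsCompatible ι N →
        biEval (Int.castRingHom N) (Sum.elim (e ∘ a) x) y p = 0 ∧
        ∀ q : MvPolynomial (κ ⊕ σ) ℤ, spec σ a q ≠ 0 →
          MvPolynomial.eval₂Hom (Int.castRingHom N) (Sum.elim (e ∘ a) x) q ≠ 0 := by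
  classical
  obtain ⟨ψ, hψ⟩ := exists_formula_eval_eq_zero.{u, v, max u v} ι (flatten p)
  choose φ hφ using fun q : MvPolynomial (κ ⊕ σ) ℤ =>
    exists_formula_eval_eq_zero.{u, v, max u v} ι q
  let ψ' : L.Formula (M ⊕ (σ ⊕ Bool)) :=
    ψ.relabel (Sum.elim (Sum.map a Sum.inl) (Sum.inr ∘ Sum.inr))
  let φ' (q : MvPolynomial (κ ⊕ σ) ℤ) : L.Formula (M ⊕ (σ ⊕ Bool)) :=
    ((φ q).relabel (Sum.map a Sum.inl)).not
  have hψ' (N : Type (max u v)) [Field N] [L.Structure N] (hN : IsCompatible ι N) (e : M → N)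
      (z : σ ⊕ Bool → N) : ψ'.Realize (Sum.elim e z) ↔
        biEval (Int.castRingHom N) (Sum.elim (e ∘ a) (z ∘ Sum.inl)) (z (Sum.inr true)) p = 0 := by
    rw [Formula.realize_relabel, hψ N hN, eval₂Hom_flatten]
    refine Eq.to_iff (congrArg (· = 0) ?_)
    congr 2
    ext (i | i) <;> rfl
  have hφ' (N : Type (max u v)) [Field N] [L.Structure N] (hN : IsCompatible ι N) (e : M → N)
      (z : σ ⊕ Bool → N) (q : MvPolynomial (κ ⊕ σ) ℤ) : (φ' q).Realize (Sum.elim e z) ↔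
        MvPolynomial.eval₂Hom (Int.castRingHom N) (Sum.elim (e ∘ a) (z ∘ Sum.inl)) q ≠ 0 := by
    rw [Formula.realize_not, Formula.realize_relabel, hφ q N hN]
    refine not_congr (Eq.to_iff (congrArg (· = 0) ?_))
    congr 2
    ext (i | i) <;> rfl
  have hP (x : σ → M) (y : M) (p : Polynomial (MvPolynomial (κ ⊕ σ) ℤ)) :
      biEval (RingHom.id M) x y (p.map (spec σ a)) =
        biEval (Int.castRingHom M) (Sum.elim a x) y p := biEval_map_spec _ _ _ _ _
  obtain ⟨N, _, e, z, hz⟩ := exists_elementaryExtension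
    ({ψ'} ∪ φ' '' {q | spec σ a q ≠ 0}) fun Γ₀ hΓ₀ => by
      -- On the hypersurface each formula follows from the nonvanishing of one nonzero polynomial;
      -- their product Q is avoided by a point supplied by the smooth point.
      have key : ∀ γ ∈ Γ₀, ∃ Q : MvPolynomial σ M, Q ≠ 0 ∧ ∀ x y,
          biEval (Int.castRingHom M) (Sum.elim a x) y p = 0 → MvPolynomial.eval x Q ≠ 0 →
          γ.Realize (Sum.elim id (Sum.elim x fun _ => y)) := by
        intro γ hγ
        rcases hΓ₀ hγ with rfl | ⟨q, hq, rfl⟩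
        · exact ⟨1, one_ne_zero, fun x y h _ => (hψ' M hM _ _).2 h⟩
        · refine ⟨spec σ a q, hq, fun x y _ h => (hφ' M hM _ _ q).2 ?_⟩
          rw [← MvPolynomial.eval₂_id, ← MvPolynomial.coe_eval₂Hom, eval₂Hom_spec] at h
          exact h
      choose! Q hQ hQ' using key
      obtain ⟨x, y, hxy, hQx⟩ := hlc.exists_generic_point (p.map (spec σ a)) (hp.map _) x₀ y₀
        ((hP _ _ _).trans h₀) (by rw [Polynomial.derivative_map, hP]; exact h₁) (∏ γ ∈ Γ₀, Q γ)
        (Finset.prod_ne_zero_iff.2 hQ)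
      rw [map_prod, Finset.prod_ne_zero_iff] at hQx
      exact ⟨Sum.elim x fun _ => y, fun γ hγ => hQ' γ hγ x y ((hP _ _ _).symm.trans hxy) (hQx γ hγ)⟩
  refine ⟨N, inferInstance, e, z ∘ Sum.inl, z (Sum.inr true), fun _ hN => ⟨?_, fun q hq => ?_⟩⟩
  · exact (hψ' N hN e z).1 (hz _ (Or.inl rfl))
  · exact (hφ' N hN e z q).1 (hz _ (Or.inr ⟨q, hq, rfl⟩))

end FieldModels

/-! ### Formulas are preserved by ring homomorphisms from large finitely generated subrings -/

section Preservation

variable {L : FirstOrder.Language.{u, v}} {ι : Language.ring →ᴸ L}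

/-- The condition `ψ` on maps from `N` to models of `T` holds for all homomorphisms that are defined
over `K` on a subring of `N` that contains the set `S`. -/
def IsPreserved (ι : Language.ring →ᴸ L) (T : L.Theory) {K N : Type w} [Field K] [Field N]
    [L.Structure K] [L.Structure N] (e : K ↪ₑ[L] N) (S : Set N)
    (ψ : ∀ (M : Type w) [L.Structure M], (N → M) → Prop) : Prop :=
  ∀ (M : Type w) [Field M] [L.Structure M] [M ⊨ T], IsCompatible ι M → ∀ (j : K ↪ₑ[L] M)
    (E : Type w) [CommRing E] (i : E →+* N) (c : K → E) (g : E →+* M), Function.Injective i →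
      S ⊆ Set.range i → (∀ a, i (c a) = e a) → (∀ a, g (c a) = j a) →
        ψ M (Function.extend i g 0)

theorem IsPreserved.mono {T : L.Theory} {K N : Type w} [Field K] [Field N] [L.Structure K]
    [L.Structure N] {e : K ↪ₑ[L] N} {S S' : Set N}
    {ψ : ∀ (M : Type w) [L.Structure M], (N → M) → Prop} (h : IsPreserved ι T e S ψ)
    (hS : S ⊆ S') : IsPreserved ι T e S' ψ :=
  fun M _ _ _ hM j E _ i c g hi hS' hc hg => h M hM j E i c g hi (hS.trans hS') hc hg

/-- Compactness with model completeness. If no finite S worked, T would be consistent with the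
failure of φ and all integral polynomial relations and values of constants in N. A model of this
gives a ring homomorphism from N that respects constants, hence an embedding of models of T, which
is elementary and preserves φ. -/
theorem exists_isPreserved (hι : IsRingWithConstants ι) {T : L.Theory}
    (hmc : IsModelComplete.{u, v, max u v} T) (hF : ModelsAreFields.{u, v, max u v} ι T fun _ _ => True)
    {K N : Type (max u v)} [Field K] [Field N] [L.Structure K] [L.Structure N] [N ⊨ T]
    (hN : IsCompatible ι N) (e : K ↪ₑ[L] N) (φ : L.Formula N) (hφ : φ.Realize id) :
    ∃ S : Finset N, IsPreserved.{u, v, max u v} ι T e S fun _ _ g => φ.Realize g := by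
  classical
  by_contra! H
  choose ρ hρ using fun q : MvPolynomial N ℤ => exists_formula_eval_eq_zero.{u, v, max u v} ι q
  let ε (c : L.Constants) : L.Formula N := (Term.var (c : N)).equal (Constants.term c)
  obtain ⟨M, _, _, _, g, hg⟩ := exists_realize_of_finite (T := T)
    (({φ.not} ∪ ρ '' {q | MvPolynomial.eval₂Hom (Int.castRingHom N) id q = 0}) ∪ Set.range ε)
    fun Γ₀ hΓ₀ => by
      have key : ∀ γ ∈ Γ₀, γ ≠ φ.not →
          ∃ S : Finset N, IsPreserved.{u, v, max u v} ι T e S fun _ _ g => γ.Realize g := by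
        intro γ hγ hne
        rcases hΓ₀ hγ with (rfl | ⟨q, hq, rfl⟩) | ⟨c, rfl⟩
        · exact absurd rfl hne
        · refine ⟨q.vars, fun M _ _ _ hM j E _ i c g hi hS hc hg => (hρ q M hM _).2 ?_⟩
          have hx : ∀ n : N, ∃ x : E, n ∈ q.vars → i x = n := fun n => by
            by_cases hn : n ∈ q.vars
            · obtain ⟨x, hx⟩ := hS hn
              exact ⟨x, fun _ => hx⟩
            · exact ⟨0, fun h => absurd h hn⟩
          choose x hx using hx
          have h1 : MvPolynomial.eval₂Hom (Int.castRingHom N) id q =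
              i (MvPolynomial.eval₂Hom (Int.castRingHom E) x q) := by
            rw [← RingHom.comp_apply, MvPolynomial.comp_eval₂Hom]
            exact MvPolynomial.eval₂Hom_congr' (Subsingleton.elim _ _)
              (fun n hn _ => (hx n hn).symm) rfl
          have h2 : MvPolynomial.eval₂Hom (Int.castRingHom M) (Function.extend i g 0) q =
              g (MvPolynomial.eval₂Hom (Int.castRingHom E) x q) := by
            rw [← RingHom.comp_apply, MvPolynomial.comp_eval₂Hom]
            refine MvPolynomial.eval₂Hom_congr' (Subsingleton.elim _ _) (fun n hn _ => ?_) rfl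
            conv_lhs => rw [← hx n hn]
            exact hi.extend_apply _ _ _
          rw [h2, (map_eq_zero_iff i hi).1 (h1.symm.trans hq), map_zero]
        -- Constants have their values in K, over which the homomorphism is already fixed.
        · refine ⟨∅, fun M _ _ _ hM j E _ i c' g hi hS hc hg => ?_⟩
          change (ε c).Realize _
          rw [Formula.realize_equal, Term.realize_var, Term.realize_constants,
            ← Embedding.map_constants e.toEmbedding, ElementaryEmbedding.coe_toEmbedding, ← hc,
            hi.extend_apply, hg]
          exact Embedding.map_constants j.toEmbedding c
      choose! S hS using key
      -- A homomorphism that is defined on the union of these sets and falsifies φ satisfies all of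
      -- Γ₀.
      have := H (Γ₀.biUnion S)
      simp only [IsPreserved, not_forall] at this
      obtain ⟨M, _, _, _, hM, j, E, _, i, c, g, hi, hES, hc, hg, hn⟩ := this
      refine ⟨M, inferInstance, ⟨0⟩, inferInstance, Function.extend i g 0, fun γ hγ => ?_⟩
      by_cases hne : γ = φ.not
      · rw [hne]
        exact hn
      · exact (hS γ hγ hne).mono (by
          exact_mod_cast Finset.subset_biUnion_of_mem S hγ) M hM j E i c g hi hES hc hg
  obtain ⟨_, hM, -⟩ := hF M
  have hring (q : MvPolynomial N ℤ) (hq : MvPolynomial.eval₂Hom (Int.castRingHom N) id q = 0) :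
      MvPolynomial.eval₂Hom (Int.castRingHom M) g q = 0 :=
    (hρ q M hM g).1 (hg _ (Or.inl (Or.inr ⟨q, hq, rfl⟩)))
  have hone : g 1 = 1 := by
    have := hring (MvPolynomial.X 1 - 1) (by simp)
    simpa [sub_eq_zero] using this
  have hadd (a b : N) : g (a + b) = g a + g b := by
    have := hring (MvPolynomial.X (a + b) - (MvPolynomial.X a + MvPolynomial.X b)) (by simp)
    simpa [sub_eq_zero] using this
  have hmul (a b : N) : g (a * b) = g a * g b := by
    have := hring (MvPolynomial.X (a * b) - (MvPolynomial.X a * MvPolynomial.X b)) (by simp)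
    simpa [sub_eq_zero] using this
  let f : N →+* M := RingHom.mk' ⟨⟨g, hone⟩, hmul⟩ hadd
  let f' : N ↪[L] M := hι.embedding hN hM f fun c => by
    have := hg _ (Or.inr ⟨c, rfl⟩)
    rwa [Formula.realize_equal, Term.realize_var, Term.realize_constants] at this
  have h1 := (hmc.elementary f').map_formula φ id
  exact (hg _ (Or.inl (Or.inl rfl))) (h1.2 hφ)

end Preservation

/-! ### Elimination of `∃^∞` in theories of fields -/

section Ultraproducts

open Filter

variable {L : FirstOrder.Language.{u, v}} {M N : ℕ → Type w} (𝒰 : Ultrafilter ℕ)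

/-- The class of a sequence in an ultraproduct. -/
def ultraMk (x : ∀ k, M k) : (𝒰 : Filter ℕ).Product M := Quotient.mk _ x

theorem exists_eq_ultraMk (x : (𝒰 : Filter ℕ).Product M) : ∃ y : ∀ k, M k, ultraMk 𝒰 y = x :=
  Quotient.exists_rep x

theorem ultraMk_eq_iff (x y : ∀ k, M k) : ultraMk 𝒰 x = ultraMk 𝒰 y ↔ ∀ᶠ k in 𝒰, x k = y k :=
  Quotient.eq''

section

variable [∀ k, L.Structure (M k)] [∀ k, Nonempty (M k)]

theorem realize_ultraMk {α : Type w'} (φ : L.Formula α) (x : α → ∀ k, M k) :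
    φ.Realize (fun i => ultraMk 𝒰 (x i)) ↔ ∀ᶠ k in 𝒰, φ.Realize fun i => x i k :=
  Ultraproduct.realize_formula_cast φ x

theorem exists_ultraMap [∀ k, L.Structure (N k)] [∀ k, Nonempty (N k)] (e : ∀ k, M k ↪ₑ[L] N k) :
    ∃ j : (𝒰 : Filter ℕ).Product M ↪ₑ[L] (𝒰 : Filter ℕ).Product N,
      ∀ x, j (ultraMk 𝒰 x) = ultraMk 𝒰 fun k => e k (x k) := by
  let j : (𝒰 : Filter ℕ).Product M → (𝒰 : Filter ℕ).Product N :=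
    Quotient.map (fun x k => e k (x k)) fun _ _ h => h.mono fun k hk => congr_arg (e k) hk
  refine ⟨elementaryOfRealize j fun n φ x hx => ?_, fun x => rfl⟩
  choose y hy using fun i => exists_eq_ultraMk 𝒰 (x i)
  obtain rfl : (fun i => ultraMk 𝒰 (y i)) = x := funext hy
  rw [realize_ultraMk] at hx
  refine (realize_ultraMk 𝒰 φ fun i k => e k (y i k)).2 (hx.mono fun k hk => ?_)
  exact ((e k).map_formula φ fun i => y i k).2 hk

theorem model_ultraproduct {T : L.Theory} (h : ∀ k, M k ⊨ T) : (𝒰 : Filter ℕ).Product M ⊨ T :=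
  ⟨fun σ hσ => (Ultraproduct.sentence_realize σ).2
    (Eventually.of_forall fun k => (h k).realize_of_mem σ hσ)⟩

variable {ι : Language.ring →ᴸ L} [∀ k, Field (M k)] [Field ((𝒰 : Filter ℕ).Product M)]

/-- Vanishing of an integral polynomial is an L-formula, so Łoś's theorem applies for any compatible
field structure on the ultraproduct. -/
theorem eval_ultraMk_eq_zero_iff (hM : ∀ k, IsCompatible ι (M k))
    (h𝒰 : IsCompatible ι ((𝒰 : Filter ℕ).Product M)) {α : Type w'} (q : MvPolynomial α ℤ)
    (x : α → ∀ k, M k) :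
    MvPolynomial.eval₂Hom (Int.castRingHom ((𝒰 : Filter ℕ).Product M))
      (fun i => ultraMk 𝒰 (x i)) q = 0 ↔
      ∀ᶠ k in 𝒰, MvPolynomial.eval₂Hom (Int.castRingHom (M k)) (fun i => x i k) q = 0 := by
  obtain ⟨φ, hφ⟩ := exists_formula_eval_eq_zero.{u, v, w} ι q
  rw [← hφ _ h𝒰, realize_ultraMk]
  simp only [fun k => hφ (M k) (hM k)]

theorem biEval_ultraMk_eq_zero_iff (hM : ∀ k, IsCompatible ι (M k))
    (h𝒰 : IsCompatible ι ((𝒰 : Filter ℕ).Product M)) {α : Type w'}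
    (p : Polynomial (MvPolynomial α ℤ)) (x : α → ∀ k, M k) (y : ∀ k, M k) :
    biEval (Int.castRingHom ((𝒰 : Filter ℕ).Product M)) (fun i => ultraMk 𝒰 (x i))
      (ultraMk 𝒰 y) p = 0 ↔
      ∀ᶠ k in 𝒰, biEval (Int.castRingHom (M k)) (fun i => x i k) (y k) p = 0 := by
  have := eval_ultraMk_eq_zero_iff 𝒰 hM h𝒰 (flatten p) (Sum.elim x fun _ => y)
  simp only [eval₂Hom_flatten] at this
  exact this

end

end Ultraproducts

/-! ### Counting realisations and descending smooth points -/

section Elimination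

open Filter

variable {L : FirstOrder.Language.{u, v}} {ι : Language.ring →ᴸ L} {T : L.Theory}

theorem exists_atLeast_formula {m : ℕ} (φ : L.Formula (Unit ⊕ Fin m)) (k : ℕ) :
    ∃ θ : L.Formula (Fin m), ∀ (M : Type w) [L.Structure M] [Nonempty M] (b : Fin m → M),
      θ.Realize b ↔ ∃ x : Fin k → M, Function.Injective x ∧
        ∀ i, φ.Realize (Sum.elim (fun _ => x i) b) := by
  have U : UDef.{u, v, w} (∅ : L.Theory) fun M _ (b : Fin m → M) =>
      ∃ x : Fin k → M, (∀ i j, x i = x j → i = j) ∧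
        ∀ i, φ.Realize (Sum.elim (fun _ => x i) b) := by
    refine UDef.exists_tuple (P := fun M _ c => (∀ i j, c (Sum.inr i) = c (Sum.inr j) → i = j) ∧
        ∀ i, φ.Realize (Sum.elim (fun _ => c (Sum.inr i)) (c ∘ Sum.inl))) (UDef.and ?_ ?_)
    · refine UDef.finite_forall fun i => UDef.finite_forall fun j => ?_
      by_cases hij : i = j
      · exact (UDef.formula ⊤).of_iff fun M _ _ _ b => by simp [hij]
      · exact (UDef.equal (.var (Sum.inr i)) (.var (Sum.inr j))).not.of_iff
          fun M _ _ _ b => by simp [hij]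
    · refine UDef.finite_forall fun i => ?_
      refine ((UDef.formula φ).comp (Sum.elim (fun _ => Sum.inr i) Sum.inl)).of_iff
        fun M _ _ _ c => ?_
      rw [Sum.comp_elim]
      rfl
  obtain ⟨θ, hθ⟩ := U
  exact ⟨θ, fun M _ _ b => hθ M b⟩

theorem infinite_iff_forall_exists_injective {X : Type*} {s : Set X} :
    s.Infinite ↔ ∀ k : ℕ, ∃ x : Fin k → X, Function.Injective x ∧ ∀ i, x i ∈ s := by
  constructor
  · intro h k
    have := h.to_subtype
    refine ⟨fun i => (Infinite.natEmbedding s i.1).1, fun i j hij => ?_, fun i => Subtype.coe_prop _⟩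
    exact Fin.ext ((Infinite.natEmbedding s).injective (Subtype.ext hij))
  · intro h hs
    obtain ⟨x, hx, hxs⟩ := h (hs.toFinset.card + 1)
    have := Finset.card_le_card_of_injOn (s := Finset.univ) (t := hs.toFinset) x
      (fun i _ => hs.mem_toFinset.2 (hxs i)) hx.injOn
    simp at this

/-- The existence of such a point is a formula with parameters in K, so it descends along the
elementary embedding. -/
theorem exists_smooth_point {K N : Type w} [Field K] [Field N] [L.Structure K] [L.Structure N]
    (hK : IsCompatible ι K) (hN : IsCompatible ι N) (e : K ↪ₑ[L] N) {σ : Type w'} [Finite σ]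
    (p q : Polynomial (MvPolynomial (K ⊕ σ) ℤ)) (x : σ → N) (y : N)
    (hp : biEval (Int.castRingHom N) (Sum.elim e x) y p = 0)
    (hq : biEval (Int.castRingHom N) (Sum.elim e x) y q ≠ 0) :
    ∃ (x : σ → K) (y : K), biEval (Int.castRingHom K) (Sum.elim id x) y p = 0 ∧
      biEval (Int.castRingHom K) (Sum.elim id x) y q ≠ 0 := by
  obtain ⟨φ, hφ⟩ := exists_formula_eval_eq_zero.{u, v, w} ι (flatten p)
  obtain ⟨ψ, hψ⟩ := exists_formula_eval_eq_zero.{u, v, w} ι (flatten q)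
  let θ : L.Formula K := Formula.iExs (σ ⊕ Bool) ((φ ⊓ ψ.not).relabel (Equiv.sumAssoc K σ Bool))
  have hθ (M : Type w) [Field M] [L.Structure M] (hM : IsCompatible ι M) (f : K → M) :
      θ.Realize f ↔ ∃ z : σ ⊕ Bool → M,
        biEval (Int.castRingHom M) (Sum.elim f (z ∘ Sum.inl)) (z (Sum.inr true)) p = 0 ∧
        biEval (Int.castRingHom M) (Sum.elim f (z ∘ Sum.inl)) (z (Sum.inr true)) q ≠ 0 := by
    rw [Formula.realize_iExs]
    refine exists_congr fun z => ?_
    rw [Formula.realize_relabel, Formula.realize_inf, Formula.realize_not, hφ M hM, hψ M hM,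
      eval₂Hom_flatten, eval₂Hom_flatten]
    have : (Sum.elim f z ∘ Equiv.sumAssoc K σ Bool) ∘ Sum.inl = Sum.elim f (z ∘ Sum.inl) := by
      ext (i | i) <;> rfl
    rw [this]
    rfl
  have h1 : θ.Realize (e ∘ id) := (hθ N hN _).2 ⟨Sum.elim x fun _ => y, hp, hq⟩
  obtain ⟨z, hz⟩ := (hθ K hK _).1 ((e.map_formula θ id).1 h1)
  exact ⟨_, _, hz⟩

end Elimination

/-! ### Specialisation into ultraproducts -/

section Specialization

open Filter

variable {L : FirstOrder.Language.{u, v}} {ι : Language.ring →ᴸ L} {T : L.Theory}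

/-- A finitely generated subextension of an elementary extension of an ultraproduct `K` of the
fields `M k` embeds over `K` in an ultraproduct of elementary extensions of the `M k`. -/
theorem exists_ringHom_ultraproduct
    (hF : ModelsAreFields.{u, v, max u v} ι T fun K _ => PerfectField K ∧ IsLaurentClosed K)
    {M : ℕ → Type (max u v)} [∀ k, L.Structure (M k)] [∀ k, Nonempty (M k)] (hT : ∀ k, M k ⊨ T)
    (𝒰 : Ultrafilter ℕ) [Field ((𝒰 : Filter ℕ).Product M)]
    (hK : IsCompatible ι ((𝒰 : Filter ℕ).Product M)) [PerfectField ((𝒰 : Filter ℕ).Product M)]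
    [Infinite ((𝒰 : Filter ℕ).Product M)] {N : Type (max u v)} [Field N] [L.Structure N]
    (hN : IsCompatible ι N) (e : (𝒰 : Filter ℕ).Product M ↪ₑ[L] N) (E : Type (max u v)) [Field E]
    [Algebra ((𝒰 : Filter ℕ).Product M) E] [Algebra.EssFiniteType ((𝒰 : Filter ℕ).Product M) E]
    (i : E →+* N) (hi : ∀ a, i (algebraMap _ E a) = e a) :
    ∃ (M' : ℕ → Type (max u v)) (_ : ∀ k, L.Structure (M' k)) (_ : ∀ k, Nonempty (M' k))
      (e' : ∀ k, M k ↪ₑ[L] M' k), ∀ (_ : Field ((𝒰 : Filter ℕ).Product M')),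
        IsCompatible ι ((𝒰 : Filter ℕ).Product M') →
          ∀ j : (𝒰 : Filter ℕ).Product M ↪ₑ[L] (𝒰 : Filter ℕ).Product M',
            (∀ x, j (ultraMk 𝒰 x) = ultraMk 𝒰 fun k => e' k (x k)) →
              ∃ g : E →+* (𝒰 : Filter ℕ).Product M', ∀ a, g (algebraMap _ E a) = j a := by
  classical
  choose fM hM hP using fun k => hF (M k)
  obtain ⟨s, P, y, hPm, hP0, hP1, hext⟩ := exists_smooth_presentation ((𝒰 : Filter ℕ).Product M) E
  obtain ⟨p, hp, rfl⟩ := exists_monic_map_spec_eq P hPm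
  have val (q : Polynomial (MvPolynomial (((𝒰 : Filter ℕ).Product M) ⊕ s) ℤ)) :
      i (biEval (algebraMap _ E) Subtype.val y (q.map (spec s id))) =
        biEval (Int.castRingHom N) (Sum.elim e (i ∘ Subtype.val)) (i y) q := by
    rw [biEval_map_spec, map_biEval]
    rw [Sum.comp_elim, Function.comp_id, show i ∘ algebraMap _ E = e from funext hi,
      Subsingleton.elim (i.comp (Int.castRingHom E)) (Int.castRingHom N)]
  -- The generating point of E is smooth and lies in N through i, so K has a smooth point on the
  -- same hypersurface.
  obtain ⟨x₀, y₀, h0, h1⟩ := exists_smooth_point hK hN e p (Polynomial.derivative p)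
    (i ∘ Subtype.val) (i y) (by rw [← val, hP0, map_zero]) (by
      rw [← val, ← Polynomial.derivative_map, Ne, map_eq_zero_iff i i.injective]
      exact hP1)
  choose a ha using exists_eq_ultraMk (M := M) 𝒰
  choose x₁ hx₁ using fun i => exists_eq_ultraMk 𝒰 (x₀ i)
  obtain ⟨y₁, rfl⟩ := exists_eq_ultraMk 𝒰 y₀
  have hv : Sum.elim id x₀ = fun i => ultraMk 𝒰 (Sum.elim a x₁ i) := by
    ext (b | b)
    · exact (ha b).symm
    · exact (hx₁ b).symm
  rw [hv] at h0 h1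
  rw [biEval_ultraMk_eq_zero_iff 𝒰 hM hK] at h0
  rw [Ne, biEval_ultraMk_eq_zero_iff 𝒰 hM hK, ← Ultrafilter.eventually_not] at h1
  have hv' (k : ℕ) : (fun i => Sum.elim a x₁ i k) = Sum.elim (fun b => a b k) (fun b => x₁ b k) := by
    ext (b | b) <;> rfl
  -- Where the k-th coordinates form a smooth point, a generic point exists in an elementary
  -- extension of M k; on the negligible set of other k, M k itself serves as a default.
  have key (k : ℕ) : ∃ (N : Type (max u v)) (_ : L.Structure N) (e : M k ↪ₑ[L] N) (x : s → N)
      (y : N), biEval (Int.castRingHom (M k)) (fun i => Sum.elim a x₁ i k) (y₁ k) p = 0 →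
      biEval (Int.castRingHom (M k)) (fun i => Sum.elim a x₁ i k) (y₁ k)
        (Polynomial.derivative p) ≠ 0 → ∀ (_ : Field N), IsCompatible ι N →
        biEval (Int.castRingHom N) (Sum.elim (fun b => e (a b k)) x) y p = 0 ∧
        ∀ q, spec s (fun b => a b k) q ≠ 0 →
          MvPolynomial.eval₂Hom (Int.castRingHom N) (Sum.elim (fun b => e (a b k)) x) q ≠ 0 := by
    by_cases h : biEval (Int.castRingHom (M k)) (fun i => Sum.elim a x₁ i k) (y₁ k) p = 0 ∧
      biEval (Int.castRingHom (M k)) (fun i => Sum.elim a x₁ i k) (y₁ k)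
        (Polynomial.derivative p) ≠ 0
    · rw [hv'] at h
      obtain ⟨N, sN, e, x, y, H⟩ := exists_elementaryExtension_generic (hM k) (hP k).2
        (fun b => a b k) p hp _ _ h.1 h.2
      exact ⟨N, sN, e, x, y, fun _ _ => H⟩
    · exact ⟨M k, inferInstance, ElementaryEmbedding.refl L _, fun b => x₁ b k, y₁ k,
        fun h' h'' => absurd ⟨h', h''⟩ h⟩
  choose M' sM' e' x y hxy using key
  have nM' (k : ℕ) : Nonempty (M' k) := Nonempty.map (e' k) inferInstance
  have hT' (k : ℕ) : M' k ⊨ T := ((e' k).theory_model_iff T).1 inferInstance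
  choose fM' hM' _ using fun k => hF (M' k)
  have hxy : ∀ᶠ k in 𝒰,
      biEval (Int.castRingHom (M' k)) (Sum.elim (fun b => e' k (a b k)) (x k)) (y k) p = 0 ∧
        ∀ q, spec s (fun b => a b k) q ≠ 0 → MvPolynomial.eval₂Hom (Int.castRingHom (M' k))
          (Sum.elim (fun b => e' k (a b k)) (x k)) q ≠ 0 := by
    filter_upwards [h0, h1] with k h0 h1
    exact hxy k h0 h1 (fM' k) (hM' k)
  refine ⟨M', sM', nM', e', fun _ hK' j hj => ?_⟩
  let _ : Algebra ((𝒰 : Filter ℕ).Product M) ((𝒰 : Filter ℕ).Product M') :=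
    (hK.ringHom hK' j.toEmbedding).toAlgebra
  have halg (b) : algebraMap ((𝒰 : Filter ℕ).Product M) ((𝒰 : Filter ℕ).Product M') b = j b := rfl
  have hjv : Sum.elim (algebraMap ((𝒰 : Filter ℕ).Product M) ((𝒰 : Filter ℕ).Product M') ∘ id)
      (fun b => ultraMk 𝒰 fun k => x k b) =
        fun c => ultraMk 𝒰 (Sum.elim (fun b k => e' k (a b k)) (fun b k => x k b) c) := by
    ext (b | b)
    · change j b = _
      conv_lhs => rw [← ha b]
      exact hj (a b)
    · rfl
  have hjv' (k : ℕ) : (fun c => Sum.elim (fun b k => e' k (a b k)) (fun b k => x k b) c k) =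
      Sum.elim (fun b => e' k (a b k)) (x k) := by
    ext (b | b) <;> rfl
  obtain ⟨g⟩ := hext ((𝒰 : Filter ℕ).Product M') (fun b => ultraMk 𝒰 fun k => x k b)
    (ultraMk 𝒰 y) (by
      rw [algebraicIndependent_iff]
      intro Q hQ
      by_contra hQ0
      obtain ⟨q, rfl⟩ := spec_id_surjective Q
      -- K is infinite, so a nonzero polynomial over K is nonzero at some K-point. Its
      -- specialisations are then nonzero at almost all k, and the generic points of the coordinates
      -- cannot be zeros of them.
      obtain ⟨w, hw⟩ : ∃ w, MvPolynomial.eval w (spec s id q) ≠ 0 := by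
        by_contra! H
        exact hQ0 (MvPolynomial.funext fun x => by rw [H, map_zero])
      choose w' hw' using fun i => exists_eq_ultraMk 𝒰 (w i)
      have e1 : Sum.elim id w = fun i => ultraMk 𝒰 (Sum.elim a w' i) := by
        ext (b | b)
        · exact (ha b).symm
        · exact (hw' b).symm
      have e2 (k : ℕ) : (fun i => Sum.elim a w' i k) =
          Sum.elim (fun b => a b k) (fun b => w' b k) := by
        ext (b | b) <;> rfl
      rw [← MvPolynomial.eval₂_id, ← MvPolynomial.coe_eval₂Hom, eval₂Hom_spec, RingHom.coe_id,
        Function.id_comp, e1, Ne, eval_ultraMk_eq_zero_iff 𝒰 hM hK,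
        ← Ultrafilter.eventually_not] at hw
      have hQ' : MvPolynomial.eval₂Hom
        (algebraMap ((𝒰 : Filter ℕ).Product M) ((𝒰 : Filter ℕ).Product M'))
        (fun b => ultraMk 𝒰 fun k => x k b) (spec s id q) = 0 := hQ
      rw [eval₂Hom_spec, hjv, eval_ultraMk_eq_zero_iff 𝒰 hM' hK'] at hQ'
      obtain ⟨k, hk1, hk2, hk3⟩ := (hw.and (hQ'.and hxy)).exists
      rw [hjv'] at hk2
      refine hk3.2 q (fun h => hk1 ?_) hk2
      have := eval₂Hom_spec (RingHom.id (M k)) (fun b => w' b k) (fun b => a b k) q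
      rw [h, map_zero] at this
      rw [e2]
      exact this.symm)
    (by
      rw [biEval_map_spec, hjv, biEval_ultraMk_eq_zero_iff 𝒰 hM' hK']
      refine hxy.mono fun k hk => ?_
      rw [hjv']
      exact hk.1)
  exact ⟨g, fun b => (g.commutes b).trans (halg b)⟩

end Specialization

/-! ### Uniform finiteness for fields by ultraproducts -/

section FieldElimination

open Filter

variable {L : FirstOrder.Language.{u, v}} {ι : Language.ring →ᴸ L} {T : L.Theory}

/-- A model complete theory of perfect fields that are existentially closed in their fields of
Laurent series, in the language of rings with constants, eliminates `∃^∞`. -/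
theorem eliminatesExistsInfinity_of_fields (hι : IsRingWithConstants ι)
    (hmc : IsModelComplete.{u, v, max u v} T)
    (hF : ModelsAreFields.{u, v, max u v} ι T fun K _ => PerfectField K ∧ IsLaurentClosed K) :
    EliminatesExistsInfinity.{u, v, max u v} T := by
  classical
  intro m φ
  choose θ hθ using exists_atLeast_formula.{u, v, max u v} φ
  by_contra! H
  -- "At least k realisations" follows from infinitely many, so if it does not define infinity, some
  -- finite solution set has at least k elements.
  have H (k : ℕ) : ∃ (M : Type (max u v)) (_ : L.Structure M) (_ : Nonempty M) (_ : M ⊨ T)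
      (b : Fin m → M), {t : M | φ.Realize (Sum.elim (fun _ => t) b)}.Finite ∧
        (θ k).Realize b := by
    obtain ⟨M, _, _, _, b, hb⟩ := H (θ k)
    refine ⟨M, inferInstance, inferInstance, inferInstance, b, ?_⟩
    rcases hb with ⟨h1, h2⟩ | ⟨h1, h2⟩
    · exact ⟨h2, h1⟩
    · exact absurd ((hθ k M b).2 (infinite_iff_forall_exists_injective.1 h2 k)) h1
  choose M sM nM hT b hfin hb using H
  let 𝒰 : Ultrafilter ℕ := hyperfilter ℕ
  have hKT : (𝒰 : Filter ℕ).Product M ⊨ T := model_ultraproduct 𝒰 hT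
  obtain ⟨_, hK, hKp, hKl⟩ := hF ((𝒰 : Filter ℕ).Product M)
  have := hKl.infinite
  let β : Fin m → (𝒰 : Filter ℕ).Product M := fun i => ultraMk 𝒰 fun k => b k i
  -- For each n almost all coordinates have at least n realisations, as 𝒰 contains the cofinite
  -- sets.
  have hinf : {t | φ.Realize (Sum.elim (fun _ => t) β)}.Infinite := by
    refine infinite_iff_forall_exists_injective.2 fun n => (hθ n _ β).1 ?_
    refine (realize_ultraMk 𝒰 (θ n) fun i k => b k i).2 ?_
    have hge : ∀ᶠ k in (𝒰 : Filter ℕ), n ≤ k :=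
      (Nat.hyperfilter_le_atTop) (eventually_ge_atTop n)
    refine hge.mono fun k hk => (hθ n _ _).2 ?_
    obtain ⟨x, hx, hx'⟩ := (hθ k _ _).1 (hb k)
    exact ⟨x ∘ Fin.castLE hk, hx.comp (Fin.castLE_injective hk), fun i => hx' _⟩
  obtain ⟨N, _, e, t, ht, hte⟩ := exists_new_realization φ β hinf
  have hNT : N ⊨ T := (e.theory_model_iff T).1 inferInstance
  have : Nonempty N := ⟨t⟩
  obtain ⟨_, hN, -⟩ := hF N
  let ψ : L.Formula N := φ.relabel (Sum.elim (fun _ => t) (e ∘ β))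
  obtain ⟨S, hS⟩ := exists_isPreserved hι hmc
    (fun M _ _ _ => (hF M).imp fun _ h => ⟨h.1, trivial⟩) hN e ψ (Formula.realize_relabel.2 ht)
  let _ : Algebra ((𝒰 : Filter ℕ).Product M) N := (hK.ringHom hN e.toEmbedding).toAlgebra
  -- E contains both t and the set S that guarantees φ(t, β) is preserved by homomorphisms over K.
  let E := IntermediateField.adjoin ((𝒰 : Filter ℕ).Product M) ((insert t S : Finset N) : Set N)
  have : Algebra.EssFiniteType ((𝒰 : Filter ℕ).Product M) E :=
    IntermediateField.essFiniteType_iff.2 ⟨_, rfl⟩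
  let i : E →+* N := E.val
  obtain ⟨M', _, _, e', H⟩ := exists_ringHom_ultraproduct hF hT 𝒰 hK hN e E i fun a => rfl
  have hT' (k : ℕ) : M' k ⊨ T := ((e' k).theory_model_iff T).1 inferInstance
  have hKT' : (𝒰 : Filter ℕ).Product M' ⊨ T := model_ultraproduct 𝒰 hT'
  obtain ⟨_, hK', -⟩ := hF ((𝒰 : Filter ℕ).Product M')
  obtain ⟨j, hj⟩ := exists_ultraMap 𝒰 e'
  obtain ⟨g, hg⟩ := H _ hK' j hj
  have hsub : ((insert t S : Finset N) : Set N) ⊆ E := IntermediateField.subset_adjoin _ _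
  have htE : t ∈ E := hsub (Finset.mem_insert_self t S)
  have key := hS _ hK' j E i (algebraMap _ E) g i.injective
    (fun s hs => ⟨⟨s, hsub (Finset.mem_insert_of_mem hs)⟩, rfl⟩) (fun a => rfl) hg
  have key : φ.Realize (Sum.elim (fun _ => g ⟨t, htE⟩) (j ∘ β)) := by
    have key := Formula.realize_relabel.1 key
    refine (congr_arg φ.Realize ?_).mp key
    ext (c | c)
    · exact i.injective.extend_apply g 0 ⟨t, htE⟩
    · exact (i.injective.extend_apply g 0 (algebraMap _ E (β c))).trans (hg _)
  obtain ⟨τ, hτ⟩ := exists_eq_ultraMk 𝒰 (g ⟨t, htE⟩)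
  have hv : Sum.elim (fun _ : Unit => g ⟨t, htE⟩) (j ∘ β) = fun c =>
      ultraMk 𝒰 ((Sum.elim (fun _ => τ) fun i k => e' k (b k i) : Unit ⊕ Fin m → ∀ k, M' k) c) := by
    ext (c | c)
    · exact hτ.symm
    · exact hj _
  rw [hv, realize_ultraMk] at key
  -- The k-th coordinate of the image of t realises φ in M' k for almost all k; the solution set in
  -- M k is finite, so the coordinate already lies in M k.
  have hr : ∀ᶠ k in (𝒰 : Filter ℕ), ∃ a, e' k a = τ k := by
    refine key.mono fun k hk => mem_range_of_finite (e' k) φ (b k) (hfin k) ?_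
    refine (congr_arg φ.Realize ?_).mp hk
    ext (c | c) <;> rfl
  have hr' (k : ℕ) : ∃ a, (∃ a, e' k a = τ k) → e' k a = τ k := by
    by_cases h : ∃ a, e' k a = τ k
    · exact ⟨h.choose, fun _ => h.choose_spec⟩
    · exact ⟨Classical.arbitrary _, fun h' => absurd h' h⟩
  choose a ha using hr'
  refine hte ⟨ultraMk 𝒰 a, ?_⟩
  have h1 : g (algebraMap _ E (ultraMk 𝒰 a)) = g ⟨t, htE⟩ := by
    rw [hg, hj, ← hτ, ultraMk_eq_iff]
    exact hr.mono fun k hk => ha k hk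
  exact congr_arg i (g.injective h1)

end FieldElimination

/-! ### Algebraically closed fields -/

section AlgebraicallyClosed

theorem isRingWithConstants_id : IsRingWithConstants (LHom.id Language.ring) where
  rel _ := inferInstanceAs (IsEmpty Empty)
  func _ f := Or.inr ⟨f, rfl⟩

theorem modelsAreFields_ACF (p : ℕ) [Fact p.Prime] :
    ModelsAreFields.{0, 0, w} (LHom.id Language.ring) (Theory.ACF p)
      fun K _ => CharP K p ∧ IsAlgClosed K := by
  intro K _ _ _
  let F := Field.fieldOfModelACF p K
  have := Field.modelField_of_modelACF p K
  let C : Ring.CompatibleRing K := Field.compatibleRingOfModelField K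
  refine ⟨F, ⟨?_, ?_, ?_, ?_, ?_⟩, Field.charP_of_model_fieldOfChar p K,
    Field.isAlgClosed_of_model_ACF p K⟩
  · exact C.funMap_zero
  · exact C.funMap_one
  · exact C.funMap_neg
  · exact C.funMap_add
  · exact C.funMap_mul

/-- Robinson's test: by the Nullstellensatz, finitely many polynomial relations over M realised in N
are realised in M, so compactness embeds N over M in an elementary extension of M. -/
theorem isModelComplete_ACF (p : ℕ) [Fact p.Prime] : IsModelComplete.{0, 0, 0} (Theory.ACF p) := by
  classical
  refine isModelComplete_of_complete_to_elementary fun M N _ _ _ _ _ _ f => ?_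
  obtain ⟨_, hM, _, _⟩ := modelsAreFields_ACF p M
  obtain ⟨_, hN, _⟩ := modelsAreFields_ACF p N
  let _ : Algebra M N := (hM.ringHom hN f).toAlgebra
  -- Elements of M occur both as parameters and through their images in N; the relations X_{f(a)} -
  -- X_a make the resulting map from N agree with `e` on M.
  choose ρ hρ using fun q : MvPolynomial (M ⊕ N) ℤ =>
    exists_formula_eval_eq_zero.{0, 0, 0} (LHom.id Language.ring) q
  obtain ⟨M', _, e, g, hg⟩ := exists_elementaryExtension
    (ρ '' {q | MvPolynomial.eval₂Hom (Int.castRingHom N) (Sum.elim f id) q = 0}) fun Γ₀ hΓ₀ => by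
      have key : ∀ γ ∈ Γ₀, ∃ q, MvPolynomial.eval₂Hom (Int.castRingHom N) (Sum.elim f id) q = 0 ∧
          ρ q = γ := fun γ hγ => hΓ₀ hγ
      choose! q hq hqγ using key
      let V : Finset (M ⊕ N) := Γ₀.biUnion fun γ => (q γ).vars
      let A := Algebra.adjoin M ((V.toRight : Finset N) : Set N)
      obtain ⟨h⟩ := exists_algHom_adjoin_of_isAlgClosed (K := M) (V.toRight : Finset N).finite_toSet
      let y (n : N) : A := if hn : n ∈ V.toRight then ⟨n, Algebra.subset_adjoin hn⟩ else 0
      have hy (n : N) (hn : Sum.inr n ∈ V) : (y n : N) = n := by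
        simp only [y, dif_pos (Finset.mem_toRight.2 hn)]
      refine ⟨fun n => h (y n), fun γ hγ => ?_⟩
      rw [← hqγ γ hγ, hρ _ M hM]
      have h1 : MvPolynomial.eval₂Hom (Int.castRingHom A) (Sum.elim (algebraMap M A) y) (q γ) = 0 := by
        apply Subtype.val_injective
        have := congr_arg (fun φ : _ →+* N => φ (q γ)) (MvPolynomial.comp_eval₂Hom
          (Int.castRingHom A) (Sum.elim (algebraMap M A) y) (A.val : A →+* N))
        refine this.trans (Eq.trans ?_ (hq γ hγ))
        refine MvPolynomial.eval₂Hom_congr' (Subsingleton.elim _ _) (fun n hn _ => ?_) rfl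
        rcases n with n | n
        · rfl
        · exact hy n (Finset.mem_biUnion.2 ⟨γ, hγ, hn⟩)
      have h2 := congr_arg (fun φ : _ →+* M => φ (q γ)) (MvPolynomial.comp_eval₂Hom
          (Int.castRingHom A) (Sum.elim (algebraMap M A) y) (h : A →+* M))
      rw [RingHom.comp_apply, h1, map_zero] at h2
      refine Eq.trans ?_ h2.symm
      refine MvPolynomial.eval₂Hom_congr' (Subsingleton.elim _ _) (fun n hn _ => ?_) rfl
      rcases n with n | n
      · exact (h.commutes n).symm
      · rfl
  have : M' ⊨ Theory.ACF p := (e.theory_model_iff _).1 inferInstance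
  have : Nonempty M' := Nonempty.map e inferInstance
  obtain ⟨_, hM', _⟩ := modelsAreFields_ACF p M'
  have hring (q : MvPolynomial (M ⊕ N) ℤ)
      (hq : MvPolynomial.eval₂Hom (Int.castRingHom N) (Sum.elim f id) q = 0) :
      MvPolynomial.eval₂Hom (Int.castRingHom M') (Sum.elim e g) q = 0 :=
    (hρ q M' hM' _).1 (hg _ ⟨q, hq, rfl⟩)
  have hone : g 1 = 1 := by
    have := hring (MvPolynomial.X (Sum.inr 1) - 1) (by simp)
    simpa [sub_eq_zero] using this
  have hadd (a b : N) : g (a + b) = g a + g b := by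
    have := hring (MvPolynomial.X (Sum.inr (a + b)) - (MvPolynomial.X (Sum.inr a) +
      MvPolynomial.X (Sum.inr b))) (by simp)
    simpa [sub_eq_zero] using this
  have hmul (a b : N) : g (a * b) = g a * g b := by
    have := hring (MvPolynomial.X (Sum.inr (a * b)) - (MvPolynomial.X (Sum.inr a) *
      MvPolynomial.X (Sum.inr b))) (by simp)
    simpa [sub_eq_zero] using this
  have hgf (a : M) : g (f a) = e a := by
    have := hring (MvPolynomial.X (Sum.inr (f a)) - MvPolynomial.X (Sum.inl a)) (by simp)
    simpa [sub_eq_zero] using this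
  let g' : N →+* M' := RingHom.mk' ⟨⟨g, hone⟩, hmul⟩ hadd
  refine ⟨M', inferInstance, isRingWithConstants_id.embedding hN hM' g' fun c => ?_, e, funext hgf⟩
  rw [← Embedding.map_constants f, ← Embedding.map_constants e.toEmbedding]
  exact hgf c

theorem exists_modelCompanion_ACF (p : ℕ) [Fact p.Prime] (n : ℕ) :
    ∃ TG : (Language.ring.sum (predLang n)).Theory, IsModelCompanion.{0, 0, 0} TG
      (additiveSubgroupTheory (LHom.id Language.ring) (Theory.ACF p) n) := by
  have h := modelsAreFields_ACF.{0} p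
  refine exists_modelCompanion_additiveSubgroups p (fun K _ _ _ => ?_) (isModelComplete_ACF p)
    (eliminatesExistsInfinity_of_fields isRingWithConstants_id (isModelComplete_ACF p)
      fun K _ _ _ => ?_) n
  · obtain ⟨F, hK, h1, h2⟩ := h K
    exact ⟨F, hK, h1, IsAlgClosed.instInfinite⟩
  · obtain ⟨F, hK, h1, h2⟩ := h K
    exact ⟨F, hK, inferInstance, isLaurentClosed_of_isAlgClosed K⟩

end AlgebraicallyClosed

/-! ### Perfect pseudo-algebraically closed fields -/

section PAC

theorem isRingWithConstants_lhomWithConstants (C : Type u) :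
    IsRingWithConstants (Language.ring.lhomWithConstants C) where
  rel n := ⟨fun r => by
    rcases r with r | r
    · exact Empty.elim r
    · exact isEmptyElim r⟩
  func n f := by
    rcases f with f | f
    · exact Or.inr ⟨f, rfl⟩
    · cases n with
      | zero => exact Or.inl rfl
      | succ n => exact isEmptyElim f

theorem exists_modelCompanion_PAC (p : ℕ) [Fact p.Prime] {C : Type u}
    {T : (Language.ring[[C]]).Theory}
    (h : ModelsAreFields.{u, 0, u} (Language.ring.lhomWithConstants C) T
      fun K _ => CharP K p ∧ PerfectField K ∧ IsPAC K)
    (hmc : IsModelComplete.{u, 0, u} T) (n : ℕ) :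
    ∃ TG : ((Language.ring[[C]]).sum (predLang n)).Theory, IsModelCompanion.{u, 0, u} TG
      (additiveSubgroupTheory (Language.ring.lhomWithConstants C) T n) := by
  refine exists_modelCompanion_additiveSubgroups p (fun K _ _ _ => ?_) hmc
    (eliminatesExistsInfinity_of_fields (isRingWithConstants_lhomWithConstants C) hmc
      fun K _ _ _ => ?_) n
  · obtain ⟨F, hK, h1, h2, h3⟩ := h K
    exact ⟨F, hK, h1, h3.isLaurentClosed.infinite⟩
  · obtain ⟨F, hK, h1, h2, h3⟩ := h K
    exact ⟨F, hK, h2, h3.isLaurentClosed⟩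

end PAC

end GenericSubspace



theorem theorem5p2 :
    -- vector subspaces over a finite field
    (∀ (F : Type) [Field F] [Finite F] (L : FirstOrder.Language.{u, v}) (ι : vecLang F →ᴸ L) (T : L.Theory),
      ContainsTheory ι T (infVecTheory F) →
      IsModelComplete.{u, v, max u v} T →
      EliminatesExistsInfinity.{u, v, max u v} T →
        IsSuitableTriple.{u, v, 0, 0, max u v} ι T (infVecTheory F) ∧
        (∃ TV : (L.sum (predLang 1)).Theory,
          IsModelCompanion.{u, v, max u v} TV (infiniteSubstructureTheory ι T 1)) ∧
        ∀ n : ℕ, ∃ TV : (L.sum (predLang n)).Theory,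
          IsModelCompanion.{u, v, max u v} TV (infiniteSubstructureTheory ι T n) ∧
          IsModelCompanion.{u, v, max u v} TV (substructureTheory ι T n)) ∧
    -- additive subgroups of fields of positive characteristic
    (∀ (p : ℕ) [Fact p.Prime] (L : FirstOrder.Language.{u, v}) (ι : Language.ring →ᴸ L) (T : L.Theory),
      ModelsAreFields.{u, v, max u v} ι T (fun K _ => CharP K p ∧ Infinite K) →
      IsModelComplete.{u, v, max u v} T →
      EliminatesExistsInfinity.{u, v, max u v} T →
        ∀ n : ℕ, ∃ TG : (L.sum (predLang n)).Theory,
          IsModelCompanion.{u, v, max u v} TG (additiveSubgroupTheory ι T n)) ∧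
    -- algebraically closed fields
    (∀ (p : ℕ) [Fact p.Prime] (n : ℕ), ∃ TG : (Language.ring.sum (predLang n)).Theory,
      IsModelCompanion.{0, 0, 0} TG
        (additiveSubgroupTheory (LHom.id Language.ring) (Theory.ACF p) n)) ∧
    -- perfect PAC fields, in the language of rings with additional constants
    (∀ (p : ℕ) [Fact p.Prime] (C : Type u) (T : (Language.ring[[C]]).Theory),
      ModelsAreFields.{u, 0, u} (Language.ring.lhomWithConstants C) T
        (fun K _ => CharP K p ∧ PerfectField K ∧ IsPAC K) →
      IsModelComplete.{u, 0, u} T →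
        ∀ n : ℕ, ∃ TG : ((Language.ring[[C]]).sum (predLang n)).Theory,
          IsModelCompanion.{u, 0, u} TG
            (additiveSubgroupTheory (Language.ring.lhomWithConstants C) T n)) := by
  refine ⟨?_, ?_, ?_, ?_⟩
  · intro F _ _ L ι T h hmc hT
    refine ⟨isSuitableTriple_vecLang h hmc hT, ?_, exists_modelCompanion_subspaces h hmc hT⟩
    obtain ⟨TV, hTV, _⟩ := exists_modelCompanion_subspaces h hmc hT 1
    exact ⟨TV, hTV⟩
  · intro p _ L ι T h hmc hT n
    exact exists_modelCompanion_additiveSubgroups p h hmc hT n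
  · intro p _ n
    exact exists_modelCompanion_ACF p n
  · intro p _ C T h hmc n
    exact exists_modelCompanion_PAC p h hmc n
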